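/- Let $T$ be a finite oriented two-dimensional simplicial complex homeomorphic to a closed disk, whose boundary is a 4-cycle with vertices $p,q,r,s$ (the corners) in the cyclic order determined by the orientation, and let $V$ be its vertex set. Let $\mathcal C$ be a finite set of subsets of $V$ (constraints), each of the form $C=\mathrm{Vertices}(S_C)$, where $S_C$ is a nonempty set of triangles of $T$ that is connected in the dual graph of $T$, the sets $S_C$ for distinct constraints being disjoint. The pair $\mathcal T=(T,\mathcal C)$ is called a constrained triangulation; a triangle of $T$ is living if no constraint contains all three of its vertices. A drawing of $\mathcal T$ is a map $\rho:V\to\mathbb C^2$ such that for each $C\in\mathcal C$ the set $\rho(C)$ lies on a complex affine line, and $\rho(p)+\rho(r)=\rho(q)+\rho(s)$. Let $\dot X(\mathcal T)\subset(\mathbb C^2)^V$ be the set of all drawings. A drawing $\rho$ is generic if moreover: no three consecutive points of the 4-gon $(\rho(p),\rho(q),\rho(r),\rho(s))$ are collinear; the three vertices of each living triangle have non-collinear images; $\rho$ is injective; and any two distinct constraints $C,C'$ with $C\cap C'\neq\emptyset$ are drawn on distinct lines. Let $X(\mathcal T)$ be the closure of the set of generic drawings in the usual topology of $(\mathbb C^2)^V$,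 and call $\mathcal T$ drawable if a generic drawing exists. Theorem. If $\mathcal T$ is drawable, then $\dot X(\mathcal T)$ is an affine algebraic variety, and $X(\mathcal T)$ is an irreducible rational affine variety over $\mathbb C$ (that is, it is Zariski closed and irreducible, and its function field is isomorphic over $\mathbb C$ to $\mathbb C(t_1,\dots,t_d)$ for some $d\ge 0$) which is one of the irreducible components of $\dot X(\mathcal T)$. -/

import Mathlib

noncomputable section

/-- A subset of affine space `ℂ^σ` is an affine variety (not necessarily irreducible) if it is the
common zero set of some polynomials. -/
def IsAffineVariety {σ : Type*} (Z : Set (σ → ℂ)) : Prop :=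
  ∃ I : Ideal (MvPolynomial σ ℂ), Z = MvPolynomial.zeroLocus ℂ I

/-- An irreducible affine variety: nonempty, and not covered by two affine varieties neither of
which contains it. -/
def IsIrreducibleVariety {σ : Type*} (Z : Set (σ → ℂ)) : Prop :=
  IsAffineVariety Z ∧ Z.Nonempty ∧
    ∀ Z₁ Z₂ : Set (σ → ℂ), IsAffineVariety Z₁ → IsAffineVariety Z₂ →
      Z ⊆ Z₁ ∪ Z₂ → Z ⊆ Z₁ ∨ Z ⊆ Z₂

/-- An irreducible affine variety is rational if its function field, the fraction field of its
coordinate ring, is isomorphic over `ℂ` to a field of rational functions in finitely many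
independent variables. -/
def IsRationalVariety {σ : Type*} (Z : Set (σ → ℂ)) : Prop :=
  IsIrreducibleVariety Z ∧ ∃ d : ℕ,
    Nonempty (FractionRing (MvPolynomial σ ℂ ⧸ MvPolynomial.vanishingIdeal ℂ Z) ≃ₐ[ℂ]
      FractionRing (MvPolynomial (Fin d) ℂ))

/-- `Z` is an irreducible component of `W`: a maximal irreducible closed subset of `W`. -/
def IsIrreducibleComponent {σ : Type*} (Z W : Set (σ → ℂ)) : Prop :=
  Maximal (fun Y : Set (σ → ℂ) => IsIrreducibleVariety Y ∧ Y ⊆ W) Z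

/-- The geometric realization of a simplicial complex on a finite vertex set, in barycentric
coordinates. -/
def AbstractSimplicialComplex.realization {V : Type*} [Fintype V]
    (K : AbstractSimplicialComplex V) : Set (V → ℝ) :=
  {x | x ∈ stdSimplex ℝ V ∧ ∃ s ∈ K.faces, ∀ v, x v ≠ 0 → v ∈ s}

/-- A two-dimensional simplicial complex with vertex set `V`, each of whose faces lies in a
triangle, together with an orientation: `pos a b c` says that `{a, b, c}` is a triangle and that
`(a, b, c)` is its positive cyclic order.  Two triangles with a common edge induce opposite
directions on that edge. -/
structure OrientedComplex (V : Type*) [DecidableEq V] extends AbstractSimplicialComplex V where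
  pos : V → V → V → Prop
  pos_rotate : ∀ a b c, pos a b c → pos b c a
  pos_ne : ∀ a b c, pos a b c → a ≠ b
  pos_asymm : ∀ a b c, pos a b c → ¬ pos b a c
  mem_faces_iff : ∀ a b c, a ≠ b → b ≠ c → a ≠ c →
    ({a, b, c} ∈ faces ↔ pos a b c ∨ pos b a c)
  pure : ∀ s ∈ faces, ∃ a b c, pos a b c ∧ s ⊆ {a, b, c}
  coherent : ∀ a b c d, pos a b c → pos a b d → c = d

namespace OrientedComplex

variable {V : Type*} [DecidableEq V] (T : OrientedComplex V)

/-- The triangles (2-cells) of the complex. -/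
def Triangle : Type _ := {t : Finset V // t ∈ T.faces ∧ t.card = 3}

/-- The dual graph: the vertices are the triangles, and two triangles are adjacent when they have
an edge in common. -/
def dualGraph : SimpleGraph T.Triangle where
  Adj s t := (s.1 ∩ t.1).card = 2
  symm := ⟨fun s t h => by rw [Finset.inter_comm]; exact h⟩
  loopless := ⟨fun s h => by
    have h3 := s.2.2
    rw [Finset.inter_self] at h
    omega⟩

/-- `(a, b)` is an edge of a positively oriented triangle and `{a, b}` is in no other triangle. -/
def IsBoundaryEdge (a b : V) : Prop :=
  (∃ c, T.pos a b c) ∧ ¬ ∃ d, T.pos b a d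

end OrientedComplex

/-- A constrained triangulation `(T, 𝒞)` with four corners: `T` is an oriented simplicial complex
homeomorphic to a disk, whose boundary is a 4-cycle with vertices
`p = corner 0`, `q = corner 1`, `r = corner 2`, `s = corner 3`, in the cyclic order determined by
the orientation; each constraint is the vertex set of a contiguous set of triangles, and these sets
of triangles can be taken disjoint for distinct constraints. -/
structure ConstrainedTriangulation (V : Type*) [Fintype V] [DecidableEq V] extends
    OrientedComplex V where
  disk : Nonempty (toAbstractSimplicialComplex.realization ≃ₜ
    Metric.closedBall (0 : EuclideanSpace ℝ (Fin 2)) 1)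
  corner : Fin 4 → V
  corner_injective : Function.Injective corner
  boundary_iff : ∀ a b, toOrientedComplex.IsBoundaryEdge a b ↔
    ∃ i : Fin 4, a = corner i ∧ b = corner (i + 1)
  constraints : Finset (Finset V)
  contiguous : ∃ S : Finset V → Set toOrientedComplex.Triangle,
    (∀ C ∈ constraints, (toOrientedComplex.dualGraph.induce (S C)).Connected ∧
      ∀ v, v ∈ C ↔ ∃ t ∈ S C, v ∈ t.1) ∧
    ∀ C ∈ constraints, ∀ C' ∈ constraints, C ≠ C' → Disjoint (S C) (S C')

namespace ConstrainedTriangulation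

variable {V : Type*} [Fintype V] [DecidableEq V] (T : ConstrainedTriangulation V)

/-- A triangle of `T` is alive if no constraint contains all its vertices. -/
def IsAlive (t : T.Triangle) : Prop := ∀ C ∈ T.constraints, ¬ t.1 ⊆ C

/-- A drawing: each constraint is drawn on a line, and the corners form a possibly degenerate
parallelogram. -/
def IsDrawing (ρ : V → Fin 2 → ℂ) : Prop :=
  (∀ C ∈ T.constraints, Collinear ℂ (ρ '' (C : Set V))) ∧
    ρ (T.corner 0) + ρ (T.corner 2) = ρ (T.corner 1) + ρ (T.corner 3)

/-- A generic drawing.  Each constraint has at least three vertices, so once `ρ` is injective the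
line on which a constraint is drawn is the affine span of the images of its vertices. -/
def IsGenericDrawing (ρ : V → Fin 2 → ℂ) : Prop :=
  T.IsDrawing ρ ∧
    (∀ i : Fin 4, ¬ Collinear ℂ
      {ρ (T.corner i), ρ (T.corner (i + 1)), ρ (T.corner (i + 2))}) ∧
    (∀ t : T.Triangle, T.IsAlive t → ¬ Collinear ℂ (ρ '' (t.1 : Set V))) ∧
    Function.Injective ρ ∧
    ∀ C ∈ T.constraints, ∀ C' ∈ T.constraints, C ≠ C' → (C ∩ C').Nonempty →
      affineSpan ℂ (ρ '' (C : Set V)) ≠ affineSpan ℂ (ρ '' (C' : Set V))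

/-- `T` is drawable if it has a generic drawing. -/
def Drawable : Prop := ∃ ρ, T.IsGenericDrawing ρ

/-- The map `V → ℂ²` with given coordinates; it identifies `ℂ^(V × {0, 1})` with `(ℂ²)^V`. -/
def ofCoords (x : V × Fin 2 → ℂ) : V → Fin 2 → ℂ := fun v j => x (v, j)

/-- The space of all drawings, as a subset of `(ℂ²)^V`. -/
def drawingSpace : Set (V × Fin 2 → ℂ) := {x | T.IsDrawing (ofCoords x)}

/-- The closure, in the usual topology of `(ℂ²)^V`, of the set of generic drawings. -/
def genericDrawingSpace : Set (V × Fin 2 → ℂ) :=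
  closure {x | T.IsGenericDrawing (ofCoords x)}

end ConstrainedTriangulation

end

/-! Call the vertices and the constraints nodes. Start from the four corners and add the other nodes
one at a time. Suppose that each new node is incident to at most two earlier ones. A new point is
then free in the plane, free on one line, or the intersection of two lines, and dually for a new
line. All coordinates thus become rational functions of independent parameters, and the result is a
generic point over a purely transcendental extension of `ℂ`.

The order exists by planarity (`exists_card_filter_adj_le_two`). In a generic drawing two
constraints share at most one vertex, so every cycle of the incidence graph has length at least six.
This graph can be drawn in the disk, since each constraint occupies a connected region of triangles
and the regions are disjoint. Euler's formula then gives `2 E + 6 ≤ 3 N` for `E` incidences between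
`N ≥ 4` nodes (`two_mul_card_incidence_add_six_le`). If every node outside the corners had degree at
least three, the corners could lower the count by at most 4, which is less than 6. Planarity is used
in homological form modulo 2: a disk has no first cohomology (`exists_eq_add_of_cocycle`), and
removing a point does not disconnect it, so that links of vertices are connected
(`reflTransGen_of_mem`). It follows that each cycle of the incidence graph is a coboundary of a
function on its faces (`exists_coboundary_eq`).

Every generic drawing whose vertices have distinct abscissas is a specialization of the generic
point, and these drawings are dense among the generic ones. Conversely, suitable specializations of
the generic point are generic drawings, because genericity is a Zariski open condition on drawings.
Hence the ideal of the generic drawings is the kernel of evaluation at the generic point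
(`exists_generic_point`). It is therefore prime, and its function field is generated by the free
parameters, because slope and intercept of a line are rational in the coordinates of two of its
points.

Finally, a nonempty Zariski open subset of an irreducible complex variety is dense in the usual
topology (`zeroLocus_subset_closure`). So the two closures of the set of generic drawings coincide,
and openness in the space of drawings makes this closure an irreducible component. -/

/-! ### Topology of the disk and first cohomology modulo 2 -/

open Metric in
theorem isPreconnected_closedBall_diff_singleton (x : EuclideanSpace ℝ (Fin 2)) :
    IsPreconnected (closedBall (0 : EuclideanSpace ℝ (Fin 2)) 1 \ {x}) := by
  have hrank : 1 < Module.rank ℝ (EuclideanSpace ℝ (Fin 2)) := by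
    rw [← Module.finrank_eq_rank, finrank_euclideanSpace_fin]
    norm_num
  have hball : IsPreconnected (ball (0 : EuclideanSpace ℝ (Fin 2)) 1 \ {x}) := by
    by_cases hx : x ∈ ball (0 : EuclideanSpace ℝ (Fin 2)) 1
    -- The open disk is homeomorphic to the plane, and the plane minus a point is connected.
    · obtain ⟨x', hx'⟩ := (Homeomorph.unitBall (E := EuclideanSpace ℝ (Fin 2))).surjective ⟨x, hx⟩
      have h := ((Set.countable_singleton x').isConnected_compl_of_one_lt_rank
        hrank).isPreconnected.image
        (fun y => ((Homeomorph.unitBall y : ball (0 : EuclideanSpace ℝ (Fin 2)) 1) :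
          EuclideanSpace ℝ (Fin 2)))
        (continuous_subtype_val.comp Homeomorph.unitBall.continuous).continuousOn
      convert h using 1
      ext y
      constructor
      · rintro ⟨hy, hyx⟩
        obtain ⟨y', hy'⟩ := (Homeomorph.unitBall (E := EuclideanSpace ℝ (Fin 2))).surjective ⟨y, hy⟩
        refine ⟨y', ?_, by simp [hy']⟩
        rintro rfl
        rw [hx'] at hy'
        exact hyx (congrArg Subtype.val hy').symm
      · rintro ⟨y', hy', rfl⟩
        refine ⟨(Homeomorph.unitBall y').2, fun h => hy' ?_⟩
        apply Homeomorph.unitBall.injective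
        rw [hx']
        exact Subtype.ext h
    · rw [Set.sdiff_singleton_eq_self hx]
      exact (convex_ball _ _).isPreconnected
  -- The punctured closed disk lies between the punctured open disk and its closure.
  refine hball.subset_closure (Set.sdiff_subset_sdiff_left ball_subset_closedBall) ?_
  rintro y ⟨hy, hyx⟩
  rw [← closure_ball _ one_ne_zero] at hy
  rw [Set.sdiff_eq, Set.inter_comm]
  exact isOpen_compl_singleton.inter_closure ⟨hyx, hy⟩

/-- The character of `ℤ/2` with values `±1`. -/
def zmodTwoSign (k : ZMod 2) : ℝ := if k = 0 then 1 else -1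

theorem zmodTwoSign_add (k l : ZMod 2) : zmodTwoSign (k + l) = zmodTwoSign k * zmodTwoSign l := by
  have h : ∀ k : ZMod 2, k = 0 ∨ k = 1 := by decide
  have h2 : (1 : ZMod 2) + 1 = 0 := rfl
  rcases h k with rfl | rfl <;> rcases h l with rfl | rfl <;> simp [zmodTwoSign, h2]

theorem abs_zmodTwoSign (k : ZMod 2) : |zmodTwoSign k| = 1 := by
  unfold zmodTwoSign; split_ifs <;> norm_num

theorem zmodTwoSign_injective : Function.Injective zmodTwoSign := by
  have h : ∀ k : ZMod 2, k = 0 ∨ k = 1 := by decide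
  intro k l hkl
  rcases h k with rfl | rfl <;> rcases h l with rfl | rfl <;> simp [zmodTwoSign] at hkl <;>
    first | rfl | linarith

namespace AbstractSimplicialComplex

variable {V : Type*} [Fintype V] [DecidableEq V] (K : AbstractSimplicialComplex V)

/-- The double cover of the realization attached to a function on the edges with values in `ℤ/2`:
the points are those of the realization with signs attached to their coordinates. -/
def doubleCover (f : Finset V → ZMod 2) : Set (V → ℝ) :=
  {y | (fun v => |y v|) ∈ K.realization ∧
    ∀ a b, a ≠ b → y a * y b = zmodTwoSign (f {a, b}) * (|y a| * |y b|)}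

variable {K} {f : Finset V → ZMod 2}

/-- The projection of the double cover. -/
def doubleCoverProj (y : K.doubleCover f) : K.realization := ⟨fun v => |y.1 v|, y.2.1⟩

theorem continuous_doubleCover_apply (v : V) : Continuous fun y : K.doubleCover f => y.1 v :=
  (continuous_apply v).comp continuous_subtype_val

theorem continuous_doubleCoverProj : Continuous (doubleCoverProj (K := K) (f := f)) := by
  exact Continuous.subtype_mk (continuous_pi fun v => (continuous_doubleCover_apply v).abs) _

instance : SMul ℤˣ (K.doubleCover f) where
  smul u y := ⟨fun v => ((u : ℤ) : ℝ) * y.1 v, by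
    have hu : |((u : ℤ) : ℝ)| = 1 := by
      rcases Int.units_eq_one_or u with rfl | rfl <;> simp
    have hu' : ((u : ℤ) : ℝ) * ((u : ℤ) : ℝ) = 1 := by
      rcases Int.units_eq_one_or u with rfl | rfl <;> simp
    refine ⟨by simpa [abs_mul, hu] using y.2.1, fun a b hab => ?_⟩
    have := y.2.2 a b hab
    simp only [abs_mul, hu, one_mul]
    rw [← this]
    linear_combination (y.1 a * y.1 b) * hu'⟩

theorem coe_units_smul (u : ℤˣ) (y : K.doubleCover f) (v : V) :
    (u • y).1 v = ((u : ℤ) : ℝ) * y.1 v := rfl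

instance : MulAction ℤˣ (K.doubleCover f) where
  one_smul y := by ext v; simp [coe_units_smul]
  mul_smul u u' y := by ext v; simp [coe_units_smul, mul_assoc]

omit [DecidableEq V] in
theorem exists_pos_of_mem_realization {x : V → ℝ} (hx : x ∈ K.realization) : ∃ v, 0 < x v := by
  by_contra! h
  have h1 : ∑ v, x v ≤ 0 := Finset.sum_nonpos fun v _ => h v
  rw [hx.1.2] at h1
  linarith

omit [DecidableEq V] in
theorem mem_faces_of_mem_realization {x : V → ℝ} (hx : x ∈ K.realization) {s : Finset V}
    (hs : s.Nonempty) (hxs : ∀ v ∈ s, x v ≠ 0) : s ∈ K.faces := by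
  obtain ⟨-, t, ht, h⟩ := hx
  exact (K.isRelLowerSet_faces ht).2 (fun v hv => h v (hxs v hv)) hs

/-- Give a vertex `u` of the support of `x` the sign `+` and each other vertex `v` the sign of `f
{u, v}`. The cocycle condition on `{u, a, b}` says that the signs of `a` and `b` are related as `f
{a, b}` demands. -/
theorem doubleCoverProj_surjective
    (hf : ∀ a b c, a ≠ b → b ≠ c → a ≠ c → {a, b, c} ∈ K.faces →
      f {a, b} + f {b, c} + f {a, c} = 0) :
    Function.Surjective (doubleCoverProj (K := K) (f := f)) := by
  rintro ⟨x, hx⟩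
  obtain ⟨u, hu⟩ := exists_pos_of_mem_realization hx
  have hx0 : ∀ v, |x v| = x v := fun v => abs_of_nonneg (hx.1.1 v)
  let σ : V → ℝ := fun v => if v = u then 1 else zmodTwoSign (f {u, v})
  have hσ : ∀ v, |σ v * x v| = x v := by
    intro v
    rw [abs_mul, hx0]
    simp only [σ]
    split_ifs <;> simp [abs_zmodTwoSign]
  refine ⟨⟨fun v => σ v * x v, by simpa only [hσ] using hx, fun a b hab => ?_⟩,
    Subtype.ext (funext hσ)⟩
  simp only [hσ]
  by_cases ha : x a = 0
  · simp [ha]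
  by_cases hb : x b = 0
  · simp [hb]
  suffices σ a * σ b = zmodTwoSign (f {a, b}) by rw [← this]; ring
  by_cases hau : a = u
  · have hbu : b ≠ u := fun h => hab (hau.trans h.symm)
    simp [σ, hau, hbu]
  by_cases hbu : b = u
  · simp [σ, hau, hbu, Finset.pair_comm]
  have h := hf u a b (Ne.symm hau) hab (Ne.symm hbu)
    (mem_faces_of_mem_realization hx (by simp) (by simp [ha, hb, hu.ne']))
  have h2 : f {a, b} = f {u, a} + f {u, b} := by
    have := CharTwo.add_self_eq_zero (f {u, a})
    have := CharTwo.add_self_eq_zero (f {u, b})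
    linear_combination h - CharTwo.add_self_eq_zero (f {u, a}) -
      CharTwo.add_self_eq_zero (f {u, b})
  simp [σ, hau, hbu, h2, zmodTwoSign_add]

theorem isCompact_doubleCover (h : IsCompact K.realization) : IsCompact (K.doubleCover f) := by
  have hc : Continuous fun (y : V → ℝ) v => |y v| := by fun_prop
  refine (isCompact_univ_pi fun _ : V => isCompact_Icc (a := (-1 : ℝ)) (b := 1)).of_isClosed_subset
    ?_ ?_
  · refine (h.isClosed.preimage hc).inter ?_
    have : {y : V → ℝ | ∀ a b, a ≠ b → y a * y b = zmodTwoSign (f {a, b}) * (|y a| * |y b|)} =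
        ⋂ a, ⋂ b, ⋂ (_ : a ≠ b), {y | y a * y b = zmodTwoSign (f {a, b}) * (|y a| * |y b|)} := by
      ext; simp
    change IsClosed {y : V → ℝ | ∀ a b, a ≠ b →
      y a * y b = zmodTwoSign (f {a, b}) * (|y a| * |y b|)}
    rw [this]
    exact isClosed_iInter fun a => isClosed_iInter fun b => isClosed_iInter fun _ =>
      isClosed_eq (by fun_prop) (by fun_prop)
  · rintro y ⟨hy, -⟩ v -
    rw [Set.mem_Icc, ← abs_le]
    have := Finset.single_le_sum (f := fun v => |y v|) (fun i _ => hy.1.1 i) (Finset.mem_univ v)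
    rw [hy.1.2] at this
    exact this

/-- A continuous surjection from a compact space to a Hausdorff space is a quotient map. Once the
sign of one nonzero coordinate is known, the relations fix all the others, so the fibres are the
pairs `{y, -y}`. The points at which a given coordinate has a fixed sign form an open set disjoint
from its negative. -/
theorem isQuotientCoveringMap_doubleCoverProj (h : IsCompact K.realization)
    (hf : ∀ a b c, a ≠ b → b ≠ c → a ≠ c → {a, b, c} ∈ K.faces →
      f {a, b} + f {b, c} + f {a, c} = 0) :
    IsQuotientCoveringMap (doubleCoverProj (K := K) (f := f)) ℤˣ := by
  have : CompactSpace (K.doubleCover f) := isCompact_iff_compactSpace.mp (isCompact_doubleCover h)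
  have hpos : ∀ y : K.doubleCover f, ∃ v, y.1 v ≠ 0 := fun y => by
    obtain ⟨v, hv⟩ := exists_pos_of_mem_realization y.2.1
    exact ⟨v, abs_pos.mp hv⟩
  refine { continuous_doubleCoverProj.isClosedMap.isQuotientMap continuous_doubleCoverProj
    (doubleCoverProj_surjective hf) with
    continuous_const_smul := ?_, apply_eq_iff_mem_orbit := ?_, disjoint := ?_ }
  · intro u
    exact Continuous.subtype_mk (continuous_pi fun v =>
      continuous_const.mul (continuous_doubleCover_apply v)) _
  · intro y z
    constructor
    · intro hyz
      have habs : ∀ v, |y.1 v| = |z.1 v| := fun v => congrFun (congrArg Subtype.val hyz) v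
      obtain ⟨v, hv⟩ := hpos z
      have key : ∀ ε : ℝ, ε * ε = 1 → y.1 v = ε * z.1 v → ∀ w, y.1 w = ε * z.1 w := by
        intro ε hε hvε w
        by_cases hwv : v = w
        · rw [← hwv, hvε]
        have h1 := y.2.2 v w hwv
        have h2 := z.2.2 v w hwv
        rw [habs, habs, ← h2, hvε] at h1
        have : z.1 v * (ε * y.1 w - z.1 w) = 0 := by linear_combination h1
        have := (mul_eq_zero.mp this).resolve_left hv
        linear_combination ε * this - y.1 w * hε
      rcases abs_eq_abs.mp (habs v) with h | h
      · refine ⟨1, ?_⟩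
        ext w
        simpa using (key 1 (by norm_num) (by simpa using h) w).symm
      · refine ⟨-1, ?_⟩
        ext w
        have := key (-1) (by norm_num) (by simpa using h) w
        simp [coe_units_smul, this]
    · rintro ⟨u, rfl⟩
      refine Subtype.ext (funext fun v => ?_)
      rcases Int.units_eq_one_or u with rfl | rfl <;> simp [doubleCoverProj, coe_units_smul]
  · intro y
    obtain ⟨v, hv⟩ := hpos y
    refine ⟨{z | 0 < y.1 v * z.1 v}, ?_, ?_⟩
    · refine (isOpen_lt continuous_const
        (continuous_const.mul (continuous_doubleCover_apply v))).mem_nhds (mul_self_pos.mpr hv)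
    · rintro u ⟨_, ⟨z, hz, rfl⟩, hz'⟩
      rcases Int.units_eq_one_or u with rfl | rfl
      · rfl
      · simp only [Set.mem_ofPred_eq, coe_units_smul] at hz hz'
        push_cast at hz'
        linarith

/-- A contractible complex has no first cohomology mod `2`. -/
theorem exists_eq_add_of_cocycle [CompactSpace K.realization] [ContractibleSpace K.realization]
    (hf : ∀ a b c, a ≠ b → b ≠ c → a ≠ c → {a, b, c} ∈ K.faces →
      f {a, b} + f {b, c} + f {a, c} = 0) :
    ∃ g : V → ZMod 2, ∀ a b, a ≠ b → {a, b} ∈ K.faces → f {a, b} = g a + g b := by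
  have cov := (isQuotientCoveringMap_doubleCoverProj
    (isCompact_iff_compactSpace.mpr inferInstance) hf).isCoveringMap
  obtain ⟨x₀, ⟨H⟩⟩ := id_nullhomotopic K.realization
  obtain ⟨e, he⟩ := doubleCoverProj_surjective hf x₀
  -- Lift the contraction, run backwards from the constant map to the identity. The end of the lift
  -- is a section of the double cover.
  let L := cov.liftHomotopy H.symm.toContinuousMap (ContinuousMap.const _ e)
    (fun a => by simp [he])
  have hL := cov.liftHomotopy_lifts H.symm.toContinuousMap (ContinuousMap.const _ e)
    (fun a => by simp [he])
  let σ : C(K.realization, K.doubleCover f) := L.comp ((ContinuousMap.const _ 1).prodMk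
    (ContinuousMap.id _))
  have hσ : ∀ x v, |(σ x).1 v| = x.1 v := by
    intro x v
    have h1 := congrFun hL (1, x)
    have h2 : H.symm.toContinuousMap (1, x) = x := by simp
    rw [h2] at h1
    exact congrFun (congrArg Subtype.val h1) v
  have hvert : ∀ v : V, Pi.single v (1 : ℝ) ∈ K.realization := fun v =>
    ⟨single_mem_stdSimplex ℝ v, {v}, K.singleton_mem v, fun w hw => by
      by_contra h
      simp only [Finset.mem_singleton] at h
      exact hw (Pi.single_eq_of_ne h _)⟩
  -- On the open star of `v`, the sign of the coordinate `v` of the section is constant: this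
  -- coordinate does not vanish along the segment from `x` to the vertex.
  have hsign : ∀ (x : K.realization) (v : V), 0 < x.1 v →
      0 < (σ x).1 v * (σ ⟨_, hvert v⟩).1 v := by
    intro x v hv
    have hseg : ∀ t : unitInterval, (fun w => (1 - t.1) * x.1 w + t.1 * (Pi.single v (1 : ℝ) : V → ℝ) w) ∈
        K.realization := by
      intro t
      refine ⟨?_, ?_⟩
      · exact convex_stdSimplex ℝ V x.2.1 (hvert v).1 (by linarith [t.2.2]) t.2.1 (by ring)
      · obtain ⟨s, hs, hxs⟩ := x.2.2
        refine ⟨s, hs, fun w hw => ?_⟩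
        by_cases hwv : w = v
        · rw [hwv]; exact hxs v hv.ne'
        · refine hxs w fun h0 => hw ?_
          simp [h0, hwv]
    let p : unitInterval → K.realization := fun t => ⟨_, hseg t⟩
    have hp : Continuous p := by
      refine Continuous.subtype_mk ?_ _
      fun_prop
    let h : unitInterval → ℝ := fun t => (σ (p t)).1 v
    have hh : Continuous h := by
      have : Continuous fun t => (σ (p t)).1 := continuous_subtype_val.comp (σ.continuous.comp hp)
      exact (continuous_apply v).comp this
    have hne : ∀ t, h t ≠ 0 := by
      intro t h0
      have h1 := hσ (p t) v
      change |h t| = _ at h1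
      rw [h0, abs_zero] at h1
      have h2 : (p t).1 v = (1 - t.1) * x.1 v + t.1 := by simp [p]
      rw [h2] at h1
      have h3 := t.2.1
      have h4 := t.2.2
      by_cases h5 : t.1 = 0
      · rw [h5] at h1; linarith
      · have : 0 < t.1 := lt_of_le_of_ne h3 (Ne.symm h5)
        nlinarith
    have hp0 : p 0 = x := Subtype.ext (by ext w; simp [p])
    have hp1 : p 1 = ⟨_, hvert v⟩ := Subtype.ext (by ext w; simp [p])
    have e0 : h 0 = (σ x).1 v := by simp only [h, hp0]
    have e1 : h 1 = (σ ⟨_, hvert v⟩).1 v := by simp only [h, hp1]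
    rw [← e0, ← e1]
    have hpre := isPreconnected_range hh
    by_contra hcon
    have hmem : (0 : ℝ) ∈ Set.range h := by
      rcases lt_or_gt_of_ne (hne 0) with h0 | h0
      · exact hpre.Icc_subset ⟨0, rfl⟩ ⟨1, rfl⟩ ⟨h0.le, by
          by_contra! h1; exact hcon (mul_pos_of_neg_of_neg h0 h1)⟩
      · exact hpre.Icc_subset ⟨1, rfl⟩ ⟨0, rfl⟩ ⟨by
          by_contra! h1; exact hcon (mul_pos h0 h1), h0.le⟩
    obtain ⟨t, ht⟩ := hmem
    exact hne t ht
  -- The primitive of `f` records the sign of the section at each vertex.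
  let g : V → ZMod 2 := fun v => if 0 < (σ ⟨_, hvert v⟩).1 v then 0 else 1
  have hg : ∀ v, (σ ⟨_, hvert v⟩).1 v = zmodTwoSign (g v) := by
    intro v
    have h1 := hσ ⟨_, hvert v⟩ v
    simp only [Pi.single_eq_same] at h1
    by_cases h : 0 < (σ ⟨_, hvert v⟩).1 v
    · simp only [g, h, if_true, zmodTwoSign]
      rwa [abs_of_pos h] at h1
    · simp only [g, h, if_false, zmodTwoSign]
      rw [abs_of_nonpos (not_lt.mp h)] at h1
      simp only [one_ne_zero, if_false]
      linarith
  refine ⟨g, fun a b hab hface => ?_⟩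
  -- The midpoint of the edge lies in the stars of both ends, so there both signs can be compared
  -- with the sign relation of the double cover.
  let m : V → ℝ := fun v =>
    (1 / 2) * (Pi.single a (1 : ℝ) : V → ℝ) v + (1 / 2) * (Pi.single b (1 : ℝ) : V → ℝ) v
  have hm : m ∈ K.realization := by
    refine ⟨convex_stdSimplex ℝ V (hvert a).1 (hvert b).1 (by norm_num) (by norm_num)
      (by norm_num), {a, b}, hface, fun v hv => ?_⟩
    by_contra h
    simp only [Finset.mem_insert, Finset.mem_singleton, not_or] at h
    exact hv (by simp [m, h.1, h.2])
  have hma : m a = 1 / 2 := by simp [m, hab]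
  have hmb : m b = 1 / 2 := by simp [m, hab.symm]
  have hva := hsign ⟨m, hm⟩ a (by change 0 < m a; rw [hma]; norm_num)
  have hvb := hsign ⟨m, hm⟩ b (by change 0 < m b; rw [hmb]; norm_num)
  have habsa := hσ ⟨m, hm⟩ a
  have habsb := hσ ⟨m, hm⟩ b
  have hprod := (σ ⟨m, hm⟩).2.2 a b hab
  simp only [hma, hmb] at habsa habsb
  rw [hg] at hva hvb
  have half : ∀ (k : ZMod 2) (r : ℝ), |r| = 1 / 2 → 0 < r * zmodTwoSign k →
      r = zmodTwoSign k / 2 := by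
    intro k r hr hpos
    unfold zmodTwoSign at hpos ⊢
    split_ifs at hpos ⊢ with hk
    · rw [abs_of_pos (by linarith)] at hr; linarith
    · rw [abs_of_neg (by linarith)] at hr; linarith
  rw [habsa, habsb, half _ _ habsa hva, half _ _ habsb hvb] at hprod
  apply zmodTwoSign_injective
  rw [zmodTwoSign_add]
  linarith

/-- If the complement of a vertex in the realization is connected, then the complement of the
vertex in the complex is connected: a function that is constant on the edges is constant. -/
theorem eq_of_isPreconnected_diff (v : V)
    (hv : IsPreconnected (K.realization \ {Pi.single v (1 : ℝ)})) (g : V → ZMod 2)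
    (hg : ∀ a b, a ≠ v → b ≠ v → a ≠ b → {a, b} ∈ K.faces → g a = g b)
    {a b : V} (ha : a ≠ v) (hb : b ≠ v) : g a = g b := by
  by_contra hab
  -- The unions of open stars of the vertices other than `v` on which `g` has a given value. Two of
  -- them cover the complement of `v`, and a common point has in its support an edge along which `g`
  -- changes.
  let U : ZMod 2 → Set (V → ℝ) := fun k => {x | ∃ w, w ≠ v ∧ g w = k ∧ 0 < x w}
  have hU : ∀ k, IsOpen (U k) := by
    intro k
    have : U k = ⋃ w, ⋃ (_ : w ≠ v ∧ g w = k), {x | 0 < x w} := by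
      ext x; simp [U, and_assoc]
    rw [this]
    exact isOpen_iUnion fun w => isOpen_iUnion fun _ => isOpen_lt continuous_const
      (continuous_apply w)
  have hvert : ∀ w, w ≠ v → Pi.single w (1 : ℝ) ∈ K.realization \ {Pi.single v (1 : ℝ)} :=
    fun w hw => ⟨⟨single_mem_stdSimplex ℝ w, {w}, K.singleton_mem w, fun u hu => by
      by_contra h
      simp only [Finset.mem_singleton] at h
      exact hu (Pi.single_eq_of_ne h _)⟩, fun h => by
        have := congrFun h w
        simp [hw] at this⟩
  have hk : ∀ k : ZMod 2, k ≠ g a → k = g b := by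
    intro k hk
    generalize g a = x at *
    generalize g b = y at *
    revert x y k
    decide
  obtain ⟨x, hx, ⟨w, hw, hwa, hxw⟩, w', hw', hwb, hxw'⟩ := hv (U (g a)) (U (g b)) (hU _) (hU _)
    (by
      rintro x ⟨hx, hxv⟩
      obtain ⟨w, hw, hxw⟩ : ∃ w, w ≠ v ∧ 0 < x w := by
        by_contra! h
        have h0 : ∀ w, w ≠ v → x w = 0 := fun w hw => le_antisymm (h w hw) (hx.1.1 w)
        have h1 : x v = 1 := by
          rw [← hx.1.2, Finset.sum_eq_single v (fun w _ hw => h0 w hw) (by simp)]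
        apply hxv
        ext w
        by_cases hwv : w = v
        · rw [hwv, h1]; simp
        · rw [h0 w hwv]; simp [hwv]
      by_cases h : g w = g a
      · exact Or.inl ⟨w, hw, h, hxw⟩
      · exact Or.inr ⟨w, hw, hk _ h, hxw⟩)
    ⟨_, hvert a ha, a, ha, rfl, by simp⟩ ⟨_, hvert b hb, b, hb, rfl, by simp⟩
  refine hab ?_
  rw [← hwa, ← hwb]
  by_cases hww : w = w'
  · rw [hww]
  · exact hg w w' hw hw' hww
      (mem_faces_of_mem_realization hx.1 (by simp) (by simp [hxw.ne', hxw'.ne']))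

omit [DecidableEq V] in
theorem isPreconnected_realization_diff
    (φ : K.realization ≃ₜ Metric.closedBall (0 : EuclideanSpace ℝ (Fin 2)) 1) (x : V → ℝ)
    (hx : x ∈ K.realization) : IsPreconnected (K.realization \ {x}) := by
  have h := isPreconnected_closedBall_diff_singleton (φ ⟨x, hx⟩)
  have h2 : IsPreconnected ((fun y => (y : EuclideanSpace ℝ (Fin 2))) ⁻¹'
      (Metric.closedBall (0 : EuclideanSpace ℝ (Fin 2)) 1 \ {(φ ⟨x, hx⟩ : EuclideanSpace ℝ (Fin 2))}) :
      Set (Metric.closedBall (0 : EuclideanSpace ℝ (Fin 2)) 1)) := by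
    rw [← Topology.IsInducing.subtypeVal.isPreconnected_image]
    rwa [Set.image_preimage_eq_of_subset]
    rintro y ⟨hy, -⟩
    exact ⟨⟨y, hy⟩, rfl⟩
  have h3 := h2.image (fun y => (φ.symm y : V → ℝ))
    (continuous_subtype_val.comp φ.symm.continuous).continuousOn
  convert h3 using 1
  ext z
  constructor
  · rintro ⟨hz, hzx⟩
    refine ⟨φ ⟨z, hz⟩, ⟨(φ ⟨z, hz⟩).2, fun h => hzx ?_⟩, by simp⟩
    have := φ.injective (Subtype.ext h)
    exact congrArg Subtype.val this
  · rintro ⟨y, ⟨hy, hyx⟩, rfl⟩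
    refine ⟨(φ.symm y).2, fun h => hyx ?_⟩
    have : φ.symm y = ⟨x, hx⟩ := Subtype.ext h
    rw [← this]
    simp

end AbstractSimplicialComplex

/-! ### Linear algebra over `ℤ/2` -/

open Finset in
/-- On a connected finite set, the functions with values in `ℤ/2` and zero sum are spanned by
the sums of two adjacent points. -/
theorem Submodule.mem_of_sum_eq_zero {α : Type*} [DecidableEq α] [Fintype α]
    (P : Submodule (ZMod 2) (α → ZMod 2)) (s : Finset α) (R : α → α → Prop)
    (hR : ∀ a ∈ s, ∀ b ∈ s, Relation.ReflTransGen R a b)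
    (hP : ∀ a b, R a b → Pi.single a 1 + Pi.single b 1 ∈ P)
    (c : α → ZMod 2) (hc : ∀ a ∉ s, c a = 0) (hsum : ∑ a ∈ s, c a = 0) : c ∈ P := by
  rcases s.eq_empty_or_nonempty with rfl | ⟨a₀, ha₀⟩
  · have : c = 0 := funext fun a => hc a (by simp)
    rw [this]
    exact P.zero_mem
  have hchar : ∀ x : α → ZMod 2, x + x = 0 := fun x => funext fun a =>
    CharTwo.add_self_eq_zero (x a)
  -- The sums along a path from `a₀` to `a` telescope.
  have key : ∀ a ∈ s, (Pi.single a₀ 1 + Pi.single a 1 : α → ZMod 2) ∈ P := by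
    intro a ha
    have hreach := hR a₀ ha₀ a ha
    clear ha
    induction hreach with
    | refl =>
      rw [hchar]
      exact P.zero_mem
    | tail _ h ih =>
      rename_i b d _
      have := P.add_mem ih (hP _ _ h)
      have e : (Pi.single a₀ 1 + Pi.single b 1 + (Pi.single b 1 + Pi.single d 1) : α → ZMod 2) =
          Pi.single a₀ 1 + Pi.single d 1 := by
        have := hchar (Pi.single b 1 : α → ZMod 2)
        linear_combination this
      rwa [e] at this
  have hsum' : c = ∑ a ∈ s, c a • (Pi.single a₀ 1 + Pi.single a 1 : α → ZMod 2) := by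
    simp only [smul_add, Finset.sum_add_distrib, ← Finset.sum_smul, hsum, zero_smul, zero_add]
    ext b
    simp only [Finset.sum_apply, Pi.smul_apply, Pi.single_apply, smul_eq_mul, mul_ite, mul_one,
      mul_zero, Finset.sum_ite_eq]
    split_ifs with hb
    · rfl
    · exact hc b hb
  rw [hsum']
  exact P.sum_mem fun a ha => P.smul_mem _ (key a ha)

/-- If the `D (Pi.single q 1)` cover each coordinate at most twice, add up to zero, and have
support of size at least `m` unless they vanish, then the range of `D` is small. -/
theorem LinearMap.mul_finrank_range_add_one_le {Q E : Type*} [Fintype Q] [DecidableEq Q] [Fintype E]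
    (D : (Q → ZMod 2) →ₗ[ZMod 2] (E → ZMod 2)) (m : ℕ)
    (hone : D 1 = 0)
    (htwo : ∀ p, (Finset.univ.filter fun q => D (Pi.single q 1) p ≠ 0).card ≤ 2)
    (hm : ∀ q, D (Pi.single q 1) ≠ 0 →
      m ≤ (Finset.univ.filter fun p => D (Pi.single q 1) p ≠ 0).card)
    (hD : 0 < Module.finrank (ZMod 2) (LinearMap.range D)) :
    m * (Module.finrank (ZMod 2) (LinearMap.range D) + 1) ≤ 2 * Fintype.card E := by
  classical
  let Q' : Finset Q := Finset.univ.filter fun q => D (Pi.single q 1) ≠ 0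
  have hsum : ∑ q, D (Pi.single q 1) = 0 := by
    rw [← map_sum]
    rw [← hone]
    congr 1
    ext q
    simp [Pi.single_apply]
  have hsum' : ∑ q ∈ Q', D (Pi.single q 1) = 0 := by
    rw [← hsum, Finset.sum_filter_ne_zero]
  have hrange : LinearMap.range D ≤ Submodule.span (ZMod 2)
      ((fun q => D (Pi.single q 1)) '' (Q' : Set Q)) := by
    rintro _ ⟨G, rfl⟩
    have hG : G = ∑ q, G q • (Pi.single q 1 : Q → ZMod 2) := by
      ext q; simp [Pi.single_apply]
    rw [hG, map_sum]
    refine Submodule.sum_mem _ fun q _ => ?_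
    rw [map_smul]
    refine Submodule.smul_mem _ _ ?_
    by_cases h : D (Pi.single q 1) = 0
    · rw [h]; exact Submodule.zero_mem _
    · exact Submodule.subset_span ⟨q, by simpa [Q'] using h, rfl⟩
  have hne : Q'.Nonempty := by
    rw [Finset.nonempty_iff_ne_empty]
    intro h0
    rw [h0] at hrange
    simp only [Finset.coe_empty, Set.image_empty, Submodule.span_empty, le_bot_iff] at hrange
    rw [hrange] at hD
    simp at hD
  obtain ⟨q₀, hq₀⟩ := hne
  -- The relation `D 1 = 0` makes one of the nonzero generators redundant; this yields the `+ 1` in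
  -- the bound.
  have hspan : Submodule.span (ZMod 2) ((fun q => D (Pi.single q 1)) '' (Q' : Set Q)) ≤
      Submodule.span (ZMod 2) (((Q'.erase q₀).image fun q => D (Pi.single q 1) : Finset _) :
        Set (E → ZMod 2)) := by
    rw [Submodule.span_le]
    rintro _ ⟨q, hq, rfl⟩
    have hmem : ∀ q ∈ Q'.erase q₀, D (Pi.single q 1) ∈ Submodule.span (ZMod 2)
        (((Q'.erase q₀).image fun q => D (Pi.single q 1) : Finset _) : Set (E → ZMod 2)) :=
      fun q hq => Submodule.subset_span (Finset.mem_coe.mpr (Finset.mem_image_of_mem _ hq))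
    by_cases h : q = q₀
    · subst h
      rw [← Finset.add_sum_erase _ _ hq₀] at hsum'
      change D (Pi.single q 1) ∈ Submodule.span _ _
      rw [eq_neg_of_add_eq_zero_left hsum']
      exact Submodule.neg_mem _ (Submodule.sum_mem _ hmem)
    · exact hmem q (Finset.mem_erase.mpr ⟨h, hq⟩)
  have hfin : Module.finrank (ZMod 2) (LinearMap.range D) ≤ Q'.card - 1 := by
    calc _ ≤ _ := Submodule.finrank_mono (hrange.trans hspan)
      _ ≤ _ := finrank_span_finset_le_card _
      _ ≤ (Q'.erase q₀).card := Finset.card_image_le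
      _ = _ := Finset.card_erase_of_mem hq₀
  have hpos : 0 < Q'.card := Finset.card_pos.mpr ⟨q₀, hq₀⟩
  -- Count the pairs `(q, p)` with `D (Pi.single q 1) p ≠ 0` in two ways.
  calc m * (Module.finrank (ZMod 2) (LinearMap.range D) + 1) ≤ m * Q'.card :=
        Nat.mul_le_mul_left _ (by omega)
    _ = ∑ q ∈ Q', m := by simp [mul_comm]
    _ ≤ ∑ q ∈ Q', (Finset.univ.filter fun p => D (Pi.single q 1) p ≠ 0).card :=
        Finset.sum_le_sum fun q hq => hm q (by simpa [Q'] using hq)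
    _ ≤ ∑ q, (Finset.univ.filter fun p => D (Pi.single q 1) p ≠ 0).card :=
        Finset.sum_le_sum_of_subset (Finset.subset_univ _)
    _ = ∑ p, (Finset.univ.filter fun q => D (Pi.single q 1) p ≠ 0).card := by
        simp only [Finset.card_filter]
        exact Finset.sum_comm
    _ ≤ ∑ _p : E, 2 := Finset.sum_le_sum fun p _ => htwo p
    _ = 2 * Fintype.card E := by simp [mul_comm]

/-! ### Sides of triangles and flows across edges -/

namespace Finset

variable {V : Type*} [DecidableEq V]

/-- The two sides of a triangle at a vertex. -/
theorem exists_filter_powersetCard_two_eq {t : Finset V} (ht : t.card = 3) {v : V} (hv : v ∈ t) :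
    ∃ e₁ e₂, e₁ ≠ e₂ ∧ (t.powersetCard 2).filter (v ∈ ·) = {e₁, e₂} := by
  obtain ⟨a, b, hab, h⟩ := Finset.card_eq_two.mp (show (t.erase v).card = 2 by
    rw [Finset.card_erase_of_mem hv, ht])
  have ha : a ≠ v ∧ a ∈ t := Finset.mem_erase.mp (h ▸ by simp)
  have hb : b ≠ v ∧ b ∈ t := Finset.mem_erase.mp (h ▸ by simp)
  refine ⟨{v, a}, {v, b}, ?_, ?_⟩
  · intro h
    have : a ∈ ({v, b} : Finset V) := h ▸ by simp
    simp [ha.1, hab] at this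
  · ext e
    simp only [mem_filter, mem_powersetCard, mem_insert, mem_singleton]
    constructor
    · rintro ⟨⟨het, hcard⟩, hve⟩
      obtain ⟨w, hw⟩ := Finset.card_eq_one.mp (show (e.erase v).card = 1 by
        rw [Finset.card_erase_of_mem hve, hcard])
      have hew : e = {v, w} := by rw [← Finset.insert_erase hve, hw]
      have hwt : w ∈ t.erase v := by
        have : w ∈ e.erase v := hw ▸ by simp
        exact Finset.erase_subset_erase v het this
      rw [h] at hwt
      simp only [mem_insert, mem_singleton] at hwt
      rcases hwt with rfl | rfl
      · exact Or.inl hew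
      · exact Or.inr hew
    · rintro (rfl | rfl)
      · exact ⟨⟨by simp [Finset.insert_subset_iff, hv, ha.2], Finset.card_pair ha.1.symm⟩,
          by simp⟩
      · exact ⟨⟨by simp [Finset.insert_subset_iff, hv, hb.2], Finset.card_pair hb.1.symm⟩,
          by simp⟩

theorem sum_sum_powersetCard_two [Fintype V] (s : Finset (Finset V)) (F : Finset V → ZMod 2) :
    ∑ t ∈ s, ∑ e ∈ t.powersetCard 2, F e =
      ∑ e ∈ (univ : Finset V).powersetCard 2, ((s.filter (e ⊆ ·)).card : ZMod 2) * F e := by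
  rw [Finset.sum_comm' (t' := (univ : Finset V).powersetCard 2) (s' := fun e => s.filter (e ⊆ ·))]
  · simp
  · intro t e
    simp only [mem_powersetCard, mem_filter, subset_univ, true_and]
    tauto

/-- A sum over the sides of a set of triangles counts each edge with multiplicity at most two.
Modulo 2 only the edges in exactly one triangle matter. -/
theorem natCast_zmod_two_mul_eq_zero {n : ℕ} (hn : n ≤ 2) {x : ZMod 2} (hx : n = 1 → x = 0) :
    (n : ZMod 2) * x = 0 := by
  interval_cases n
  · simp
  · simp [hx rfl]
  · have : ((2 : ℕ) : ZMod 2) = 0 := rfl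
    rw [this, zero_mul]

/-- A set of triangles connected through the edges in `𝓔` carries flows with any prescribed
boundary of zero sum. -/
theorem exists_flow [Fintype V] (tri : Finset (Finset V)) (htri : ∀ t ∈ tri, t.card = 3)
    (hedge : ∀ e : Finset V, e.card = 2 → (tri.filter (e ⊆ ·)).card ≤ 2)
    (s : Finset (Finset V)) (hs : s ⊆ tri) (𝓔 : Set (Finset V))
    (hconn : ∀ t ∈ s, ∀ t' ∈ s, Relation.ReflTransGen
      (fun t t' => t ∈ s ∧ t' ∈ s ∧ (t ∩ t').card = 2 ∧ t ∩ t' ∈ 𝓔) t t')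
    (c : Finset V → ZMod 2) (hc : ∀ t ∉ s, c t = 0) (hsum : ∑ t ∈ s, c t = 0) :
    ∃ y : Finset V → ZMod 2, (∀ e, y e ≠ 0 → e ∈ 𝓔) ∧
      ∀ t ∈ tri, ∑ e ∈ t.powersetCard 2, y e = c t := by
  let P : Submodule (ZMod 2) (Finset V → ZMod 2) :=
    { carrier := {c | ∃ y : Finset V → ZMod 2, (∀ e, y e ≠ 0 → e ∈ 𝓔) ∧
        ∀ t ∈ tri, ∑ e ∈ t.powersetCard 2, y e = c t}
      zero_mem' := ⟨0, by simp, by simp⟩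
      add_mem' := by
        rintro c c' ⟨y, hy, hy'⟩ ⟨z, hz, hz'⟩
        refine ⟨y + z, fun e he => ?_, fun t ht => ?_⟩
        · by_contra h
          exact he (by simp [not_not.mp (mt (hy e) h), not_not.mp (mt (hz e) h)])
        · simp [sum_add_distrib, hy' t ht, hz' t ht]
      smul_mem' := by
        rintro k c ⟨y, hy, hy'⟩
        refine ⟨k • y, fun e he => hy e fun h => he (by simp [h]), fun t ht => ?_⟩
        simp [← mul_sum, hy' t ht] }
  refine P.mem_of_sum_eq_zero s _ hconn ?_ c hc hsum
  rintro t t' ⟨ht, ht', hcard, he⟩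
  -- One unit across the common edge has boundary exactly `t + t'`, because no third triangle
  -- contains this edge.
  refine ⟨Pi.single (t ∩ t') 1, fun e h => ?_, fun u hu => ?_⟩
  · by_contra h'
    refine h (Pi.single_eq_of_ne (fun h0 => h' ?_) _)
    rw [h0]
    exact he
  · have htt' : t ≠ t' := by
      rintro rfl
      rw [inter_self, htri t (hs ht)] at hcard
      omega
    have hfilter : tri.filter (t ∩ t' ⊆ ·) = {t, t'} := by
      symm
      apply Finset.eq_of_subset_of_card_le
      · intro u hu
        simp only [mem_insert, mem_singleton] at hu
        rcases hu with rfl | rfl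
        · exact mem_filter.mpr ⟨hs ht, inter_subset_left⟩
        · exact mem_filter.mpr ⟨hs ht', inter_subset_right⟩
      · rw [Finset.card_pair htt']
        exact hedge _ hcard
    have hmem : t ∩ t' ⊆ u ↔ u = t ∨ u = t' := by
      have := congrArg (u ∈ ·) hfilter
      simpa [hu] using this
    simp only [Pi.single_apply, sum_ite_eq', mem_powersetCard, hcard, and_true, hmem, Pi.add_apply]
    by_cases h1 : u = t
    · simp [h1, htt']
    · simp [h1]

end Finset

/-! ### The incidence graph of points and lines and its cycles -/

section

open Finset

/-- A finite set of triangles without first cohomology mod `2`, in which each edge is in at most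
two triangles and the links of the vertices are connected, together with disjoint connected regions
of triangles.  Connectedness is expressed by the existence of flows with prescribed boundary. -/
structure PlanarRegions (V : Type*) [Fintype V] [DecidableEq V] where
  tri : Finset (Finset V)
  card_tri : ∀ t ∈ tri, t.card = 3
  card_edge : ∀ e : Finset V, e.card = 2 → (tri.filter (e ⊆ ·)).card ≤ 2
  exact : ∀ f : Finset V → ZMod 2, (∀ t ∈ tri, ∑ e ∈ t.powersetCard 2, f e = 0) →
    ∃ g : V → ZMod 2, ∀ t ∈ tri, ∀ e ∈ t.powersetCard 2, f e = ∑ v ∈ e, g v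
  link : ∀ (v : V) (c : Finset V → ZMod 2), (∀ t, ¬ (t ∈ tri ∧ v ∈ t) → c t = 0) →
    ∑ t ∈ tri, c t = 0 → ∃ y : Finset V → ZMod 2,
      (∀ e, y e ≠ 0 → v ∈ e ∧ (tri.filter (e ⊆ ·)).card = 2) ∧
      ∀ t ∈ tri, ∑ e ∈ t.powersetCard 2, y e = c t
  lines : Finset (Finset V)
  region : Finset V → Finset (Finset V)
  region_subset : ∀ C ∈ lines, region C ⊆ tri
  region_disjoint : ∀ C ∈ lines, ∀ C' ∈ lines, C ≠ C' → Disjoint (region C) (region C')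
  mem_iff : ∀ C ∈ lines, ∀ v, v ∈ C ↔ ∃ t ∈ region C, v ∈ t
  flow : ∀ C ∈ lines, ∀ c : Finset V → ZMod 2, (∀ t ∉ region C, c t = 0) →
    ∑ t ∈ region C, c t = 0 → ∃ x : Finset V → ZMod 2,
      (∀ e, x e ≠ 0 → ((region C).filter (e ⊆ ·)).card = 2) ∧
      ∀ t ∈ tri, ∑ e ∈ t.powersetCard 2, x e = c t

/-- The incidences between a set of points and a set of lines. -/
abbrev Incidence {V : Type*} [DecidableEq V] (A : Finset V) (B : Finset (Finset V)) : Type _ :=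
  {p : V × Finset V // p ∈ (A ×ˢ B).filter fun p => p.1 ∈ p.2}

section CycleSpace

variable {V : Type*} [DecidableEq V] {A : Finset V} {B : Finset (Finset V)}

/-- The boundary map of the incidence graph. -/
def incidenceBoundary (A : Finset V) (B : Finset (Finset V)) :
    (Incidence A B → ZMod 2) →ₗ[ZMod 2] (A ⊕ B → ZMod 2) where
  toFun z := Sum.elim (fun v => ∑ p : Incidence A B, if p.1.1 = v then z p else 0)
    (fun C => ∑ p : Incidence A B, if p.1.2 = C then z p else 0)
  map_add' z z' := by
    ext (v | C) <;> simp only [Pi.add_apply, Sum.elim_inl, Sum.elim_inr, ← sum_add_distrib] <;>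
      exact sum_congr rfl fun p _ => by split_ifs <;> simp
  map_smul' k z := by
    ext (v | C) <;> simp [mul_sum]

theorem incidence_mem (p : Incidence A B) : p.1.1 ∈ A ∧ p.1.2 ∈ B ∧ p.1.1 ∈ p.1.2 := by
  have := p.2
  simp only [mem_filter, mem_product] at this
  exact ⟨this.1.1, this.1.2, this.2⟩

theorem mem_ker_incidenceBoundary {z : Incidence A B → ZMod 2} :
    z ∈ LinearMap.ker (incidenceBoundary A B) ↔
      (∀ v ∈ A, ∑ p : Incidence A B, (if p.1.1 = v then z p else 0) = 0) ∧
      ∀ C ∈ B, ∑ p : Incidence A B, (if p.1.2 = C then z p else 0) = 0 := by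
  rw [LinearMap.mem_ker, funext_iff, Sum.forall]
  simp [incidenceBoundary]

/-- Each edge has one end among the points and one among the lines, so boundaries have zero total
and the boundary map misses at least one dimension. This is the lower bound `E - N + 1` for the
cycle space, valid also for disconnected graphs. -/
theorem finrank_ker_incidenceBoundary (h : A.Nonempty ∨ B.Nonempty) :
    ((A ×ˢ B).filter fun p => p.1 ∈ p.2).card + 1 ≤
      Module.finrank (ZMod 2) (LinearMap.ker (incidenceBoundary A B)) + (A.card + B.card) := by
  let s : (A ⊕ B → ZMod 2) →ₗ[ZMod 2] ZMod 2 := ∑ i, LinearMap.proj i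
  have hs : ∀ z, s z = ∑ i, z i := fun z => by simp [s]
  have hrange : LinearMap.range (incidenceBoundary A B) ≤ LinearMap.ker s := by
    rintro _ ⟨z, rfl⟩
    rw [LinearMap.mem_ker, hs, Fintype.sum_sum_type]
    simp only [incidenceBoundary, LinearMap.coe_mk, AddHom.coe_mk, Sum.elim_inl, Sum.elim_inr]
    rw [sum_comm, sum_comm (s := (univ : Finset B))]
    have h1 : ∀ p : Incidence A B, ∑ v : A, (if p.1.1 = v then z p else 0) = z p := by
      intro p
      rw [sum_eq_single ⟨p.1.1, (incidence_mem p).1⟩] <;> simp +contextual [Subtype.ext_iff, eq_comm]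
    have h2 : ∀ p : Incidence A B, ∑ v : B, (if p.1.2 = v then z p else 0) = z p := by
      intro p
      rw [sum_eq_single ⟨p.1.2, (incidence_mem p).2.1⟩] <;>
        simp +contextual [Subtype.ext_iff, eq_comm]
    simp only [h1, h2]
    exact CharTwo.add_self_eq_zero _
  have hsurj : LinearMap.range s = ⊤ := by
    rw [LinearMap.range_eq_top]
    have : Nonempty (A ⊕ B) := by
      rcases h with ⟨a, ha⟩ | ⟨b, hb⟩
      · exact ⟨Sum.inl ⟨a, ha⟩⟩
      · exact ⟨Sum.inr ⟨b, hb⟩⟩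
    obtain ⟨i⟩ := this
    intro k
    exact ⟨Pi.single i k, by rw [hs]; simp⟩
  have h1 := LinearMap.finrank_range_add_finrank_ker s
  have h2 := LinearMap.finrank_range_add_finrank_ker (incidenceBoundary A B)
  have h3 := Submodule.finrank_mono hrange
  rw [hsurj] at h1
  simp only [finrank_top, Module.finrank_self, Module.finrank_fintype_fun_eq_card,
    Fintype.card_sum, Fintype.card_coe] at h1 h2
  omega

/-- Parity: a sum in `ℤ/2` that vanishes cannot have exactly one nonzero term. -/
theorem exists_other_incidence {α : Type*} [DecidableEq α] {z : Incidence A B → ZMod 2}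
    (f : Incidence A B → α)
    (p : Incidence A B) (hp : z p ≠ 0)
    (h : ∑ q : Incidence A B, (if f q = f p then z q else 0) = 0) :
    ∃ q, q ≠ p ∧ f q = f p ∧ z q ≠ 0 := by
  by_contra! hcon
  rw [sum_eq_single p] at h
  · simp at h; exact hp h
  · intro q _ hqp
    split_ifs with hq
    · exact hcon q hqp hq
    · rfl
  · simp

/-- If two lines have at most one common point, a nonzero cycle has at least six edges. -/
theorem six_le_card_support (hB : ∀ C ∈ B, ∀ C' ∈ B, C ≠ C' → (C ∩ C').card ≤ 1)
    {z : Incidence A B → ZMod 2} (hz : z ∈ LinearMap.ker (incidenceBoundary A B)) (h0 : z ≠ 0) :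
    6 ≤ (univ.filter fun p => z p ≠ 0).card := by
  rw [mem_ker_incidenceBoundary] at hz
  have stepC : ∀ p : Incidence A B, z p ≠ 0 → ∃ q : Incidence A B, q.1.1 = p.1.1 ∧
      q.1.2 ≠ p.1.2 ∧ z q ≠ 0 := by
    intro p hp
    obtain ⟨q, h1, h2, h3⟩ := exists_other_incidence (fun q => q.1.1) p hp
      (hz.1 _ (incidence_mem p).1)
    exact ⟨q, h2, fun h => h1 (Subtype.ext (Prod.ext h2 h)), h3⟩
  have stepV : ∀ p : Incidence A B, z p ≠ 0 → ∃ q : Incidence A B, q.1.2 = p.1.2 ∧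
      q.1.1 ≠ p.1.1 ∧ z q ≠ 0 := by
    intro p hp
    obtain ⟨q, h1, h2, h3⟩ := exists_other_incidence (fun q => q.1.2) p hp
      (hz.2 _ (incidence_mem p).2.1)
    exact ⟨q, h2, fun h => h1 (Subtype.ext (Prod.ext h h2)), h3⟩
  have huniq : ∀ {v w : V} {C C' : Finset V}, C ∈ B → C' ∈ B → v ∈ C → w ∈ C → v ∈ C' → w ∈ C' →
      v ≠ w → C = C' := by
    intro v w C C' hC hC' h1 h2 h3 h4 hvw
    by_contra hne
    have := hB C hC C' hC' hne
    rw [Finset.card_le_one] at this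
    exact hvw (this v (mem_inter.mpr ⟨h1, h3⟩) w (mem_inter.mpr ⟨h2, h4⟩))
  -- Extend `p1` on both sides to a path in the support, changing in turn the line and the point.
  -- The order along the path is `p5`, `p3`, `p1`, `p2`, `p4`, `p6`. A coincidence would make two
  -- distinct lines share two points.
  obtain ⟨p1, hp1⟩ : ∃ p, z p ≠ 0 := by
    by_contra! h
    exact h0 (funext h)
  obtain ⟨p2, h21, h22, hp2⟩ := stepC p1 hp1
  obtain ⟨p3, h31, h32, hp3⟩ := stepV p1 hp1
  obtain ⟨p4, h41, h42, hp4⟩ := stepV p2 hp2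
  obtain ⟨p5, h51, h52, hp5⟩ := stepC p3 hp3
  obtain ⟨p6, h61, h62, hp6⟩ := stepC p4 hp4
  have m1 := incidence_mem p1
  have m2 := incidence_mem p2
  have m3 := incidence_mem p3
  have m4 := incidence_mem p4
  have m5 := incidence_mem p5
  have m6 := incidence_mem p6
  have e5 : p5.1.2 ≠ p2.1.2 := by
    intro h
    refine h22 (huniq m2.2.1 m1.2.1 (v := p1.1.1) (w := p3.1.1) ?_ ?_ m1.2.2 ?_ h32.symm)
    · rw [← h21]; exact m2.2.2
    · rw [← h, ← h51]; exact m5.2.2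
    · rw [← h31]; exact m3.2.2
  have e34 : p3.1.1 ≠ p4.1.1 := by
    intro h
    refine h22 (huniq m2.2.1 m1.2.1 (v := p1.1.1) (w := p3.1.1) ?_ ?_ m1.2.2 ?_ h32.symm)
    · rw [← h21]; exact m2.2.2
    · rw [h, ← h41]; exact m4.2.2
    · rw [← h31]; exact m3.2.2
  have hsub : ({p1, p2, p3, p4, p5, p6} : Finset (Incidence A B)) ⊆
      univ.filter fun p => z p ≠ 0 := by
    intro p hp
    simp only [mem_insert, mem_singleton] at hp
    simp only [mem_filter, mem_univ, true_and]
    rcases hp with rfl | rfl | rfl | rfl | rfl | rfl <;> assumption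
  refine le_trans (le_of_eq ?_) (card_le_card hsub)
  symm
  have d : ∀ {p q : Incidence A B}, p.1.1 ≠ q.1.1 ∨ p.1.2 ≠ q.1.2 → p ≠ q := by
    rintro p q (h | h) rfl <;> exact h rfl
  have e14 : p1.1.1 ≠ p4.1.1 := fun h => h42 (h.symm.trans h21.symm)
  have n12 : p1 ≠ p2 := d (Or.inr h22.symm)
  have n13 : p1 ≠ p3 := d (Or.inl h32.symm)
  have n14 : p1 ≠ p4 := d (Or.inl e14)
  have n15 : p1 ≠ p5 := d (Or.inl (h51 ▸ h32.symm))
  have n16 : p1 ≠ p6 := d (Or.inl (h61 ▸ e14))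
  have n23 : p2 ≠ p3 := d (Or.inl (h21 ▸ h32.symm))
  have n24 : p2 ≠ p4 := d (Or.inl h42.symm)
  have n25 : p2 ≠ p5 := d (Or.inr e5.symm)
  have n26 : p2 ≠ p6 := d (Or.inl (h61 ▸ h42.symm))
  have n34 : p3 ≠ p4 := d (Or.inl e34)
  have n35 : p3 ≠ p5 := d (Or.inr (by rw [h31] at h52; rw [h31]; exact h52.symm))
  have n36 : p3 ≠ p6 := d (Or.inl (h61 ▸ e34))
  have n45 : p4 ≠ p5 := d (Or.inl (h51 ▸ e34.symm))
  have n46 : p4 ≠ p6 := d (Or.inr h62.symm)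
  have n56 : p5 ≠ p6 := d (Or.inl (h51 ▸ h61 ▸ e34))
  simp [n12, n13, n14, n15, n16, n23, n24, n25, n26, n34, n35, n36, n45, n46, n56]

end CycleSpace

end

/-! ### Faces of the incidence graph and Euler's inequality -/

section

open Finset

namespace PlanarRegions

variable {V : Type*} [Fintype V] [DecidableEq V] (P : PlanarRegions V)
  (A : Finset V) (B : Finset (Finset V)) (τ : V → Finset V → Finset V)

/-- Two flags `(v, e)`, `e` an edge at the vertex `v`, are adjacent if no edge of the incidence
graph of `A` and `B`, drawn in the plane, separates them.  The incidence of `v ∈ A` and `C ∈ B` is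
drawn through the triangle `τ v C`. -/
inductive FlagRel : V × Finset V → V × Finset V → Prop
  -- One may move along an edge from one end to the other unless it is interior to a region, which
  -- is thought of as contracted to the node of its line.
  | edge {v w : V} {e t : Finset V} : t ∈ P.tri → e ∈ t.powersetCard 2 → v ∈ e → w ∈ e →
      (∀ C ∈ B, ((P.region C).filter (e ⊆ ·)).card ≠ 2) → FlagRel (v, e) (w, e)
  -- One may turn around `v` inside a triangle unless an incidence leaves `v` through that corner.
  | corner {v : V} {e e' t : Finset V} : t ∈ P.tri → v ∈ e → v ∈ e' → e ∈ t.powersetCard 2 →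
      e' ∈ t.powersetCard 2 → (∀ C ∈ B, v ∈ A → v ∈ C → τ v C ≠ t) → FlagRel (v, e) (v, e')
  -- Boundary edges at `v` are joined through the outside of the disk.
  | boundary {v : V} {e e' : Finset V} : v ∈ e → v ∈ e' → e.card = 2 → e'.card = 2 →
      (P.tri.filter (e ⊆ ·)).card = 1 → (P.tri.filter (e' ⊆ ·)).card = 1 → FlagRel (v, e) (v, e')

/-- The faces of the incidence graph. -/
abbrev Face : Type _ := Quot (P.FlagRel A B τ)

instance : Finite (P.Face A B τ) := Quot.finite _

noncomputable instance : Fintype (P.Face A B τ) := Fintype.ofFinite _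

variable {P A B τ}

/-- The value at a flag of a function on the faces. -/
abbrev flagVal (G : P.Face A B τ → ZMod 2) (v : V) (e : Finset V) : ZMod 2 := G (Quot.mk _ (v, e))

/-- The coboundary at the corner of a triangle of a function on the faces. -/
def cornerVal (G : P.Face A B τ → ZMod 2) (v : V) (t : Finset V) : ZMod 2 :=
  ∑ e ∈ (t.powersetCard 2).filter (v ∈ ·), flagVal G v e

variable (P A B τ) in
/-- The coboundary of a function on the faces. -/
def coboundary : (P.Face A B τ → ZMod 2) →ₗ[ZMod 2] (Incidence A B → ZMod 2) where
  toFun G p := cornerVal G p.1.1 (τ p.1.1 p.1.2)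
  map_add' G G' := by ext p; simp [cornerVal, flagVal, sum_add_distrib]
  map_smul' k G := by ext p; simp [cornerVal, flagVal, mul_sum]

theorem coboundary_apply (G : P.Face A B τ → ZMod 2) (p : Incidence A B) :
    P.coboundary A B τ G p = cornerVal G p.1.1 (τ p.1.1 p.1.2) := rfl

theorem cornerVal_eq_zero (G : P.Face A B τ → ZMod 2) {v : V} {t : Finset V} (ht : t ∈ P.tri)
    (hv : v ∈ t) (h : ∀ C ∈ B, v ∈ A → v ∈ C → τ v C ≠ t) : cornerVal G v t = 0 := by
  obtain ⟨e₁, e₂, hne, he⟩ := exists_filter_powersetCard_two_eq (P.card_tri t ht) hv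
  have h1 : e₁ ∈ (t.powersetCard 2).filter (v ∈ ·) := he ▸ by simp
  have h2 : e₂ ∈ (t.powersetCard 2).filter (v ∈ ·) := he ▸ by simp
  rw [mem_filter] at h1 h2
  rw [cornerVal, he, sum_pair hne, flagVal, flagVal,
    Quot.sound (FlagRel.corner ht h1.2 h2.2 h1.1 h2.1 h)]
  exact CharTwo.add_self_eq_zero _

/-- Corners of a region through which no incidence passes contribute zero, since both sides there
belong to the same face. The regions being disjoint, the only incidence of `v` that can use a
triangle of the region of `C` is the one with `C`. So the choice of `τ` disappears from the sums
over a whole region. -/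
theorem sum_cornerVal_eq (hτ : ∀ C ∈ B, ∀ v ∈ C, τ v C ∈ P.region C ∧ v ∈ τ v C)
    (hB : B ⊆ P.lines) (G : P.Face A B τ → ZMod 2) {v : V} {C : Finset V}
    (hC : C ∈ B) :
    (if v ∈ C then cornerVal G v (τ v C) else 0) =
      ∑ t ∈ P.region C, if v ∈ t then cornerVal G v t else 0 := by
  split_ifs with hvC
  · rw [sum_eq_single (τ v C)]
    · rw [if_pos (hτ C hC v hvC).2]
    · intro t ht htne
      split_ifs with hvt
      · refine cornerVal_eq_zero G (P.region_subset C (hB hC) ht) hvt ?_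
        rintro C' hC' - hvC' rfl
        by_cases hCC : C = C'
        · subst hCC; exact htne rfl
        · exact Finset.disjoint_left.mp (P.region_disjoint C (hB hC) C' (hB hC') hCC) ht
            (hτ C' hC' v hvC').1
      · rfl
    · intro h
      exact absurd (hτ C hC v hvC).1 h
  · symm
    refine sum_eq_zero fun t ht => ?_
    rw [if_neg]
    intro hvt
    exact hvC ((P.mem_iff C (hB hC) v).mpr ⟨t, ht, hvt⟩)

omit [Fintype V] in
theorem sum_incidence (F : V → Finset V → ZMod 2) :
    (∀ v ∈ A, ∑ p : Incidence A B, (if p.1.1 = v then F p.1.1 p.1.2 else 0) =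
      ∑ C ∈ B, if v ∈ C then F v C else 0) ∧
    ∀ C ∈ B, ∑ p : Incidence A B, (if p.1.2 = C then F p.1.1 p.1.2 else 0) =
      ∑ v ∈ A, if v ∈ C then F v C else 0 := by
  constructor
  · intro v hv
    rw [Finset.sum_coe_sort ((A ×ˢ B).filter fun p => p.1 ∈ p.2)
      (fun p => if p.1 = v then F p.1 p.2 else 0), sum_filter, sum_product,
      sum_eq_single v]
    · simp
    · intro w _ hw
      simp [hw]
    · exact fun h => absurd hv h
  · intro C hC
    rw [Finset.sum_coe_sort ((A ×ˢ B).filter fun p => p.1 ∈ p.2)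
      (fun p => if p.2 = C then F p.1 p.2 else 0), sum_filter, sum_product_right,
      sum_eq_single C]
    · simp
    · intro w _ hw
      simp [hw]
    · exact fun h => absurd hC h

/-- Around a point or around a region the values of a function on the faces cancel in pairs. At a
point, each interior edge borders two triangles, and all boundary edges lie in one face. In a
region, interior edges occur twice, and the two ends of an edge on its rim lie in the same face. -/
theorem coboundary_mem_ker (hτ : ∀ C ∈ B, ∀ v ∈ C, τ v C ∈ P.region C ∧ v ∈ τ v C)
    (hB : B ⊆ P.lines) (G : P.Face A B τ → ZMod 2) :
    P.coboundary A B τ G ∈ LinearMap.ker (incidenceBoundary A B) := by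
  rw [mem_ker_incidenceBoundary]
  simp only [coboundary_apply]
  obtain ⟨h1, h2⟩ := sum_incidence (A := A) (B := B) (fun v C => cornerVal G v (τ v C))
  refine ⟨fun v hv => (h1 v hv).trans ?_, fun C hC => (h2 C hC).trans ?_⟩
  · rw [sum_congr rfl fun C hC => sum_cornerVal_eq hτ hB G hC]
    have hsum : ∑ C ∈ B, ∑ t ∈ P.region C, (if v ∈ t then cornerVal G v t else 0) =
        ∑ t ∈ P.tri, if v ∈ t then cornerVal G v t else 0 := by
      rw [← sum_biUnion fun C hC C' hC' hne => P.region_disjoint C (hB hC) C' (hB hC') hne]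
      refine sum_subset (biUnion_subset.mpr fun C hC => P.region_subset C (hB hC)) ?_
      intro t ht hnot
      split_ifs with hvt
      · refine cornerVal_eq_zero G ht hvt ?_
        rintro C hC - hvC rfl
        exact hnot (mem_biUnion.mpr ⟨C, hC, (hτ C hC v hvC).1⟩)
      · rfl
    have hflag : ∀ (F : Finset V → ZMod 2),
        ∑ t ∈ P.tri, (if v ∈ t then ∑ e ∈ (t.powersetCard 2).filter (v ∈ ·), F e else 0) =
        ∑ e ∈ (univ : Finset V).powersetCard 2,
          ((P.tri.filter (e ⊆ ·)).card : ZMod 2) * (if v ∈ e then F e else 0) := by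
      intro F
      rw [← sum_sum_powersetCard_two]
      refine sum_congr rfl fun t _ => ?_
      rw [sum_filter]
      split_ifs with hvt
      · rfl
      · symm
        refine sum_eq_zero fun e he => if_neg fun hve => hvt ((mem_powersetCard.mp he).1 hve)
    rw [hsum]
    simp only [cornerVal]
    rw [hflag]
    -- If `v` is on the boundary, all values may be replaced by the one at a boundary edge `e₀`: the
    -- edges of multiplicity two do not count, and those of multiplicity one lie in the same face.
    -- Then the two sides of each triangle cancel.
    by_cases hbd : ∃ e : Finset V, v ∈ e ∧ e.card = 2 ∧ (P.tri.filter (e ⊆ ·)).card = 1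
    · obtain ⟨e₀, hv₀, hc₀, hb₀⟩ := hbd
      have hconst : ∑ e ∈ (univ : Finset V).powersetCard 2,
          ((P.tri.filter (e ⊆ ·)).card : ZMod 2) * (if v ∈ e then flagVal G v e else 0) =
          ∑ e ∈ (univ : Finset V).powersetCard 2,
          ((P.tri.filter (e ⊆ ·)).card : ZMod 2) * (if v ∈ e then flagVal G v e₀ else 0) := by
        refine sum_congr rfl fun e he => ?_
        have hce := (mem_powersetCard.mp he).2
        split_ifs with hve
        · rw [← sub_eq_zero, ← mul_sub]
          refine natCast_zmod_two_mul_eq_zero (P.card_edge e hce) fun h => ?_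
          rw [flagVal, flagVal, Quot.sound (FlagRel.boundary hve hv₀ hce hc₀ h hb₀), sub_self]
        · rfl
      rw [hconst, ← hflag]
      refine sum_eq_zero fun t ht => ?_
      split_ifs with hvt
      · obtain ⟨e₁, e₂, hne, he⟩ := exists_filter_powersetCard_two_eq (P.card_tri t ht) hvt
        rw [he, sum_pair hne]
        exact CharTwo.add_self_eq_zero _
      · rfl
    · push Not at hbd
      refine sum_eq_zero fun e he => ?_
      have hce := (mem_powersetCard.mp he).2
      split_ifs with hve
      · exact natCast_zmod_two_mul_eq_zero (P.card_edge e hce) fun h => absurd h (hbd e hve hce)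
      · simp
  · rw [sum_congr rfl fun v hv => sum_cornerVal_eq hτ hB G hC, sum_comm]
    have hreg := P.region_subset C (hB hC)
    have h3 : ∀ t ∈ P.region C, ∑ v ∈ A, (if v ∈ t then cornerVal G v t else 0) =
        ∑ e ∈ t.powersetCard 2, ∑ v ∈ e, flagVal G v e := by
      intro t ht
      have h4 : ∑ v ∈ A, (if v ∈ t then cornerVal G v t else 0) = ∑ v ∈ t, cornerVal G v t := by
        rw [← sum_filter]
        refine sum_subset (fun v hv => (mem_filter.mp hv).2) fun v hvt hv => ?_
        refine cornerVal_eq_zero G (hreg ht) hvt fun _ _ hvA => ?_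
        exact absurd (mem_filter.mpr ⟨hvA, hvt⟩) hv
      rw [h4]
      simp only [cornerVal]
      refine sum_comm' fun v e => ?_
      simp only [mem_filter, mem_powersetCard]
      constructor
      · tauto
      · rintro ⟨h, h', h''⟩
        exact ⟨h' h, ⟨h', h''⟩, h⟩
    rw [sum_congr rfl h3, sum_sum_powersetCard_two]
    refine sum_eq_zero fun e he => ?_
    have hce := (mem_powersetCard.mp he).2
    have hle : ((P.region C).filter (e ⊆ ·)).card ≤ 2 :=
      (card_le_card (filter_subset_filter _ hreg)).trans (P.card_edge e hce)
    refine natCast_zmod_two_mul_eq_zero hle fun h => ?_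
    obtain ⟨v, w, hvw, rfl⟩ := card_eq_two.mp hce
    obtain ⟨t, ht⟩ := card_eq_one.mp h
    have htm : t ∈ (P.region C).filter ({v, w} ⊆ ·) := ht ▸ mem_singleton_self t
    rw [mem_filter] at htm
    rw [sum_pair hvw, flagVal, flagVal, Quot.sound (FlagRel.edge (v := v) (w := w)
      (hreg htm.1) (mem_powersetCard.mpr ⟨htm.2, hce⟩) (by simp) (by simp) ?_)]
    · exact CharTwo.add_self_eq_zero _
    · intro C' hC' h2
      -- An edge in exactly one triangle of the region of `C` has room for at most one further
      -- triangle, so it is not interior to another region.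
      by_cases hCC : C = C'
      · subst hCC; omega
      have hd := P.region_disjoint C (hB hC) C' (hB hC') hCC
      have hsub : (P.region C).filter ({v, w} ⊆ ·) ∪ (P.region C').filter ({v, w} ⊆ ·) ⊆
          P.tri.filter ({v, w} ⊆ ·) :=
        union_subset (filter_subset_filter _ hreg)
          (filter_subset_filter _ (P.region_subset C' (hB hC')))
      have := card_le_card hsub
      rw [card_union_of_disjoint (disjoint_filter_filter hd), h, h2] at this
      have := P.card_edge _ hce
      omega

/-- This is the planarity of the incidence graph. Spread the cycle `z` over the disk: for each line
`C` a flow `x C` inside its region, and for each point `v` a flow `y v` across the edges at `v`,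
both with the values of `z` as sources at the triangles `τ v C`. They exist because the sources add
up to zero at every node. In the total flow each incidence counts twice, so it has no boundary, and
exactness writes it as the coboundary of a function `g` on the vertices. The function on the faces
is `g v + y v e`: at a corner `g v` cancels and the sources of `y v` remain. -/
theorem exists_coboundary_eq (hτ : ∀ C ∈ B, ∀ v ∈ C, τ v C ∈ P.region C ∧ v ∈ τ v C)
    (hB : B ⊆ P.lines) {z : Incidence A B → ZMod 2}
    (hz : z ∈ LinearMap.ker (incidenceBoundary A B)) :
    ∃ G, P.coboundary A B τ G = z := by
  rw [mem_ker_incidenceBoundary] at hz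
  let z' : V → Finset V → ZMod 2 := fun v C =>
    if h : (v, C) ∈ (A ×ˢ B).filter fun p => p.1 ∈ p.2 then z ⟨(v, C), h⟩ else 0
  have hz' : ∀ p : Incidence A B, z p = z' p.1.1 p.1.2 := fun p => by
    simp only [z', p.2, dif_pos]
  have hz0 : ∀ v C, ¬ (v ∈ A ∧ C ∈ B ∧ v ∈ C) → z' v C = 0 := fun v C h => by
    simp only [z']
    rw [dif_neg]
    simpa [and_assoc] using h
  simp only [hz'] at hz
  obtain ⟨h1, h2⟩ := sum_incidence (A := A) (B := B) z'
  have hzA : ∀ v, ∑ C ∈ B, z' v C = 0 := by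
    intro v
    by_cases hv : v ∈ A
    · rw [← hz.1 v hv, h1 v hv]
      refine sum_congr rfl fun C _ => ?_
      split_ifs with h
      · rfl
      · exact hz0 v C (by tauto)
    · exact sum_eq_zero fun C _ => hz0 v C (by tauto)
  have hzB : ∀ C ∈ B, ∑ v, z' v C = 0 := by
    intro C hC
    rw [← hz.2 C hC, h2 C hC, ← sum_subset (subset_univ A)]
    · refine sum_congr rfl fun v _ => ?_
      split_ifs with h
      · rfl
      · exact hz0 v C (by tauto)
    · exact fun v _ hv => hz0 v C (by tauto)
  let c : V → Finset V → Finset V → ZMod 2 := fun v C t => if τ v C = t then z' v C else 0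
  have hc : ∀ v C t, c v C t ≠ 0 → v ∈ A ∧ C ∈ B ∧ v ∈ C ∧ τ v C = t := by
    intro v C t h
    simp only [c] at h
    split_ifs at h with h'
    · by_contra hcon
      exact h (hz0 v C (by tauto))
    · exact absurd rfl h
  have hcC : ∀ v C t, c v C t ≠ 0 → t ∈ P.region C := fun v C t h => by
    obtain ⟨-, h2, h3, rfl⟩ := hc v C t h
    exact (hτ C h2 v h3).1
  have hx : ∀ C ∈ B, ∃ x : Finset V → ZMod 2,
      (∀ e, x e ≠ 0 → ((P.region C).filter (e ⊆ ·)).card = 2) ∧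
      ∀ t ∈ P.tri, ∑ e ∈ t.powersetCard 2, x e = ∑ v, c v C t := by
    intro C hC
    refine P.flow C (hB hC) (fun t => ∑ v, c v C t) (fun t ht => ?_) ?_
    · refine sum_eq_zero fun v _ => ?_
      by_contra h
      exact ht (hcC v C t h)
    · rw [sum_comm, ← hzB C hC]
      refine sum_congr rfl fun v _ => ?_
      simp only [c]
      rw [sum_ite_eq]
      split_ifs with h
      · rfl
      · symm
        refine hz0 v C fun h' => h (hτ C h'.2.1 v h'.2.2).1
  have hy : ∀ v, ∃ y : Finset V → ZMod 2,
      (∀ e, y e ≠ 0 → v ∈ e ∧ (P.tri.filter (e ⊆ ·)).card = 2) ∧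
      ∀ t ∈ P.tri, ∑ e ∈ t.powersetCard 2, y e = ∑ C ∈ B, c v C t := by
    intro v
    refine P.link v (fun t => ∑ C ∈ B, c v C t) (fun t ht => ?_) ?_
    · refine sum_eq_zero fun C hC => ?_
      by_contra h
      obtain ⟨-, h2, h3, h4⟩ := hc v C t h
      exact ht ⟨P.region_subset C (hB hC) (hcC v C t h), h4 ▸ (hτ C h2 v h3).2⟩
    · rw [sum_comm, ← hzA v]
      refine sum_congr rfl fun C hC => ?_
      simp only [c]
      rw [sum_ite_eq]
      split_ifs with h
      · rfl
      · symm
        refine hz0 v C fun h' => h (P.region_subset C (hB hC) (hτ C h'.2.1 v h'.2.2).1)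
  choose! x hx1 hx2 using hx
  choose y hy1 hy2 using hy
  have hy0 : ∀ v e, v ∉ e → y v e = 0 := fun v e h => by
    by_contra h'
    exact h (hy1 v e h').1
  obtain ⟨g, hg⟩ := P.exact (fun e => ∑ C ∈ B, x C e + ∑ v, y v e) (fun t ht => by
    rw [sum_add_distrib, sum_comm, sum_comm (s := t.powersetCard 2) (t := univ),
      sum_congr rfl fun C hC => hx2 C hC t ht, sum_congr rfl fun v _ => hy2 v t ht, sum_comm]
    exact CharTwo.add_self_eq_zero _)
  have hcorner : ∀ t ∈ P.tri, ∀ v ∈ t,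
      ∑ e ∈ (t.powersetCard 2).filter (v ∈ ·), (g v + y v e) = ∑ C ∈ B, c v C t := by
    intro t ht v hv
    rw [← hy2 v t ht, sum_add_distrib]
    obtain ⟨e₁, e₂, hne, he⟩ := exists_filter_powersetCard_two_eq (P.card_tri t ht) hv
    have : ∑ e ∈ (t.powersetCard 2).filter (v ∈ ·), g v = 0 := by
      rw [he, sum_pair hne]
      exact CharTwo.add_self_eq_zero _
    rw [this, zero_add, sum_filter]
    refine sum_congr rfl fun e _ => ?_
    split_ifs with h
    · rfl
    · exact (hy0 v e h).symm
  -- Constancy along an edge not interior to any region holds since every `x C` vanishes there;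
  -- along the boundary, since `y v` does.
  let G₀ : V × Finset V → ZMod 2 := fun f => g f.1 + y f.1 f.2
  have hG₀ : ∀ f f', P.FlagRel A B τ f f' → G₀ f = G₀ f' := by
    intro f f' hff
    cases hff with
    | @edge v w e t ht he hv hw hcr =>
      by_cases hvw : v = w
      · rw [hvw]
      have hge := hg t ht e he
      have hx0 : ∑ C ∈ B, x C e = 0 := sum_eq_zero fun C hC => by
        by_contra h
        exact hcr C hC (hx1 C hC e h)
      have hevw : e = {v, w} := by
        symm
        apply eq_of_subset_of_card_le
        · simp [insert_subset_iff, hv, hw]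
        · rw [(mem_powersetCard.mp he).2, card_pair hvw]
      have hys : ∑ u, y u e = y v e + y w e := by
        rw [← sum_pair (f := fun u => y u e) hvw]
        symm
        refine sum_subset (subset_univ _) fun u _ hu => hy0 u e ?_
        rwa [hevw]
      rw [hx0, zero_add, hys, hevw, sum_pair hvw] at hge
      simp only [G₀]
      rw [hevw]
      linear_combination hge + CharTwo.add_self_eq_zero (g v) -
        CharTwo.add_self_eq_zero (y w {v, w})
    | @corner v e e' t ht hve hve' he he' hne =>
      have hvt : v ∈ t := (mem_powersetCard.mp he).1 hve
      by_cases hee : e = e'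
      · rw [hee]
      have h := hcorner t ht v hvt
      obtain ⟨e₁, e₂, hne', hfil⟩ := exists_filter_powersetCard_two_eq (P.card_tri t ht) hvt
      have hfil' : (t.powersetCard 2).filter (v ∈ ·) = {e, e'} := by
        symm
        apply eq_of_subset_of_card_le
        · simp [insert_subset_iff, hve, hve', he, he', -mem_powersetCard]
        · rw [hfil, card_pair hne', card_pair hee]
      have h0 : ∑ C ∈ B, c v C t = 0 := sum_eq_zero fun C hC => by
        by_contra h'
        obtain ⟨i1, i2, i3, i4⟩ := hc v C t h'
        exact hne C i2 i1 i3 i4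
      rw [hfil', sum_pair hee, h0] at h
      exact CharTwo.add_eq_zero.mp h
    | @boundary v e e' hv hv' hc hc' hb hb' =>
      have h1 : ∀ e, (P.tri.filter (e ⊆ ·)).card = 1 → y v e = 0 := by
        intro e hb
        by_contra h
        have := (hy1 v e h).2
        omega
      simp [G₀, h1 e hb, h1 e' hb']
  refine ⟨Quot.lift G₀ hG₀, ?_⟩
  ext p
  obtain ⟨i1, i2, i3⟩ := incidence_mem p
  obtain ⟨i4, i5⟩ := hτ _ i2 _ i3
  rw [coboundary_apply, hz' p]
  change ∑ e ∈ _, (g p.1.1 + y p.1.1 e) = _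
  rw [hcorner _ (P.region_subset _ (hB i2) i4) _ i5, sum_eq_single p.1.2]
  · simp [c]
  · intro C hC hCne
    by_contra h
    have h3 := hcC _ _ _ h
    exact Finset.disjoint_left.mp (P.region_disjoint C (hB hC) p.1.2 (hB i2) hCne) h3 i4
  · exact fun h => absurd i2 h

/-- Let `k` be the dimension of the cycle space, `N` the number of nodes and `E` that of incidences.
Then `E + 1 ≤ k + N`, and if `k > 0` also `6 (k + 1) ≤ 2 E`, because the coboundaries of single
faces have at least six edges unless they vanish, while each edge borders at most two faces.
Eliminate `k`. -/
theorem two_mul_card_incidence_add_six_le (hB : B ⊆ P.lines)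
    (hint : ∀ C ∈ B, ∀ C' ∈ B, C ≠ C' → (C ∩ C').card ≤ 1) (h4 : 4 ≤ A.card + B.card) :
    2 * ((A ×ˢ B).filter fun p => p.1 ∈ p.2).card + 6 ≤ 3 * (A.card + B.card) := by
  classical
  have hτ : ∀ v C, ∃ t, C ∈ B → v ∈ C → t ∈ P.region C ∧ v ∈ t := by
    intro v C
    by_cases h : C ∈ B ∧ v ∈ C
    · obtain ⟨t, ht⟩ := (P.mem_iff C (hB h.1) v).mp h.2
      exact ⟨t, fun _ _ => ht⟩
    · exact ⟨∅, fun h1 h2 => absurd ⟨h1, h2⟩ h⟩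
  choose τ hτ using hτ
  replace hτ : ∀ C ∈ B, ∀ v ∈ C, τ v C ∈ P.region C ∧ v ∈ τ v C := fun C hC v hv => hτ v C hC hv
  have hrange : LinearMap.range (P.coboundary A B τ) = LinearMap.ker (incidenceBoundary A B) := by
    apply le_antisymm
    · rintro _ ⟨G, rfl⟩
      exact coboundary_mem_ker hτ hB G
    · intro z hz
      exact exists_coboundary_eq hτ hB hz
  have hlow := finrank_ker_incidenceBoundary (A := A) (B := B) (by
    by_contra! h
    rw [h.1, h.2] at h4
    simp at h4)
  rw [← hrange] at hlow
  have hcard : Fintype.card (Incidence A B) = ((A ×ˢ B).filter fun p => p.1 ∈ p.2).card :=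
    Fintype.card_coe _
  -- For a forest, `E + 1 ≤ N` suffices only if `N ≥ 4`.
  rcases Nat.eq_zero_or_pos (Module.finrank (ZMod 2) (LinearMap.range (P.coboundary A B τ)))
    with h0 | hpos
  · omega
  have hpair : ∀ p : Incidence A B, ∃ e₁ e₂, e₁ ≠ e₂ ∧
      ((τ p.1.1 p.1.2).powersetCard 2).filter (p.1.1 ∈ ·) = {e₁, e₂} := by
    intro p
    obtain ⟨-, i2, i3⟩ := incidence_mem p
    obtain ⟨i4, i5⟩ := hτ _ i2 _ i3
    exact exists_filter_powersetCard_two_eq (P.card_tri _ (P.region_subset _ (hB i2) i4)) i5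
  have hup := (P.coboundary A B τ).mul_finrank_range_add_one_le 6 ?_ ?_ ?_ hpos
  · rw [hcard] at hup
    omega
  · ext p
    obtain ⟨e₁, e₂, hne, he⟩ := hpair p
    rw [coboundary_apply, cornerVal, he, sum_pair hne]
    rfl
  · intro p
    obtain ⟨e₁, e₂, hne, he⟩ := hpair p
    refine le_trans (card_le_card (t := {Quot.mk _ (p.1.1, e₁), Quot.mk _ (p.1.1, e₂)}) ?_)
      card_le_two
    intro q hq
    simp only [mem_filter, mem_univ, true_and] at hq
    rw [coboundary_apply, cornerVal, he, sum_pair hne] at hq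
    simp only [mem_insert, mem_singleton]
    by_contra! hcon
    simp [flagVal, hcon.1.symm, hcon.2.symm] at hq
  · intro q hq
    exact six_le_card_support hint (coboundary_mem_ker hτ hB _) hq

end PlanarRegions

end

/-! ### An order in which each node meets at most two earlier ones -/

section

open Finset

/-- Points and lines in the plane, such that two lines have at most one common point, each point
lies on three lines and each line contains three points, where up to four points on which nothing
is required are allowed: this is impossible. -/
theorem PlanarRegions.not_three_le_degree {V : Type*} [Fintype V] [DecidableEq V]
    (P : PlanarRegions V) {A K : Finset V} {B : Finset (Finset V)} (hB : B ⊆ P.lines)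
    (hint : ∀ C ∈ B, ∀ C' ∈ B, C ≠ C' → (C ∩ C').card ≤ 1) (hAK : Disjoint A K)
    (hK : K.card ≤ 4) (hne : A.Nonempty ∨ B.Nonempty)
    (hBK : ∀ C ∈ B, (K.filter (· ∈ C)).card ≤ 2)
    (hdeg : ∀ v ∈ A, 3 ≤ (B.filter (v ∈ ·)).card)
    (hdeg' : ∀ C ∈ B, 3 ≤ ((A ∪ K).filter (· ∈ C)).card) : False := by
  have h4 : 4 ≤ A.card + B.card := by
    obtain ⟨v, hv⟩ : A.Nonempty := by
      rcases hne with h | ⟨C, hC⟩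
      · exact h
      · by_contra h
        rw [not_nonempty_iff_eq_empty] at h
        have h1 := hdeg' C hC
        have h2 := hBK C hC
        rw [h, empty_union] at h1
        omega
    have h1 := hdeg v hv
    have h2 := card_le_card (filter_subset (v ∈ ·) B)
    have h3 : 0 < A.card := card_pos.mpr ⟨v, hv⟩
    omega
  -- Keep only the exceptional points on at least two lines. Each other one carries at most one
  -- incidence, so at most `4 - |J|` incidences are lost. Adding `hpt` and `hln` gives `3 N ≤ 2 E +
  -- 4` for the remaining graph, against `2 E + 6 ≤ 3 N`.
  let J := K.filter fun v => 2 ≤ (B.filter (v ∈ ·)).card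
  have hJ : J ⊆ K := filter_subset _ _
  have hAJ : Disjoint A J := hAK.mono_right hJ
  have hinc : ∀ D : Finset V, ((D ×ˢ B).filter fun p => p.1 ∈ p.2).card =
      ∑ v ∈ D, (B.filter (v ∈ ·)).card := fun D => by
    simp only [card_filter]
    rw [sum_product]
  have hinc' : ∀ D : Finset V, ((D ×ˢ B).filter fun p => p.1 ∈ p.2).card =
      ∑ C ∈ B, (D.filter (· ∈ C)).card := fun D => by
    simp only [card_filter]
    rw [sum_product_right]
  have hmain := P.two_mul_card_incidence_add_six_le (A := A ∪ J) hB hint (by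
    have := card_le_card (subset_union_left (s₁ := A) (s₂ := J))
    omega)
  have hpt : 3 * A.card + 2 * J.card ≤ (((A ∪ J) ×ˢ B).filter fun p => p.1 ∈ p.2).card := by
    rw [hinc, sum_union hAJ]
    have h1 := card_nsmul_le_sum A (fun v => (B.filter (v ∈ ·)).card) 3 hdeg
    have h2 := card_nsmul_le_sum J (fun v => (B.filter (v ∈ ·)).card) 2
      fun v hv => (mem_filter.mp hv).2
    simp only [smul_eq_mul] at h1 h2
    omega
  have hln : 3 * B.card + J.card ≤ (((A ∪ J) ×ˢ B).filter fun p => p.1 ∈ p.2).card + 4 := by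
    have h1 := card_nsmul_le_sum B (fun C => ((A ∪ K).filter (· ∈ C)).card) 3 hdeg'
    rw [← hinc', hinc, sum_union hAK, ← sum_sdiff hJ, smul_eq_mul] at h1
    have h2 : ∑ v ∈ K \ J, (B.filter (v ∈ ·)).card ≤ (K \ J).card * 1 := by
      rw [← smul_eq_mul]
      refine sum_le_card_nsmul _ _ _ fun v hv => ?_
      rw [mem_sdiff, mem_filter, not_and, not_le] at hv
      have := hv.2 hv.1
      omega
    have h3 := card_sdiff_add_card_eq_card hJ
    rw [hinc, sum_union hAJ]
    omega
  rw [card_union_of_disjoint hAJ] at hmain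
  omega

namespace OrientedComplex

variable {V : Type*} [DecidableEq V] (T : OrientedComplex V)

/-- By coherence, the third vertex of a triangle on an edge is determined by the direction that the
triangle induces on the edge, and there are two directions. -/
theorem card_filter_le_two {s : Finset (Finset V)} (hs : ∀ t ∈ s, t ∈ T.faces ∧ t.card = 3)
    {e : Finset V} (he : e.card = 2) : (s.filter (e ⊆ ·)).card ≤ 2 := by
  obtain ⟨v, w, hvw, rfl⟩ := card_eq_two.mp he
  by_contra! hcon
  have hpos : ∀ t ∈ s.filter ({v, w} ⊆ ·), ∃ c, t = {v, w, c} ∧ (T.pos v w c ∨ T.pos w v c) := by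
    intro t ht
    obtain ⟨hts, hsub⟩ := mem_filter.mp ht
    obtain ⟨hface, hcard⟩ := hs t hts
    obtain ⟨c, hc⟩ := card_eq_one.mp (show (t \ {v, w}).card = 1 by
      rw [card_sdiff_of_subset hsub, hcard, he])
    have ht' : t = {v, w, c} := by
      rw [← sdiff_union_of_subset hsub, hc]
      ext; simp only [mem_union, mem_singleton, mem_insert]; tauto
    have hcmem : c ∈ t \ {v, w} := hc ▸ mem_singleton_self c
    simp only [mem_sdiff, mem_insert, mem_singleton, not_or] at hcmem
    refine ⟨c, ht', ?_⟩
    rw [ht'] at hface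
    exact (T.mem_faces_iff v w c hvw (Ne.symm hcmem.2.2) (Ne.symm hcmem.2.1)).mp hface
  obtain ⟨t₁, t₂, t₃, h1, h2, h3, h12, h13, h23⟩ := two_lt_card_iff.mp hcon
  obtain ⟨c₁, rfl, hc₁⟩ := hpos t₁ h1
  obtain ⟨c₂, rfl, hc₂⟩ := hpos t₂ h2
  obtain ⟨c₃, rfl, hc₃⟩ := hpos t₃ h3
  have hco := T.coherent
  rcases hc₁ with hc₁ | hc₁ <;> rcases hc₂ with hc₂ | hc₂ <;> rcases hc₃ with hc₃ | hc₃
  all_goals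
    first
    | exact h12 (by rw [hco _ _ _ _ hc₁ hc₂])
    | exact h13 (by rw [hco _ _ _ _ hc₁ hc₃])
    | exact h23 (by rw [hco _ _ _ _ hc₂ hc₃])

end OrientedComplex

namespace ConstrainedTriangulation

variable {V : Type*} [Fintype V] [DecidableEq V] (T : ConstrainedTriangulation V)

open Classical in
/-- The finite set of the triangles. -/
noncomputable def triangles : Finset (Finset V) := univ.filter fun t => t ∈ T.faces ∧ t.card = 3

theorem mem_triangles {t : Finset V} : t ∈ T.triangles ↔ t ∈ T.faces ∧ t.card = 3 := by
  simp [triangles]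

theorem card_triangles_filter_le {e : Finset V} (he : e.card = 2) :
    (T.triangles.filter (e ⊆ ·)).card ≤ 2 :=
  T.card_filter_le_two (fun _ ht => T.mem_triangles.mp ht) he

theorem exists_eq_sum_of_cocycle (f : Finset V → ZMod 2)
    (hf : ∀ t ∈ T.triangles, ∑ e ∈ t.powersetCard 2, f e = 0) :
    ∃ g : V → ZMod 2, ∀ e : Finset V, e ∈ T.faces → e.card = 2 → f e = ∑ v ∈ e, g v := by
  obtain ⟨φ⟩ := T.disk
  have : CompactSpace T.toAbstractSimplicialComplex.realization := by
    have : CompactSpace (Metric.closedBall (0 : EuclideanSpace ℝ (Fin 2)) 1) :=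
      isCompact_iff_compactSpace.mp (isCompact_closedBall _ _)
    exact φ.symm.compactSpace
  have : ContractibleSpace T.toAbstractSimplicialComplex.realization := by
    have : ContractibleSpace (Metric.closedBall (0 : EuclideanSpace ℝ (Fin 2)) 1) :=
      (convex_closedBall _ _).contractibleSpace ⟨0, by simp⟩
    exact φ.contractibleSpace
  obtain ⟨g, hg⟩ := AbstractSimplicialComplex.exists_eq_add_of_cocycle
    (K := T.toAbstractSimplicialComplex) (f := f) (by
      intro a b c hab hbc hac hface
      have hcard : ({a, b, c} : Finset V).card = 3 :=
        card_eq_three.mpr ⟨a, b, c, hab, hac, hbc, rfl⟩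
      have h := hf {a, b, c} (T.mem_triangles.mpr ⟨hface, hcard⟩)
      have hp : ({a, b, c} : Finset V).powersetCard 2 = {{a, b}, {b, c}, {a, c}} := by
        symm
        apply eq_of_subset_of_card_le
        · intro e he
          simp only [mem_insert, mem_singleton] at he
          rw [mem_powersetCard]
          rcases he with rfl | rfl | rfl
          · exact ⟨by simp, card_pair hab⟩
          · exact ⟨by simp, card_pair hbc⟩
          · exact ⟨by simp [insert_subset_iff], card_pair hac⟩
        · rw [card_powersetCard, hcard, card_eq_three.mpr ⟨_, _, _, ?_, ?_, ?_, rfl⟩]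
          · rfl
          · intro h; have : a ∈ ({b, c} : Finset V) := h ▸ by simp
            simp [hab, hac] at this
          · intro h; have : b ∈ ({a, c} : Finset V) := h ▸ by simp
            simp [hab.symm, hbc] at this
          · intro h; have : b ∈ ({a, c} : Finset V) := h ▸ by simp
            simp [hab.symm, hbc] at this
      rw [hp, sum_insert, sum_pair, ← add_assoc] at h
      · exact h
      · intro h; have : b ∈ ({a, c} : Finset V) := h ▸ by simp
        simp [hab.symm, hbc] at this
      · simp only [mem_insert, mem_singleton, not_or]
        constructor
        · intro h; have : a ∈ ({b, c} : Finset V) := h ▸ by simp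
          simp [hab, hac] at this
        · intro h; have : b ∈ ({a, c} : Finset V) := h ▸ by simp
          simp [hab.symm, hbc] at this)
  refine ⟨g, fun e he hcard => ?_⟩
  obtain ⟨a, b, hab, rfl⟩ := card_eq_two.mp hcard
  rw [hg a b hab he, sum_pair hab]

theorem inter_mem_edges {s : Finset (Finset V)} (hs : s ⊆ T.triangles) {t t' e : Finset V}
    (ht : t ∈ s) (ht' : t' ∈ s) (hne : t ≠ t') (he : e.card = 2) (het : e ⊆ t) (het' : e ⊆ t') :
    t ∩ t' = e ∧ (s.filter (e ⊆ ·)).card = 2 := by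
  have h3 := (T.mem_triangles.mp (hs ht)).2
  have h3' := (T.mem_triangles.mp (hs ht')).2
  constructor
  · symm
    apply eq_of_subset_of_card_le (subset_inter het het')
    by_contra! h
    have h1 : t ∩ t' = t := eq_of_subset_of_card_le inter_subset_left (by omega)
    have h2 : t ∩ t' = t' := eq_of_subset_of_card_le inter_subset_right (by omega)
    exact hne (h1.symm.trans h2)
  · apply le_antisymm
    · exact (card_le_card (filter_subset_filter _ hs)).trans (T.card_triangles_filter_le he)
    · rw [← card_pair hne]
      refine card_le_card ?_
      simp [insert_subset_iff, ht, ht', het, het']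

/-- The link of `v` is connected. Mark the edges at `v` that lie on triangles reachable from `t₀`.
The two sides at `v` of a triangle are marked together, so the marking is a cocycle, hence the
coboundary of some `g`. It vanishes away from `v`, and the complement of `v` is connected, so `g` is
constant there and all edges at `v` have the same mark. -/
theorem reflTransGen_of_mem (v : V) {t₀ t₁ : Finset V} (ht₀ : t₀ ∈ T.triangles.filter (v ∈ ·))
    (ht₁ : t₁ ∈ T.triangles.filter (v ∈ ·)) :
    Relation.ReflTransGen (fun t t' => t ∈ T.triangles.filter (v ∈ ·) ∧
      t' ∈ T.triangles.filter (v ∈ ·) ∧ (t ∩ t').card = 2 ∧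
      t ∩ t' ∈ {e | v ∈ e ∧ (T.triangles.filter (e ⊆ ·)).card = 2}) t₀ t₁ := by
  classical
  set R : Finset V → Finset V → Prop := fun t t' => t ∈ T.triangles.filter (v ∈ ·) ∧
      t' ∈ T.triangles.filter (v ∈ ·) ∧ (t ∩ t').card = 2 ∧
      t ∩ t' ∈ {e | v ∈ e ∧ (T.triangles.filter (e ⊆ ·)).card = 2} with hR
  by_contra hcon
  let f : Finset V → ZMod 2 := fun e =>
    if v ∈ e ∧ ∃ t ∈ T.triangles, e ⊆ t ∧ Relation.ReflTransGen R t₀ t then 1 else 0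
  have hf : ∀ t ∈ T.triangles, ∀ e ∈ t.powersetCard 2, v ∈ e →
      f e = if Relation.ReflTransGen R t₀ t then 1 else 0 := by
    intro t ht e he hve
    obtain ⟨het, hcard⟩ := mem_powersetCard.mp he
    by_cases hr : Relation.ReflTransGen R t₀ t
    · simp only [f, hr, if_true]
      rw [if_pos ⟨hve, t, ht, het, hr⟩]
    · simp only [f, hr, if_false]
      rw [if_neg]
      rintro ⟨-, t', ht', het', hr'⟩
      have hne : t' ≠ t := by rintro rfl; exact hr hr'
      obtain ⟨h1, h2⟩ := T.inter_mem_edges subset_rfl ht' ht hne hcard het' het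
      refine hr (hr'.tail ⟨mem_filter.mpr ⟨ht', het' hve⟩, mem_filter.mpr ⟨ht, het hve⟩, ?_, ?_⟩)
      · rw [h1, hcard]
      · rw [h1]; exact ⟨hve, h2⟩
  have hf0 : ∀ e, v ∉ e → f e = 0 := fun e he => if_neg fun h => he h.1
  obtain ⟨g, hg⟩ := T.exists_eq_sum_of_cocycle f (by
    intro t ht
    by_cases hvt : v ∈ t
    · obtain ⟨e₁, e₂, hne, he⟩ := exists_filter_powersetCard_two_eq (T.mem_triangles.mp ht).2 hvt
      have h1 : ∑ e ∈ t.powersetCard 2, f e = ∑ e ∈ (t.powersetCard 2).filter (v ∈ ·), f e := by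
        rw [sum_filter]
        refine sum_congr rfl fun e _ => ?_
        split_ifs with h
        · rfl
        · exact hf0 e h
      rw [h1, sum_congr rfl fun e he => hf t ht e (mem_filter.mp he).1 (mem_filter.mp he).2,
        he, sum_pair hne]
      exact CharTwo.add_self_eq_zero _
    · exact sum_eq_zero fun e he => hf0 e fun h => hvt ((mem_powersetCard.mp he).1 h))
  obtain ⟨φ⟩ := T.disk
  have hvert : Pi.single v (1 : ℝ) ∈ T.toAbstractSimplicialComplex.realization :=
    ⟨single_mem_stdSimplex ℝ v, {v}, T.singleton_mem v, fun w hw => by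
      by_contra h
      simp only [mem_singleton] at h
      exact hw (Pi.single_eq_of_ne h _)⟩
  have hconst {a b : V} (ha : a ≠ v) (hb : b ≠ v) : g a = g b :=
    AbstractSimplicialComplex.eq_of_isPreconnected_diff v
    (AbstractSimplicialComplex.isPreconnected_realization_diff φ _ hvert) g (by
      intro a b ha hb hab hface
      have h := hg {a, b} hface (card_pair hab)
      rw [hf0 _ (by simp [ha.symm, hb.symm]), sum_pair hab] at h
      exact CharTwo.add_eq_zero.mp h.symm) ha hb
  have key : ∀ t ∈ T.triangles.filter (v ∈ ·), ∃ a, a ≠ v ∧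
      (if Relation.ReflTransGen R t₀ t then 1 else 0) = g v + g a := by
    intro t ht
    obtain ⟨ht, hvt⟩ := mem_filter.mp ht
    obtain ⟨hface, hcard⟩ := T.mem_triangles.mp ht
    obtain ⟨a, ha⟩ : (t.erase v).Nonempty := by
      rw [← card_pos, card_erase_of_mem hvt, hcard]; norm_num
    obtain ⟨hav, hat⟩ := mem_erase.mp ha
    have hsub : {v, a} ⊆ t := by simp [insert_subset_iff, hvt, hat]
    refine ⟨a, hav, ?_⟩
    rw [← hf t ht {v, a} (mem_powersetCard.mpr ⟨hsub, card_pair hav.symm⟩) (by simp),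
      hg _ ((T.isRelLowerSet_faces hface).2 hsub (by simp)) (card_pair hav.symm),
      sum_pair hav.symm]
  obtain ⟨a, ha, h0⟩ := key t₀ ht₀
  obtain ⟨b, hb, h1⟩ := key t₁ ht₁
  rw [if_pos Relation.ReflTransGen.refl, hconst ha hb] at h0
  rw [if_neg hcon, ← h0] at h1
  exact zero_ne_one h1

/-- The planar regions given by the constraints. -/
theorem exists_planarRegions : ∃ P : PlanarRegions V, P.lines = T.constraints := by
  classical
  obtain ⟨S, hS, hdisj⟩ := T.contiguous
  let reg : Finset V → Finset (Finset V) := fun C =>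
    T.triangles.filter fun t => ∃ h, (⟨t, h⟩ : T.Triangle) ∈ S C
  have hreg : ∀ C, reg C ⊆ T.triangles := fun C => filter_subset _ _
  have hmem : ∀ C (t : T.Triangle), t ∈ S C → t.1 ∈ reg C := fun C t ht =>
    mem_filter.mpr ⟨T.mem_triangles.mpr t.2, t.2, ht⟩
  refine ⟨{
    tri := T.triangles
    card_tri := fun t ht => (T.mem_triangles.mp ht).2
    card_edge := fun e he => T.card_triangles_filter_le he
    exact := fun f hf => by
      obtain ⟨g, hg⟩ := T.exists_eq_sum_of_cocycle f hf
      refine ⟨g, fun t ht e he => ?_⟩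
      obtain ⟨het, hcard⟩ := mem_powersetCard.mp he
      refine hg e ((T.isRelLowerSet_faces (T.mem_triangles.mp ht).1).2 het ?_) hcard
      rw [← card_pos]; omega
    link := fun v c hc hsum => by
      obtain ⟨y, hy1, hy2⟩ := exists_flow T.triangles (fun t ht => (T.mem_triangles.mp ht).2)
        (fun e he => T.card_triangles_filter_le he) (T.triangles.filter (v ∈ ·))
        (filter_subset _ _) {e | v ∈ e ∧ (T.triangles.filter (e ⊆ ·)).card = 2}
        (fun t ht t' ht' => T.reflTransGen_of_mem v ht ht') c
        (fun t ht => hc t (by simpa using ht)) (by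
          rw [← hsum, sum_filter]
          refine sum_congr rfl fun t ht => ?_
          split_ifs with h
          · rfl
          · exact (hc t fun h' => h h'.2).symm)
      exact ⟨y, hy1, hy2⟩
    lines := T.constraints
    region := reg
    region_subset := fun C _ => hreg C
    region_disjoint := fun C hC C' hC' hne => by
      rw [Finset.disjoint_left]
      intro t ht ht'
      obtain ⟨-, h, hm⟩ := mem_filter.mp ht
      obtain ⟨-, h', hm'⟩ := mem_filter.mp ht'
      exact Set.disjoint_left.mp (hdisj C hC C' hC' hne) hm hm'
    mem_iff := fun C hC v => by
      rw [(hS C hC).2 v]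
      constructor
      · rintro ⟨t, ht, hv⟩
        exact ⟨t.1, hmem C t ht, hv⟩
      · rintro ⟨t, ht, hv⟩
        obtain ⟨-, h, hm⟩ := mem_filter.mp ht
        exact ⟨⟨t, h⟩, hm, hv⟩
    flow := fun C hC c hc hsum => by
      obtain ⟨y, hy1, hy2⟩ := exists_flow T.triangles (fun t ht => (T.mem_triangles.mp ht).2)
        (fun e he => T.card_triangles_filter_le he) (reg C) (hreg C)
        {e | ((reg C).filter (e ⊆ ·)).card = 2} (by
          intro t ht t' ht'
          obtain ⟨-, h, hm⟩ := mem_filter.mp ht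
          obtain ⟨-, h', hm'⟩ := mem_filter.mp ht'
          have hconn := (hS C hC).1.preconnected ⟨⟨t, h⟩, hm⟩ ⟨⟨t', h'⟩, hm'⟩
          rw [SimpleGraph.reachable_iff_reflTransGen] at hconn
          refine hconn.lift (fun t => t.1.1) fun u u' huu => ?_
          have hcard : (u.1.1 ∩ u'.1.1).card = 2 := huu
          have hne : u.1.1 ≠ u'.1.1 := by
            intro h
            rw [h, inter_self, u'.1.2.2] at hcard
            omega
          exact ⟨hmem C u.1 u.2, hmem C u'.1 u'.2, hcard, (T.inter_mem_edges (hreg C)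
            (hmem C u.1 u.2) (hmem C u'.1 u'.2) hne hcard inter_subset_left
            inter_subset_right).2⟩) c hc hsum
      exact ⟨y, hy1, hy2⟩ }, rfl⟩

-- Two common vertices have distinct images, which would span both lines. This is how genericity
-- bounds the girth of the incidence graph.
variable {T} in
theorem IsGenericDrawing.card_inter_le_one {ρ : V → Fin 2 → ℂ} (hρ : T.IsGenericDrawing ρ)
    {C C' : Finset V} (hC : C ∈ T.constraints) (hC' : C' ∈ T.constraints) (hne : C ≠ C') :
    (C ∩ C').card ≤ 1 := by
  obtain ⟨⟨hcol, -⟩, -, -, hinj, hspan⟩ := hρ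
  rw [card_le_one]
  intro a ha b hb
  by_contra hab
  obtain ⟨ha1, ha2⟩ := mem_inter.mp ha
  obtain ⟨hb1, hb2⟩ := mem_inter.mp hb
  refine hspan C hC C' hC' hne ⟨a, ha⟩ ?_
  rw [← (hcol C hC).affineSpan_eq_of_ne (Set.mem_image_of_mem ρ ha1) (Set.mem_image_of_mem ρ hb1)
    (hinj.ne hab), ← (hcol C' hC').affineSpan_eq_of_ne (Set.mem_image_of_mem ρ ha2)
    (Set.mem_image_of_mem ρ hb2) (hinj.ne hab)]

/-- The set of the four corners. -/
def corners : Finset V := univ.image T.corner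

-- Among three of the four corners there are always three consecutive ones, and these are not
-- collinear.
variable {T} in
theorem IsGenericDrawing.card_filter_corners_le {ρ : V → Fin 2 → ℂ} (hρ : T.IsGenericDrawing ρ)
    {C : Finset V} (hC : C ∈ T.constraints) : (T.corners.filter (· ∈ C)).card ≤ 2 := by
  by_contra! h
  rw [corners, filter_image, card_image_of_injective _ T.corner_injective] at h
  have hdec : ∀ s : Finset (Fin 4), 2 < s.card → ∃ i, i ∈ s ∧ i + 1 ∈ s ∧ i + 2 ∈ s := by decide
  obtain ⟨i, h0, h1, h2⟩ := hdec _ h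
  simp only [mem_filter, mem_univ, true_and] at h0 h1 h2
  refine hρ.2.1 i ((hρ.1.1 C hC).subset ?_)
  rintro x (rfl | rfl | rfl)
  · exact Set.mem_image_of_mem ρ h0
  · exact Set.mem_image_of_mem ρ h1
  · exact Set.mem_image_of_mem ρ h2

/-- The vertices and the constraints. -/
abbrev Node : Type _ := V ⊕ T.constraints

/-- Incidence of vertices and constraints. -/
def Adj : T.Node → T.Node → Prop
  | Sum.inl v, Sum.inr C => v ∈ C.1
  | Sum.inr C, Sum.inl v => v ∈ C.1
  | _, _ => False

theorem adj_symm {e f : T.Node} (h : T.Adj e f) : T.Adj f e := by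
  rcases e with v | C <;> rcases f with w | D <;> exact h

open Classical in
/-- In a drawable triangulation, one can add the vertices and the constraints to the corners one
after the other, so that each is incident to at most two previous ones. -/
theorem exists_card_filter_adj_le_two (hT : T.Drawable) (S : Finset T.Node) (hS : S.Nonempty)
    (hcor : ∀ i, Sum.inl (T.corner i) ∉ S) :
    ∃ e ∈ S, ((S ∪ T.corners.map ⟨Sum.inl, Sum.inl_injective⟩).filter (T.Adj e)).card ≤ 2 := by
  obtain ⟨ρ, hρ⟩ := hT
  obtain ⟨P, hP⟩ := T.exists_planarRegions
  by_contra! hcon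
  let A : Finset V := univ.filter fun v => Sum.inl v ∈ S
  let B' : Finset T.constraints := univ.filter fun C => Sum.inr C ∈ S
  let B : Finset (Finset V) := B'.map ⟨Subtype.val, Subtype.val_injective⟩
  have hB : ∀ C ∈ B, C ∈ T.constraints := by
    intro C hC
    obtain ⟨C', -, rfl⟩ := mem_map.mp hC
    exact C'.2
  refine P.not_three_le_degree (A := A) (K := T.corners) (B := B) (hP ▸ hB)
    (fun C hC C' hC' hne => hρ.card_inter_le_one (hB C hC) (hB C' hC') hne) ?_ ?_ ?_
    (fun C hC => hρ.card_filter_corners_le (hB C hC)) ?_ ?_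
  · rw [Finset.disjoint_left]
    rintro v hv hv'
    obtain ⟨i, -, rfl⟩ := mem_image.mp hv'
    exact hcor i (mem_filter.mp hv).2
  · exact card_image_le.trans (by simp)
  · obtain ⟨v | C, h⟩ := hS
    · exact Or.inl ⟨v, by simpa [A] using h⟩
    · exact Or.inr ⟨C.1, mem_map.mpr ⟨C, by simpa [B'] using h, rfl⟩⟩
  · intro v hv
    have h := hcon (Sum.inl v) (mem_filter.mp hv).2
    refine le_trans h (le_trans (card_le_card ?_) (card_image_le (s := B.filter (v ∈ ·))
      (f := fun C => if h : C ∈ T.constraints then (Sum.inr ⟨C, h⟩ : T.Node) else Sum.inl v)))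
    intro f hf
    obtain ⟨hfS, hadj⟩ := mem_filter.mp hf
    rcases f with w | C
    · exact absurd hadj (by simp [Adj])
    · rw [mem_image]
      refine ⟨C.1, mem_filter.mpr ⟨mem_map.mpr ⟨C, ?_, rfl⟩, hadj⟩, by simp⟩
      simpa [B'] using hfS
  · intro C hC
    obtain ⟨C', hC', rfl⟩ := mem_map.mp hC
    have h := hcon (Sum.inr C') (mem_filter.mp hC').2
    refine le_trans h (le_trans (card_le_card ?_) (card_image_le (f := Sum.inl)))
    intro f hf
    obtain ⟨hfS, hadj⟩ := mem_filter.mp hf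
    rcases f with w | D
    · refine mem_image.mpr ⟨w, mem_filter.mpr ⟨?_, hadj⟩, rfl⟩
      simpa [A] using hfS
    · exact absurd hadj (by simp [Adj])

end ConstrainedTriangulation

end

/-! ### Density of Zariski open subsets in the usual topology -/

/-- A surjective homomorphism to an algebraically closed field extends to an integral extension. -/
theorem exists_ringHom_comp_algebraMap_eq {S B k : Type*} [CommRing S] [CommRing B] [Algebra S B]
    [Algebra.IsIntegral S B] (hinj : Function.Injective (algebraMap S B)) [Field k] [IsAlgClosed k]
    (χ : S →+* k) (hχ : Function.Surjective χ) :
    ∃ Ψ : B →+* k, Ψ.comp (algebraMap S B) = χ := by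
  have hmax : (RingHom.ker χ).IsMaximal := RingHom.ker_isMaximal_of_surjective χ hχ
  obtain ⟨Q, hQ, hQc⟩ := Ideal.exists_ideal_over_maximal_of_isIntegral (S := B) (RingHom.ker χ)
    (by rw [(RingHom.injective_iff_ker_eq_bot _).mp hinj]; exact bot_le)
  let e := RingHom.quotientKerEquivOfSurjective hχ
  let q : S ⧸ RingHom.ker χ →+* B ⧸ Q := Ideal.quotientMap Q (algebraMap S B) hQc.ge
  have hq : q.IsIntegral := by
    rintro x
    obtain ⟨b, rfl⟩ := Ideal.Quotient.mk_surjective x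
    obtain ⟨p, hp, hpb⟩ := Algebra.IsIntegral.isIntegral (R := S) b
    refine ⟨p.map (Ideal.Quotient.mk _), hp.map _, ?_⟩
    rw [Polynomial.eval₂_map]
    have : q.comp (Ideal.Quotient.mk (RingHom.ker χ)) =
        (Ideal.Quotient.mk Q).comp (algebraMap S B) := by ext; rfl
    rw [this, ← Polynomial.hom_eval₂, hpb, map_zero]
  -- The domain `B ⧸ Q` is integral over the algebraically closed field `k`, hence equal to it.
  let f : k →+* B ⧸ Q := q.comp e.symm.toRingHom
  have hf : f.IsIntegral := RingHom.IsIntegral.trans _ _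
    (RingHom.isIntegral_of_surjective _ e.symm.surjective) hq
  have : IsDomain (B ⧸ Q) := Ideal.Quotient.isDomain Q
  have hbij := IsAlgClosed.ringHom_bijective_of_isIntegral f hf
  refine ⟨(RingEquiv.ofBijective f hbij).symm.toRingHom.comp (Ideal.Quotient.mk Q), ?_⟩
  ext s
  change (RingEquiv.ofBijective f hbij).symm (Ideal.Quotient.mk Q (algebraMap S B s)) = χ s
  rw [RingEquiv.symm_apply_eq]
  change _ = q (e.symm (χ s))
  have : e.symm (χ s) = Ideal.Quotient.mk _ s := by
    rw [RingEquiv.symm_apply_eq]; rfl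
  rw [this]
  rfl

/-- If `θ` is integral over an integrally closed subring, each root of a specialization of the
minimal polynomial of `θ` is the value of `θ` at a point above. -/
theorem exists_ringHom_of_root_minpoly {A B k : Type*} [CommRing A] [IsDomain A]
    [IsIntegrallyClosed A] [CommRing B] [IsDomain B] [Algebra A B] [Module.IsTorsionFree A B]
    [Algebra.IsIntegral A B] [Field k] [IsAlgClosed k] (ε : A →+* k) (hε : Function.Surjective ε)
    (θ : B) (r : k) (hr : (minpoly A θ).eval₂ ε r = 0) :
    ∃ Ψ : B →+* k, Ψ.comp (algebraMap A B) = ε ∧ Ψ θ = r := by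
  have hθ : IsIntegral A θ := Algebra.IsIntegral.isIntegral θ
  -- Since `A` is integrally closed, `A[θ]` is the quotient of the polynomial ring by the minimal
  -- polynomial over `A`. A root therefore defines a homomorphism on `A[θ]`, which extends to `B`.
  let E := minpoly.equivAdjoin hθ
  let χ : Algebra.adjoin A {θ} →+* k := (AdjoinRoot.lift ε r hr).comp E.symm.toRingEquiv.toRingHom
  have hχA : ∀ a, χ (algebraMap A _ a) = ε a := by
    intro a
    change AdjoinRoot.lift ε r hr (E.symm (algebraMap A _ a)) = ε a
    rw [AlgEquiv.commutes]
    exact AdjoinRoot.lift_of hr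
  have hχθ : χ ⟨θ, Algebra.self_mem_adjoin_singleton A θ⟩ = r := by
    have h : E (AdjoinRoot.root _) = ⟨θ, Algebra.self_mem_adjoin_singleton A θ⟩ := by
      rw [minpoly.coe_equivAdjoin, AdjoinRoot.Minpoly.toAdjoin, AdjoinRoot.liftAlgHom_root]
    change AdjoinRoot.lift ε r hr (E.symm _) = r
    rw [← h, AlgEquiv.symm_apply_apply]
    exact AdjoinRoot.lift_root hr
  have : Algebra.IsIntegral (Algebra.adjoin A {θ}) B := ⟨fun x =>
    (Algebra.IsIntegral.isIntegral (R := A) x).tower_top⟩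
  obtain ⟨Ψ, hΨ⟩ := exists_ringHom_comp_algebraMap_eq (B := B) Subtype.val_injective χ
    (fun y => by obtain ⟨a, rfl⟩ := hε y; exact ⟨_, hχA a⟩)
  refine ⟨Ψ, ?_, ?_⟩
  · ext a
    rw [← hχA a, ← hΨ]
    rfl
  · rw [← hχθ, ← hΨ]
    rfl

/-- The norm of the value at `t` is the product of the distances from `t` to the roots; take the
nearest root. -/
theorem Polynomial.exists_root_norm_sub_pow_le (q : Polynomial ℂ) (hq : q.Monic)
    (hd : 0 < q.natDegree) (t : ℂ) :
    ∃ r, q.eval r = 0 ∧ ‖t - r‖ ^ q.natDegree ≤ ‖q.eval t‖ := by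
  have hs := IsAlgClosed.splits q
  have hprod : q = (q.roots.map fun r => Polynomial.X - Polynomial.C r).prod :=
    hs.eq_prod_roots_of_monic hq
  have hcard : q.roots.card = q.natDegree := hs.natDegree_eq_card_roots.symm
  have heval : ‖q.eval t‖ = (q.roots.map fun r => ‖t - r‖).prod := by
    conv_lhs => rw [hprod]
    rw [Polynomial.eval_multiset_prod, Multiset.map_map]
    have := map_multiset_prod (normHom : ℂ →*₀ ℝ)
      (Multiset.map ((Polynomial.eval t) ∘ fun r => Polynomial.X - Polynomial.C r) q.roots)
    rw [Multiset.map_map] at this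
    simpa [Function.comp_def] using this
  have hne : q.roots.toFinset.Nonempty := by
    rw [Multiset.toFinset_nonempty, ← Multiset.card_pos, hcard]
    exact hd
  obtain ⟨r, hr, hmin⟩ := Finset.exists_min_image _ (fun r => ‖t - r‖) hne
  refine ⟨r, (Polynomial.mem_roots'.mp (Multiset.mem_toFinset.mp hr)).2, ?_⟩
  rw [heval, ← hcard]
  have := Multiset.prod_map_le_prod_map₀ (s := q.roots) (fun _ => ‖t - r‖) (fun x => ‖t - x‖)
    (fun _ _ => norm_nonneg _) (fun x hx => hmin x (Multiset.mem_toFinset.mpr hx))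
  simpa using this

/-- Restrict `h` to the complex line from `a` to a point where `h` does not vanish: only finitely
many zeros lie on it. -/
theorem MvPolynomial.dense_setOf_eval_ne_zero {τ : Type*} [Finite τ] {h : MvPolynomial τ ℂ}
    (hh : h ≠ 0) : Dense {a : τ → ℂ | MvPolynomial.eval a h ≠ 0} := by
  intro a
  obtain ⟨c, hc⟩ : ∃ c, MvPolynomial.eval c h ≠ 0 := by
    by_contra! hcon
    exact hh (MvPolynomial.funext fun x => by rw [hcon, map_zero])
  let q : Polynomial ℂ := MvPolynomial.aeval
    (fun i => Polynomial.C (a i) + Polynomial.X * Polynomial.C (c i - a i)) h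
  have hq : ∀ t, q.eval t = MvPolynomial.eval (fun i => a i + t * (c i - a i)) h := by
    intro t
    change Polynomial.evalRingHom t q = _
    simp only [q]
    rw [MvPolynomial.aeval_def, ← MvPolynomial.coe_eval₂Hom, ← RingHom.comp_apply]
    have : (Polynomial.evalRingHom t).comp (MvPolynomial.eval₂Hom (algebraMap ℂ (Polynomial ℂ))
        (fun i => Polynomial.C (a i) + Polynomial.X * Polynomial.C (c i - a i))) =
        MvPolynomial.eval (fun i => a i + t * (c i - a i)) := by
      ext <;> simp
    rw [this]
  have hq0 : q ≠ 0 := by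
    intro h0
    have := hq 1
    rw [h0] at this
    simp at this
    exact hc this.symm
  have hd : Dense {t : ℂ | q.eval t ≠ 0} := by
    have : {t : ℂ | q.eval t ≠ 0} = {t | q.IsRoot t}ᶜ := rfl
    rw [this]
    exact (Polynomial.finite_setOfPred_isRoot hq0).countable.dense_compl ℂ
  have hcont : Continuous fun t : ℂ => fun i => a i + t * (c i - a i) := by fun_prop
  have h0 := hcont.range_subset_closure_image_dense hd (Set.mem_range_self 0)
  simp only [zero_mul, add_zero] at h0
  refine closure_mono ?_ h0
  rintro _ ⟨t, ht, rfl⟩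
  change _ ≠ _
  rw [← hq]
  exact ht

/-- The Cauchy bound, weakened to a continuous function of the coefficients. It keeps the roots
bounded when the coefficients converge. -/
theorem Polynomial.norm_root_le_of_monic {q : Polynomial ℂ} (hq : q.Monic) {x : ℂ}
    (hx : q.eval x = 0) : ‖x‖ ≤ ∑ i ∈ Finset.range q.natDegree, ‖q.coeff i‖ + 1 := by
  have h := (Polynomial.IsRoot.norm_lt_cauchyBound hq.ne_zero hx).le
  have h2 : Polynomial.cauchyBound q ≤ ∑ i ∈ Finset.range q.natDegree, ‖q.coeff i‖₊ + 1 := by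
    rw [Polynomial.cauchyBound, hq.leadingCoeff, nnnorm_one, div_one]
    gcongr
    exact Finset.sup_le fun i hi =>
      Finset.single_le_sum (f := fun i => ‖q.coeff i‖₊) (fun _ _ => zero_le) hi
  have h3 := h.trans h2
  rw [← NNReal.coe_le_coe] at h3
  simpa using h3

namespace MvPolynomial

variable {σ : Type*} [Finite σ]

omit [Finite σ] in
theorem isClosed_zeroLocus (I : Ideal (MvPolynomial σ ℂ)) : IsClosed (zeroLocus ℂ I) := by
  have : zeroLocus ℂ I = ⋂ p ∈ I, {x | eval x p = 0} := by
    ext x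
    simp [mem_zeroLocus_iff, aeval_eq_eval]
  rw [this]
  exact isClosed_biInter fun p _ => isClosed_eq (continuous_eval p) continuous_const

open Filter Topology in
/-- A nonempty Zariski open subset of an irreducible variety is dense in the usual topology. -/
theorem zeroLocus_subset_closure (I : Ideal (MvPolynomial σ ℂ)) [I.IsPrime]
    {f : MvPolynomial σ ℂ} (hf : f ∉ I) :
    zeroLocus ℂ I ⊆ closure {x | x ∈ zeroLocus ℂ I ∧ eval x f ≠ 0} := by
  intro z hz
  have := Fintype.ofFinite σ
  let B := MvPolynomial σ ℂ ⧸ I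
  -- Noether normalization: the variety is finite over an affine space, through the map `base`.
  obtain ⟨s, g, hginj, hgint⟩ := exists_integral_inj_algHom_of_fg ℂ B
  let : Algebra (MvPolynomial (Fin s) ℂ) B := g.toRingHom.toAlgebra
  have : Algebra.IsIntegral (MvPolynomial (Fin s) ℂ) B := ⟨hgint⟩
  have : FaithfulSMul (MvPolynomial (Fin s) ℂ) B := (faithfulSMul_iff_algebraMap_injective _ _).mpr hginj
  have hgA : ∀ a, algebraMap (MvPolynomial (Fin s) ℂ) B a = g a := fun _ => rfl
  let mk : MvPolynomial σ ℂ →+* B := Ideal.Quotient.mk I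
  have hmk : Function.Surjective mk := Ideal.Quotient.mk_surjective
  choose t ht using fun j => hmk (g (X j))
  let base : (σ → ℂ) → (Fin s → ℂ) := fun x j => eval x (t j)
  have hbase : Continuous base := continuous_pi fun j => continuous_eval (t j)
  -- the homomorphism given by a point, and the point given by a homomorphism
  have hpt : ∀ x ∈ zeroLocus ℂ I, ∃ Ψ : B →+* ℂ, (∀ p, Ψ (mk p) = eval x p) ∧
      ∀ a, Ψ (g a) = eval (base x) a := by
    intro x hx
    let Ψ : B →+* ℂ := Ideal.Quotient.lift I (eval x) fun p hp => by
      simpa [aeval_eq_eval] using hx p hp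
    have h1 : ∀ p, Ψ (mk p) = eval x p := fun p => Ideal.Quotient.lift_mk _ _ _
    refine ⟨Ψ, h1, fun a => ?_⟩
    have : Ψ.comp g.toRingHom = eval (base x) := by
      ext j
      · simp only [RingHom.comp_apply]
        have : g.toRingHom (C j) = mk (C j) := g.commutes j
        rw [this, h1, eval_C, eval_C]
      · simp only [RingHom.comp_apply]
        have : g.toRingHom (X j) = mk (t j) := (ht j).symm
        rw [this, h1, eval_X]
    exact RingHom.congr_fun this a
  have hhom : ∀ (b : Fin s → ℂ) (Ψ : B →+* ℂ), (∀ a, Ψ (g a) = eval b a) →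
      ∃ x ∈ zeroLocus ℂ I, (∀ p, Ψ (mk p) = eval x p) ∧ base x = b := by
    intro b Ψ hΨ
    have h1 : ∀ p, Ψ (mk p) = eval (fun i => Ψ (mk (X i))) p := by
      intro p
      have : Ψ.comp mk = eval (fun i => Ψ (mk (X i))) := by
        ext c
        · simp only [RingHom.comp_apply]
          have : mk (C c) = g (C c) := (g.commutes c).symm
          rw [this, hΨ, eval_C, eval_C]
        · simp
      exact RingHom.congr_fun this p
    refine ⟨_, ?_, h1, ?_⟩
    · intro p hp
      rw [aeval_eq_eval]
      change eval _ p = 0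
      rw [← h1]
      have : mk p = 0 := Ideal.Quotient.eq_zero_iff_mem.mpr hp
      rw [this, map_zero]
    · ext j
      simp only [base]
      rw [← h1, ht, hΨ, eval_X]
  -- monic equations for the coordinates
  choose m hm hmx using fun i : σ => Algebra.IsIntegral.isIntegral (R := MvPolynomial (Fin s) ℂ)
    (mk (X i))
  have hroot : ∀ x ∈ zeroLocus ℂ I, ∀ i, ((m i).map (eval (base x))).eval (x i) = 0 := by
    intro x hx i
    obtain ⟨Ψ, h1, h2⟩ := hpt x hx
    have h3 : x i = Ψ (mk (X i)) := by rw [h1, eval_X]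
    have h4 : eval (base x) = Ψ.comp (algebraMap (MvPolynomial (Fin s) ℂ) B) := by
      ext a
      · exact (h2 _).symm
      · exact (h2 _).symm
    rw [Polynomial.eval_map, h3, h4, ← Polynomial.hom_eval₂, hmx, map_zero]
  -- a function that vanishes on the fibre of `z` exactly away from `z`
  let Θ : MvPolynomial σ ℂ := ∏ i, ∏ r ∈ ((m i).map (eval (base z))).roots.toFinset.erase (z i),
    (X i - C r)
  have hΘz : eval z Θ ≠ 0 := by
    simp only [Θ, map_prod, map_sub, eval_X, eval_C]
    rw [Finset.prod_ne_zero_iff]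
    intro i _
    rw [Finset.prod_ne_zero_iff]
    intro r hr
    exact sub_ne_zero.mpr (Finset.ne_of_mem_erase hr).symm
  have hΘx : ∀ x ∈ zeroLocus ℂ I, base x = base z → eval x Θ = eval z Θ → x = z := by
    intro x hx hxz hΘ
    by_contra hne
    obtain ⟨i, hi⟩ := Function.ne_iff.mp hne
    refine hΘz ?_
    rw [← hΘ]
    simp only [Θ, map_prod, map_sub, eval_X, eval_C]
    refine Finset.prod_eq_zero (Finset.mem_univ i) (Finset.prod_eq_zero (i := x i) ?_ (sub_self _))
    rw [Finset.mem_erase, Multiset.mem_toFinset, Polynomial.mem_roots']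
    refine ⟨hi, ((hm i).map _).ne_zero, ?_⟩
    rw [← hxz]
    exact hroot x hx i
  -- Polynomial rings are integrally closed, so each root of `μ` specialized at `b` is the value of
  -- `Θ` at a point above `b`. For `b` near `base z`, some root is near `eval z Θ`.
  let μ := minpoly (MvPolynomial (Fin s) ℂ) (mk Θ)
  have hμ : μ.Monic := minpoly.monic (Algebra.IsIntegral.isIntegral _)
  have hμd : 0 < μ.natDegree := minpoly.natDegree_pos (Algebra.IsIntegral.isIntegral _)
  have hμz : (μ.map (eval (base z))).eval (eval z Θ) = 0 := by
    obtain ⟨Ψ, h1, h2⟩ := hpt z hz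
    have h4 : eval (base z) = Ψ.comp (algebraMap (MvPolynomial (Fin s) ℂ) B) := by
      ext a
      · exact (h2 _).symm
      · exact (h2 _).symm
    have h5 := minpoly.aeval (MvPolynomial (Fin s) ℂ) (mk Θ)
    rw [Polynomial.aeval_def] at h5
    rw [Polynomial.eval_map, ← h1, h4, ← Polynomial.hom_eval₂, h5, map_zero]
  -- a hypersurface in the base away from which `f` does not vanish
  obtain ⟨h, hh0, hh⟩ : ∃ h : MvPolynomial (Fin s) ℂ, h ≠ 0 ∧ g h ∈ Ideal.span {mk f} := by
    have hne : mk f ≠ 0 := fun h0 => hf (Ideal.Quotient.eq_zero_iff_mem.mp h0)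
    have := Ideal.comap_ne_bot_of_integral_mem (R := MvPolynomial (Fin s) ℂ) hne
      (Ideal.mem_span_singleton_self (mk f)) (Algebra.IsIntegral.isIntegral _)
    obtain ⟨h, hmem, hne⟩ := Submodule.exists_mem_ne_zero_of_ne_bot this
    exact ⟨h, hne, hmem⟩
  have hfx : ∀ x ∈ zeroLocus ℂ I, eval (base x) h ≠ 0 → eval x f ≠ 0 := by
    intro x hx hne h0
    obtain ⟨Ψ, h1, h2⟩ := hpt x hx
    obtain ⟨c, hc⟩ := Ideal.mem_span_singleton'.mp hh
    rw [← h2, ← hc, map_mul, h1, h0, mul_zero] at hne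
    exact hne rfl
  -- points above the base
  have hex : ∀ b : Fin s → ℂ, ∃ x ∈ zeroLocus ℂ I, base x = b ∧
      ‖eval z Θ - eval x Θ‖ ^ μ.natDegree ≤ ‖(μ.map (eval b)).eval (eval z Θ)‖ := by
    intro b
    have hd : (μ.map (eval b)).natDegree = μ.natDegree := hμ.natDegree_map _
    obtain ⟨r, hr, hle⟩ := (μ.map (eval b)).exists_root_norm_sub_pow_le (hμ.map _) (hd ▸ hμd)
      (eval z Θ)
    obtain ⟨Ψ, hΨ, hΨr⟩ := exists_ringHom_of_root_minpoly (eval b)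
      (fun c => ⟨C c, eval_C c⟩) (mk Θ) r (by rwa [← Polynomial.eval_map])
    obtain ⟨x, hx, h1, h2⟩ := hhom b Ψ fun a => RingHom.congr_fun hΨ a
    refine ⟨x, hx, h2, ?_⟩
    rw [← h1, hΨr, ← hd]
    exact hle
  choose w hwI hwb hwr using hex
  -- Approach `base z` in the base off the hypersurface `h = 0`. A limit of points above, with `Θ`
  -- close to its value at `z`, lies over `base z` and must be `z`.
  obtain ⟨b, hbh, hb⟩ := mem_closure_iff_seq_limit.mp (dense_setOf_eval_ne_zero hh0 (base z))
  -- the points stay bounded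
  have hcoef : ∀ p : MvPolynomial (Fin s) ℂ, Tendsto (fun n => eval (b n) p) atTop
      (𝓝 (eval (base z) p)) := fun p => ((continuous_eval p).tendsto _).comp hb
  have hbdd : ∀ i, ∃ M : ℝ, ∀ n, ‖w (b n) i‖ ≤ M := by
    intro i
    have h1 : Tendsto (fun n => ∑ j ∈ Finset.range (m i).natDegree, ‖eval (b n) ((m i).coeff j)‖ + 1)
        atTop (𝓝 (∑ j ∈ Finset.range (m i).natDegree, ‖eval (base z) ((m i).coeff j)‖ + 1)) :=
      (tendsto_finsetSum _ fun j _ => (hcoef _).norm).add tendsto_const_nhds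
    obtain ⟨M, hM⟩ := h1.bddAbove_range
    refine ⟨M, fun n => le_trans ?_ (hM ⟨n, rfl⟩)⟩
    have h2 := hroot _ (hwI (b n)) i
    rw [hwb] at h2
    have h3 := Polynomial.norm_root_le_of_monic ((hm i).map (eval (b n))) h2
    rw [(hm i).natDegree_map] at h3
    simpa [Polynomial.coeff_map] using h3
  choose M hM using hbdd
  have hcomp : IsCompact (Set.pi Set.univ fun i => Metric.closedBall (0 : ℂ) (M i)) :=
    isCompact_univ_pi fun i => isCompact_closedBall _ _
  obtain ⟨x, -, φ, hφ, hx⟩ := hcomp.tendsto_subseq (x := fun n => w (b n))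
    fun n i _ => by simpa using hM i n
  have hxI : x ∈ zeroLocus ℂ I := (isClosed_zeroLocus I).mem_of_tendsto hx
    (Eventually.of_forall fun n => hwI _)
  have hxb : base x = base z := by
    refine tendsto_nhds_unique ((hbase.tendsto x).comp hx) ?_
    have : base ∘ (fun n => w (b n)) ∘ φ = b ∘ φ := by
      ext1 n
      exact hwb _
    rw [this]
    exact hb.comp hφ.tendsto_atTop
  have hxΘ : eval x Θ = eval z Θ := by
    have h1 : Tendsto (fun n => ‖(μ.map (eval (b n))).eval (eval z Θ)‖) atTop (𝓝 0) := by
      have : ∀ c, (μ.map (eval c)).eval (eval z Θ) =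
          ∑ j ∈ Finset.range (μ.natDegree + 1), eval c (μ.coeff j) * eval z Θ ^ j := by
        intro c
        rw [Polynomial.eval_eq_sum_range, hμ.natDegree_map]
        simp [Polynomial.coeff_map]
      rw [← norm_zero (E := ℂ), ← hμz]
      simp only [this]
      exact (tendsto_finsetSum _ fun j _ => (hcoef _).mul tendsto_const_nhds).norm
    have h2 : Tendsto (fun n => ‖eval z Θ - eval (w (b (φ n))) Θ‖ ^ μ.natDegree) atTop
        (𝓝 (‖eval z Θ - eval x Θ‖ ^ μ.natDegree)) :=
      ((tendsto_const_nhds.sub (((continuous_eval Θ).tendsto x).comp hx)).norm).pow _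
    have h3 := le_of_tendsto_of_tendsto' h2 (h1.comp hφ.tendsto_atTop) fun n => hwr (b (φ n))
    have h4 : ‖eval z Θ - eval x Θ‖ ^ μ.natDegree = 0 := le_antisymm h3 (by positivity)
    exact (sub_eq_zero.mp (norm_eq_zero.mp (pow_eq_zero_iff hμd.ne' |>.mp h4))).symm
  rw [← hΘx x hxI hxb hxΘ]
  exact mem_closure_of_tendsto hx (Eventually.of_forall fun n =>
    ⟨hwI _, hfx _ (hwI _) (by change eval (base (w (b (φ n)))) h ≠ 0; rw [hwb]; exact hbh _)⟩)

end MvPolynomial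

/-! ### Specialization of rational functions and the generic configuration -/

section

namespace MvPolynomial

variable {σ : Type*}

/-- The rational function `k` is defined at `t` and takes there the value `z`. -/
def SpecializesTo (t : σ → ℂ) (k : FractionRing (MvPolynomial σ ℂ)) (z : ℂ) : Prop :=
  ∃ p q : MvPolynomial σ ℂ, eval t q ≠ 0 ∧ k * algebraMap _ _ q = algebraMap _ _ p ∧
    z * eval t q = eval t p

namespace SpecializesTo

variable {t : σ → ℂ} {k k' : FractionRing (MvPolynomial σ ℂ)} {z z' : ℂ}

theorem algebraMap (t : σ → ℂ) (p : MvPolynomial σ ℂ) :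
    SpecializesTo t (algebraMap _ _ p) (eval t p) :=
  ⟨p, 1, by simp, by simp, by simp⟩

theorem add (h : SpecializesTo t k z) (h' : SpecializesTo t k' z') :
    SpecializesTo t (k + k') (z + z') := by
  obtain ⟨p, q, hq, hk, hz⟩ := h
  obtain ⟨p', q', hq', hk', hz'⟩ := h'
  refine ⟨p * q' + p' * q, q * q', by simp [hq, hq'], ?_, ?_⟩
  · simp only [map_add, map_mul, ← hk, ← hk']
    ring
  · simp only [map_add, map_mul, ← hz, ← hz']
    ring

theorem mul (h : SpecializesTo t k z) (h' : SpecializesTo t k' z') :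
    SpecializesTo t (k * k') (z * z') := by
  obtain ⟨p, q, hq, hk, hz⟩ := h
  obtain ⟨p', q', hq', hk', hz'⟩ := h'
  refine ⟨p * p', q * q', by simp [hq, hq'], ?_, ?_⟩
  · simp only [map_mul, ← hk, ← hk']
    ring
  · simp only [map_mul, ← hz, ← hz']
    ring

theorem neg (h : SpecializesTo t k z) : SpecializesTo t (-k) (-z) := by
  obtain ⟨p, q, hq, hk, hz⟩ := h
  exact ⟨-p, q, hq, by simp [← hk], by simp [← hz]⟩

theorem sub (h : SpecializesTo t k z) (h' : SpecializesTo t k' z') :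
    SpecializesTo t (k - k') (z - z') := by
  simpa [sub_eq_add_neg] using h.add h'.neg

/-- The fraction field contains the polynomial ring, so the numerator is zero. With the rules for
sums and products this transfers algebraic relations between rational functions to their values. -/
theorem eq_zero (h : SpecializesTo t 0 z) : z = 0 := by
  obtain ⟨p, q, hq, hk, hz⟩ := h
  rw [zero_mul, eq_comm, FaithfulSMul.algebraMap_eq_zero_iff] at hk
  simpa [hk, hq] using hz

theorem ne_zero (h : SpecializesTo t k z) (hz : z ≠ 0) : k ≠ 0 := by
  rintro rfl
  exact hz h.eq_zero

theorem inv (h : SpecializesTo t k z) (hz : z ≠ 0) : SpecializesTo t k⁻¹ z⁻¹ := by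
  have hk0 := h.ne_zero hz
  obtain ⟨p, q, hq, hk, hz'⟩ := h
  refine ⟨q, p, ?_, ?_, ?_⟩
  · rw [← hz']
    exact mul_ne_zero hz hq
  · rw [← hk, inv_mul_cancel_left₀ hk0]
  · rw [← hz', inv_mul_cancel_left₀ hz]

theorem div (h : SpecializesTo t k z) (h' : SpecializesTo t k' z') (hz : z' ≠ 0) :
    SpecializesTo t (k / k') (z / z') := by
  simpa [div_eq_mul_inv] using h.mul (h'.inv hz)

theorem aeval {ι : Type*} {r : ι → FractionRing (MvPolynomial σ ℂ)} {x : ι → ℂ}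
    (h : ∀ i, SpecializesTo t (r i) (x i)) (F : MvPolynomial ι ℂ) :
    SpecializesTo t (aeval r F) (eval x F) := by
  induction F using MvPolynomial.induction_on with
  | C a =>
    have := algebraMap t (C a : MvPolynomial σ ℂ)
    rw [eval_C] at this ⊢
    rwa [aeval_C, IsScalarTower.algebraMap_apply ℂ (MvPolynomial σ ℂ), algebraMap_eq]
  | add p q hp hq => simpa using hp.add hq
  | mul_X p i hp => simpa using hp.mul (h i)

/-- Finitely many rational functions have a common point of definition. -/
theorem exists_forall {ι : Type*} [Finite ι] (r : ι → FractionRing (MvPolynomial σ ℂ)) :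
    ∃ t : σ → ℂ, ∀ i, ∃ z, SpecializesTo t (r i) z := by
  obtain ⟨⟨b, hb⟩, hr⟩ :=
    IsLocalization.exist_integer_multiples_of_finite (nonZeroDivisors (MvPolynomial σ ℂ)) r
  have hb0 := nonZeroDivisors.ne_zero hb
  obtain ⟨t, ht⟩ : ∃ t, eval t b ≠ 0 := by
    by_contra! h
    exact hb0 (funext fun t => by simp [h t])
  refine ⟨t, fun i => ?_⟩
  obtain ⟨p, hp⟩ := hr i
  refine ⟨eval t p / eval t b, p, b, ht, ?_, div_mul_cancel₀ _ ht⟩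
  rw [hp, mul_comm]
  simp [Algebra.smul_def]

end SpecializesTo

end MvPolynomial

open MvPolynomial

/-- Coordinates `x (e, 0)`, `x (e, 1)` of points and lines, the latter being given by slope and
negative intercept, such that `R` implies incidence, the points of a line have distinct abscissas,
the lines through a point have distinct slopes, and `c` is a parallelogram. -/
structure IsIncidenceConfiguration {N : Type*} (R : N → N → Prop) (c : Fin 4 → N)
    (x : N × Fin 2 → ℂ) : Prop where
  incident : ∀ e f, R e f → x (e, 1) + x (f, 1) = x (e, 0) * x (f, 0)
  separated : ∀ e f g, R e f → R e g → f ≠ g → x (f, 0) ≠ x (g, 0)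
  parallelogram : ∀ j, x (c 0, j) + x (c 2, j) = x (c 1, j) + x (c 3, j)

/-- If the points and lines can be added to the four corners one after the other so that each is
incident to at most two previous ones, there is a generic configuration: its coordinates are
rational functions in some of the coordinates, which specialize to every configuration. -/
theorem exists_generic_incidenceConfiguration {N : Type*} [DecidableEq N]
    {R : N → N → Prop} [DecidableRel R] (hsymm : ∀ e f, R e f → R f e) (hirr : ∀ e, ¬ R e e)
    {c : Fin 4 → N} (hc : Function.Injective c) (hcc : ∀ i j, ¬ R (c i) (c j))
    (hdeg : ∀ S : Finset N, S.Nonempty → (∀ i, c i ∉ S) →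
      ∃ e ∈ S, ((S ∪ Finset.univ.image c).filter (R e)).card ≤ 2)
    (hQ : ∃ x, IsIncidenceConfiguration R c x) (S : Finset N) (hS : ∀ i, c i ∉ S) :
    ∃ (τ : Set (N × Fin 2)) (r : N × Fin 2 → FractionRing (MvPolynomial (N × Fin 2) ℂ)),
      (∀ e ∈ S ∪ Finset.univ.image c, ∀ f ∈ S ∪ Finset.univ.image c, R e f →
        r (e, 1) + r (f, 1) = r (e, 0) * r (f, 0)) ∧
      (∀ j, r (c 0, j) + r (c 2, j) = r (c 1, j) + r (c 3, j)) ∧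
      (∀ e ∈ S ∪ Finset.univ.image c, ∀ j, r (e, j) ∈ IntermediateField.adjoin ℂ
        ((fun i => algebraMap (MvPolynomial (N × Fin 2) ℂ)
          (FractionRing (MvPolynomial (N × Fin 2) ℂ)) (X i)) '' τ)) ∧
      (∀ i ∈ τ, i.1 ∈ S ∪ Finset.univ.image c ∧
        r i = algebraMap (MvPolynomial (N × Fin 2) ℂ) _ (X i)) ∧
      (∀ x, IsIncidenceConfiguration R c x → ∀ e ∈ S ∪ Finset.univ.image c, ∀ j,
        SpecializesTo x (r (e, j)) (x (e, j))) := by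
  let K := FractionRing (MvPolynomial (N × Fin 2) ℂ)
  let Y : N × Fin 2 → K := fun i => algebraMap (MvPolynomial (N × Fin 2) ℂ) K (X i)
  have hY : ∀ (x : N × Fin 2 → ℂ) i, SpecializesTo x (Y i) (x i) := fun x i => by
    simpa using SpecializesTo.algebraMap x (X i)
  induction' hn : S.card with n ih generalizing S
  · rw [Finset.card_eq_zero] at hn
    subst hn
    -- Three corners are free; the parallelogram condition determines the fourth.
    let r : N × Fin 2 → K := fun i =>
      if i.1 = c 3 then Y (c 0, i.2) + Y (c 2, i.2) - Y (c 1, i.2) else Y i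
    let τ : Set (N × Fin 2) := {i | i.1 ∈ Finset.univ.image c ∧ i.1 ≠ c 3}
    have hτ : ∀ i, i ≠ 3 → ∀ j, Y (c i, j) ∈ IntermediateField.adjoin ℂ (Y '' τ) := by
      intro i hi j
      exact IntermediateField.subset_adjoin _ _ (Set.mem_image_of_mem Y ⟨by simp, hc.ne hi⟩)
    refine ⟨τ, r, ?_, ?_, ?_, ?_, ?_⟩
    · intro e he f hf h
      simp only [Finset.empty_union, Finset.mem_image, Finset.mem_univ, true_and] at he hf
      obtain ⟨i, rfl⟩ := he
      obtain ⟨j, rfl⟩ := hf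
      exact absurd h (hcc i j)
    · intro j
      have h0 : c 0 ≠ c 3 := hc.ne (by decide)
      have h1 : c 1 ≠ c 3 := hc.ne (by decide)
      have h2 : c 2 ≠ c 3 := hc.ne (by decide)
      simp [r, h0, h1, h2]
    · intro e he j
      simp only [Finset.empty_union, Finset.mem_image, Finset.mem_univ, true_and] at he
      obtain ⟨i, rfl⟩ := he
      by_cases hi : i = 3
      · subst hi
        simp only [r, if_true]
        exact sub_mem (add_mem (hτ 0 (by decide) j) (hτ 2 (by decide) j)) (hτ 1 (by decide) j)
      · simp only [r, hc.eq_iff, hi, if_false]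
        exact hτ i hi j
    · rintro i ⟨hi, hi3⟩
      exact ⟨by simpa using hi, if_neg hi3⟩
    · intro x hx e he j
      simp only [r]
      split_ifs with h
      · change e = c 3 at h
        subst h
        rw [show x (c 3, j) = x (c 0, j) + x (c 2, j) - x (c 1, j) by
          rw [hx.parallelogram]; ring]
        exact ((hY x _).add (hY x _)).sub (hY x _)
      · exact hY x _
  · obtain ⟨e, heS, hcard⟩ := hdeg S (Finset.card_pos.mp (by omega)) hS
    obtain ⟨τ, r, h1, h2, h3, h4, h5⟩ := ih (S.erase e)
      (fun i hi => hS i (Finset.mem_of_mem_erase hi)) (by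
        rw [Finset.card_erase_of_mem heS, hn]; rfl)
    have hec : e ∉ Finset.univ.image c := by
      intro h
      obtain ⟨i, -, rfl⟩ := Finset.mem_image.mp h
      exact hS i heS
    set U := S.erase e ∪ Finset.univ.image c with hU
    have heU : e ∉ U := by simp [hU] at hec ⊢; exact hec
    have hSU : S ∪ Finset.univ.image c = insert e U := by
      rw [hU, ← Finset.insert_union, Finset.insert_erase heS]
    rw [hSU] at hcard ⊢
    rw [Finset.filter_insert, if_neg (hirr e)] at hcard
    have hcU : ∀ i, c i ∈ U := fun i => by simp [hU]
    -- it suffices to give the coordinates of the new node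
    suffices H : ∃ (τ' : Set (Fin 2)) (a : Fin 2 → K),
        (∀ f ∈ U, R e f → a 1 + r (f, 1) = a 0 * r (f, 0)) ∧
        (∀ j, a j ∈ IntermediateField.adjoin ℂ (Y '' (τ ∪ (fun j => (e, j)) '' τ'))) ∧
        (∀ j ∈ τ', a j = Y (e, j)) ∧
        (∀ x, IsIncidenceConfiguration R c x → ∀ j, SpecializesTo x (a j) (x (e, j))) by
      obtain ⟨τ', a, ha1, ha2, ha3, ha4⟩ := H
      let r' : N × Fin 2 → K := fun i => if i.1 = e then a i.2 else r i
      have hre : ∀ j, r' (e, j) = a j := fun j => if_pos rfl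
      have hrU : ∀ f ∈ U, ∀ j, r' (f, j) = r (f, j) := fun f hf j =>
        if_neg (fun h : f = e => heU (h ▸ hf))
      refine ⟨τ ∪ (fun j => (e, j)) '' τ', r', ?_, ?_, ?_, ?_, ?_⟩
      · intro f hf g hg hfg
        rcases Finset.mem_insert.mp hf with rfl | hf <;> rcases Finset.mem_insert.mp hg with rfl | hg
        · exact absurd hfg (hirr _)
        · rw [hre, hre, hrU g hg, hrU g hg]
          exact ha1 g hg hfg
        · rw [hre, hre, hrU f hf, hrU f hf, add_comm, mul_comm]
          exact ha1 f hf (hsymm _ _ hfg)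
        · rw [hrU f hf, hrU f hf, hrU g hg, hrU g hg]
          exact h1 f hf g hg hfg
      · intro j
        rw [hrU _ (hcU _), hrU _ (hcU _), hrU _ (hcU _), hrU _ (hcU _)]
        exact h2 j
      · intro f hf j
        rcases Finset.mem_insert.mp hf with rfl | hf
        · rw [hre]
          exact ha2 j
        · rw [hrU f hf]
          exact IntermediateField.adjoin.mono _ _ _
            (Set.image_mono Set.subset_union_left) (h3 f hf j)
      · rintro i (hi | ⟨j, hj, rfl⟩)
        · obtain ⟨hiU, hri⟩ := h4 i hi
          exact ⟨Finset.mem_insert_of_mem hiU, (hrU i.1 hiU i.2).trans hri⟩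
        · exact ⟨Finset.mem_insert_self _ _, (hre j).trans (ha3 j hj)⟩
      · intro x hx f hf j
        rcases Finset.mem_insert.mp hf with rfl | hf
        · rw [hre]
          exact ha4 x hx j
        · rw [hrU f hf]
          exact h5 x hx f hf j
    have hr : ∀ f ∈ U, ∀ j τ', r (f, j) ∈ IntermediateField.adjoin ℂ (Y '' (τ ∪ τ')) :=
      fun f hf j τ' => IntermediateField.adjoin.mono _ _ _
        (Set.image_mono Set.subset_union_left) (h3 f hf j)
    have hYe : ∀ j (τ' : Set (Fin 2)), j ∈ τ' →
        Y (e, j) ∈ IntermediateField.adjoin ℂ (Y '' (τ ∪ (fun j => (e, j)) '' τ')) :=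
      fun j τ' hj => IntermediateField.subset_adjoin _ _
        (Set.mem_image_of_mem Y (Or.inr ⟨j, hj, rfl⟩))
    obtain h | h | h : (U.filter (R e)).card = 0 ∨ (U.filter (R e)).card = 1 ∨
        (U.filter (R e)).card = 2 := by omega
    -- No earlier neighbour: both coordinates are free.
    · rw [Finset.card_eq_zero, Finset.filter_eq_empty_iff] at h
      exact ⟨Set.univ, fun j => Y (e, j), fun f hf hef => absurd hef (h hf),
        fun j => hYe j _ (Set.mem_univ j), fun _ _ => rfl, fun x _ j => hY x _⟩
    -- One earlier neighbour: the first coordinate is free and the incidence gives the second.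
    · obtain ⟨f, hf⟩ := Finset.card_eq_one.mp h
      have hf' : f ∈ U ∧ R e f := Finset.mem_filter.mp (hf ▸ Finset.mem_singleton_self f)
      refine ⟨{0}, ![Y (e, 0), Y (e, 0) * r (f, 0) - r (f, 1)], ?_, ?_, ?_, ?_⟩
      · intro g hg heg
        obtain rfl : g = f := by
          have : g ∈ U.filter (R e) := Finset.mem_filter.mpr ⟨hg, heg⟩
          rwa [hf, Finset.mem_singleton] at this
        simp
      · rw [Fin.forall_fin_two]
        exact ⟨hYe 0 _ rfl, sub_mem (mul_mem (hYe 0 _ rfl) (hr f hf'.1 0 _)) (hr f hf'.1 1 _)⟩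
      · rintro j rfl
        rfl
      · intro x hx
        rw [Fin.forall_fin_two]
        refine ⟨hY x _, ?_⟩
        have := hx.incident e f hf'.2
        rw [show x (e, 1) = x (e, 0) * x (f, 0) - x (f, 1) by rw [← this]; ring]
        exact ((hY x _).mul (h5 x hx f hf'.1 0)).sub (h5 x hx f hf'.1 1)
    · obtain ⟨f, g, hfg, hf⟩ := Finset.card_eq_two.mp h
      have hf' : f ∈ U ∧ R e f := Finset.mem_filter.mp (hf ▸ by simp)
      have hg' : g ∈ U ∧ R e g := Finset.mem_filter.mp (hf ▸ by simp)
      -- Two earlier neighbours: the incidences are two linear equations, with a unique solution,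
      -- since their determinant specializes to a nonzero number at the given configuration.
      have hK : r (f, 0) - r (g, 0) ≠ 0 := by
        obtain ⟨x, hx⟩ := hQ
        exact ((h5 x hx f hf'.1 0).sub (h5 x hx g hg'.1 0)).ne_zero
          (sub_ne_zero.mpr (hx.separated e f g hf'.2 hg'.2 hfg))
      set a := (r (f, 1) - r (g, 1)) / (r (f, 0) - r (g, 0)) with ha
      refine ⟨∅, ![a, a * r (f, 0) - r (f, 1)], ?_, ?_, ?_, ?_⟩
      · intro k hk hek
        have : k ∈ U.filter (R e) := Finset.mem_filter.mpr ⟨hk, hek⟩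
        rw [hf, Finset.mem_insert, Finset.mem_singleton] at this
        rcases this with rfl | rfl
        · simp
        · simp only [Matrix.cons_val_zero, Matrix.cons_val_one]
          have : a * (r (f, 0) - r (k, 0)) = r (f, 1) - r (k, 1) := div_mul_cancel₀ _ hK
          linear_combination this
      · have ham : a ∈ IntermediateField.adjoin ℂ (Y '' (τ ∪ (fun j => (e, j)) '' ∅)) :=
          div_mem (sub_mem (hr f hf'.1 1 _) (hr g hg'.1 1 _))
            (sub_mem (hr f hf'.1 0 _) (hr g hg'.1 0 _))
        rw [Fin.forall_fin_two]
        exact ⟨ham, sub_mem (mul_mem ham (hr f hf'.1 0 _)) (hr f hf'.1 1 _)⟩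
      · rintro j ⟨⟩
      · intro x hx
        have hs := sub_ne_zero.mpr (hx.separated e f g hf'.2 hg'.2 hfg)
        have e1 := hx.incident e f hf'.2
        have e2 := hx.incident e g hg'.2
        have hax : SpecializesTo x a (x (e, 0)) := by
          rw [show x (e, 0) = (x (f, 1) - x (g, 1)) / (x (f, 0) - x (g, 0)) by
            rw [eq_div_iff hs]; linear_combination e2 - e1]
          exact ((h5 x hx f hf'.1 1).sub (h5 x hx g hg'.1 1)).div
            ((h5 x hx f hf'.1 0).sub (h5 x hx g hg'.1 0)) hs
        rw [Fin.forall_fin_two]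
        refine ⟨hax, ?_⟩
        rw [show x (e, 1) = x (e, 0) * x (f, 0) - x (f, 1) by rw [← e1]; ring]
        exact (hax.mul (h5 x hx f hf'.1 0)).sub (h5 x hx f hf'.1 1)

end

/-! ### Irreducible components and rationality -/

section

open MvPolynomial

section Varieties

variable {σ : Type*} {Z D : Set (σ → ℂ)}

theorem MvPolynomial.isIrreducibleVariety_zeroLocus {I : Ideal (MvPolynomial σ ℂ)} [I.IsPrime]
    (hI : vanishingIdeal ℂ (zeroLocus ℂ I) = I) : IsIrreducibleVariety (zeroLocus ℂ I) := by
  refine ⟨⟨I, rfl⟩, ?_, ?_⟩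
  · by_contra h
    rw [Set.not_nonempty_iff_eq_empty] at h
    rw [h, vanishingIdeal_empty] at hI
    exact Ideal.IsPrime.ne_top' hI.symm
  · rintro _ _ ⟨I₁, rfl⟩ ⟨I₂, rfl⟩ hcov
    by_contra! h
    obtain ⟨h₁, h₂⟩ := h
    obtain ⟨x₁, hx₁, h₁⟩ := Set.not_subset.mp h₁
    obtain ⟨x₂, hx₂, h₂⟩ := Set.not_subset.mp h₂
    simp only [mem_zeroLocus_iff, not_forall] at h₁ h₂
    obtain ⟨p, hp, hpx⟩ := h₁
    obtain ⟨q, hq, hqx⟩ := h₂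
    have hpI : p ∉ I := fun h => hpx (hx₁ p h)
    have hqI : q ∉ I := fun h => hqx (hx₂ q h)
    have hpq : p * q ∉ I := fun h => (Ideal.IsPrime.mem_or_mem ‹_› h).elim hpI hqI
    apply hpq
    rw [← hI]
    intro z hz
    rw [map_mul]
    rcases hcov hz with h | h
    · rw [h p hp, zero_mul]
    · rw [h q hq, mul_zero]

theorem MvPolynomial.vanishingIdeal_zeroLocus_vanishingIdeal (Z : Set (σ → ℂ)) :
    vanishingIdeal ℂ (zeroLocus ℂ (vanishingIdeal ℂ Z)) = vanishingIdeal ℂ Z :=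
  le_antisymm (vanishingIdeal_anti_mono (zeroLocus_vanishingIdeal_le Z))
    (le_vanishingIdeal_zeroLocus _)

theorem IsAffineVariety.zeroLocus_vanishingIdeal_subset (hD : IsAffineVariety D) (hZ : Z ⊆ D) :
    zeroLocus ℂ (vanishingIdeal ℂ Z) ⊆ D := by
  obtain ⟨J, rfl⟩ := hD
  exact zeroLocus_anti_mono fun p hp x hx => hZ hx p hp

/-- A subset of a variety which contains a nonempty open subset and whose vanishing ideal is
prime has an irreducible component as its closure. -/
theorem closure_eq_zeroLocus_vanishingIdeal [Finite σ] (hD : IsAffineVariety D) (hZ : Z ⊆ D)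
    [(vanishingIdeal ℂ Z).IsPrime] {f : MvPolynomial σ ℂ} (hf : f ∉ vanishingIdeal ℂ Z)
    (hfZ : ∀ x ∈ D, eval x f ≠ 0 → x ∈ Z) :
    closure Z = zeroLocus ℂ (vanishingIdeal ℂ Z) := by
  apply subset_antisymm
  · exact closure_minimal (zeroLocus_vanishingIdeal_le Z) (isClosed_zeroLocus _)
  -- The points of the Zariski closure where `f ≠ 0` already belong to `Z`, and they are dense in it
  -- for the usual topology.
  · exact (zeroLocus_subset_closure _ hf).trans (closure_mono fun x hx =>
      hfZ x (hD.zeroLocus_vanishingIdeal_subset hZ hx.1) hx.2)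

/-- An irreducible `Y` in `D` that contains the Zariski closure of `Z` is covered by this closure
and the hypersurface `f = 0`. The hypersurface does not contain `Z`, so `Y` lies in the closure. -/
theorem isIrreducibleComponent_zeroLocus_vanishingIdeal (hD : IsAffineVariety D) (hZ : Z ⊆ D)
    [(vanishingIdeal ℂ Z).IsPrime] {f : MvPolynomial σ ℂ} (hf : f ∉ vanishingIdeal ℂ Z)
    (hfZ : ∀ x ∈ D, eval x f ≠ 0 → x ∈ Z) :
    IsIrreducibleComponent (zeroLocus ℂ (vanishingIdeal ℂ Z)) D := by
  refine ⟨⟨isIrreducibleVariety_zeroLocus (vanishingIdeal_zeroLocus_vanishingIdeal Z),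
    hD.zeroLocus_vanishingIdeal_subset hZ⟩, ?_⟩
  rintro Y ⟨hY, hYD⟩ hZY
  have hcov : Y ⊆ zeroLocus ℂ (vanishingIdeal ℂ Z) ∪ zeroLocus ℂ (Ideal.span {f}) := by
    intro y hy
    by_cases h : eval y f = 0
    · refine Or.inr ?_
      rw [zeroLocus_span]
      simpa [aeval_eq_eval] using h
    · exact Or.inl (zeroLocus_vanishingIdeal_le Z (hfZ y (hYD hy) h))
  refine (hY.2.2 _ _ ⟨_, rfl⟩ ⟨_, rfl⟩ hcov).resolve_right fun h => hf ?_
  intro z hz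
  exact h (hZY (zeroLocus_vanishingIdeal_le Z hz)) f (Ideal.subset_span rfl)

open scoped IntermediateField.algebraAdjoinAdjoin in
/-- The fraction field of the algebra generated by some elements of a field is the field of
rational functions in `d` variables, if these elements generate the same field as `d` algebraically
independent ones. -/
theorem MvPolynomial.nonempty_fractionRing_quotient_ker_algEquiv {K : Type*} [Field K]
    [Algebra ℂ K] (r : σ → K) {I : Ideal (MvPolynomial σ ℂ)}
    (hI : I = RingHom.ker (aeval (R := ℂ) r)) {d : ℕ} {y : Fin d → K}
    (hy : AlgebraicIndependent ℂ y)
    (hry : IntermediateField.adjoin ℂ (Set.range r) = IntermediateField.adjoin ℂ (Set.range y)) :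
    Nonempty (FractionRing (MvPolynomial σ ℂ ⧸ I) ≃ₐ[ℂ]
      FractionRing (MvPolynomial (Fin d) ℂ)) := by
  subst hI
  let e : (MvPolynomial σ ℂ ⧸ RingHom.ker (aeval (R := ℂ) r)) ≃ₐ[ℂ]
      Algebra.adjoin ℂ (Set.range r) :=
    (Ideal.quotientKerEquivRange (aeval (R := ℂ) r)).trans
      (Subalgebra.equivOfEq _ _ (Algebra.adjoin_range_eq_range_aeval ℂ r).symm)
  exact ⟨((IsFractionRing.algEquivOfAlgEquiv
    (L := IntermediateField.adjoin ℂ (Set.range r)) e).trans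
      (IntermediateField.equivOfEq hry)).trans hy.aevalEquivField.symm⟩

end Varieties

/-! ### Collinearity in the complex plane -/

section Plane

/-- This makes collinearity a system of polynomial equations, so that drawings form a variety and
genericity becomes an open condition. -/
theorem collinear_iff_forall_det_eq_zero {s : Set (Fin 2 → ℂ)} :
    Collinear ℂ s ↔ ∀ p ∈ s, ∀ q ∈ s, ∀ r ∈ s,
      (q 0 - p 0) * (r 1 - p 1) - (r 0 - p 0) * (q 1 - p 1) = 0 := by
  constructor
  · rw [collinear_iff_exists_forall_eq_smul_vadd]
    rintro ⟨o, v, h⟩ p hp q hq r hr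
    obtain ⟨a, rfl⟩ := h p hp
    obtain ⟨b, rfl⟩ := h q hq
    obtain ⟨c, rfl⟩ := h r hr
    simp only [vadd_eq_add, Pi.add_apply, Pi.smul_apply, smul_eq_mul]
    ring
  · intro h
    rcases s.subsingleton_or_nontrivial with hs | ⟨p, hp, q, hq, hpq⟩
    · exact hs.induction_on (collinear_empty ℂ _) fun x => collinear_singleton ℂ x
    rw [collinear_iff_of_mem hp]
    refine ⟨q - p, fun r hr => ?_⟩
    have hd := h p hp q hq r hr
    by_cases h0 : q 0 - p 0 = 0
    · have h1 : q 1 - p 1 ≠ 0 := fun h1 => hpq (funext fun j => by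
        fin_cases j
        · exact (sub_eq_zero.mp h0).symm
        · exact (sub_eq_zero.mp h1).symm)
      refine ⟨(r 1 - p 1) / (q 1 - p 1), funext fun j => ?_⟩
      rw [h0, zero_mul, zero_sub, neg_eq_zero, mul_eq_zero, or_iff_left h1] at hd
      fin_cases j
      · simp [h0, sub_eq_zero.mp hd]
      · simp [div_mul_cancel₀ _ h1]
    · refine ⟨(r 0 - p 0) / (q 0 - p 0), funext fun j => ?_⟩
      fin_cases j
      · simp [div_mul_cancel₀ _ h0]
      · simp only [Fin.mk_one, Fin.isValue, vadd_eq_add, Pi.add_apply, Pi.smul_apply,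
          Pi.sub_apply, smul_eq_mul]
        field_simp
        linear_combination hd

theorem collinear_of_forall_mul_sub_eq {s : Set (Fin 2 → ℂ)} {m b : ℂ}
    (h : ∀ p ∈ s, p 1 + b = p 0 * m) : Collinear ℂ s := by
  rw [collinear_iff_forall_det_eq_zero]
  intro p hp q hq r hr
  linear_combination (q 0 - p 0) * (h r hr - h p hp) - (r 0 - p 0) * (h q hq - h p hp)

theorem Collinear.exists_forall_add_eq_mul {s : Set (Fin 2 → ℂ)} (h : Collinear ℂ s)
    {p q : Fin 2 → ℂ} (hp : p ∈ s) (hq : q ∈ s) (hpq : p 0 ≠ q 0) :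
    ∃ m b : ℂ, ∀ r ∈ s, r 1 + b = r 0 * m := by
  have h0 : q 0 - p 0 ≠ 0 := sub_ne_zero.mpr hpq.symm
  refine ⟨(q 1 - p 1) / (q 0 - p 0), p 0 * ((q 1 - p 1) / (q 0 - p 0)) - p 1, fun r hr => ?_⟩
  have := collinear_iff_forall_det_eq_zero.mp h p hp q hq r hr
  field_simp
  linear_combination this

theorem Collinear.affineSpan_eq_affineSpan {s t : Set (Fin 2 → ℂ)} (h : Collinear ℂ (s ∪ t))
    (hs : s.Nontrivial) (ht : t.Nontrivial) : affineSpan ℂ s = affineSpan ℂ t := by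
  have key : ∀ u ⊆ s ∪ t, u.Nontrivial → affineSpan ℂ u = affineSpan ℂ (s ∪ t) := by
    rintro u hu ⟨p, hp, q, hq, hpq⟩
    rw [← (h.subset hu).affineSpan_eq_of_ne hp hq hpq, h.affineSpan_eq_of_ne (hu hp) (hu hq) hpq]
  rw [key s Set.subset_union_left hs, key t Set.subset_union_right ht]

theorem Collinear.union_of_affineSpan_eq {s t : Set (Fin 2 → ℂ)} (hs : Collinear ℂ s)
    (h : affineSpan ℂ s = affineSpan ℂ t) : Collinear ℂ (s ∪ t) := by
  have hu : s ∪ t ⊆ affineSpan ℂ s :=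
    Set.union_subset (subset_affineSpan ℂ s) (h ▸ subset_affineSpan ℂ t)
  refine Collinear.subset hu ?_
  rw [Collinear, ← direction_affineSpan, AffineSubspace.affineSpan_coe, direction_affineSpan]
  exact hs

end Plane

end

/-! ### Drawings as configurations of points and lines -/

section

open MvPolynomial

namespace ConstrainedTriangulation

section Determinant

variable {V : Type*}

/-- Twice the area of the triangle with vertices `a`, `b`, `c`. -/
noncomputable def det (a b c : V) : MvPolynomial (V × Fin 2) ℂ :=
  (X (b, 0) - X (a, 0)) * (X (c, 1) - X (a, 1)) - (X (c, 0) - X (a, 0)) * (X (b, 1) - X (a, 1))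

theorem collinear_image_ofCoords_iff {x : V × Fin 2 → ℂ} {s : Set V} :
    Collinear ℂ (ofCoords x '' s) ↔ ∀ a ∈ s, ∀ b ∈ s, ∀ c ∈ s, eval x (det a b c) = 0 := by
  simp [collinear_iff_forall_det_eq_zero, det, ofCoords]

end Determinant

variable {V : Type*} [Fintype V] [DecidableEq V] (T : ConstrainedTriangulation V)

theorem constraint_nontrivial {C : Finset V} (hC : C ∈ T.constraints) : C.Nontrivial := by
  obtain ⟨S, hS, -⟩ := T.contiguous
  obtain ⟨hconn, hmem⟩ := hS C hC
  obtain ⟨t, ht⟩ := hconn.nonempty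
  have hsub : t.1 ⊆ C := fun v hv => (hmem v).mpr ⟨t, ht, hv⟩
  rw [← Finset.one_lt_card_iff_nontrivial]
  have := Finset.card_le_card hsub
  have := t.2.2
  omega

/-- The set of generic drawings. -/
def genericDrawings : Set (V × Fin 2 → ℂ) := {x | T.IsGenericDrawing (ofCoords x)}

theorem genericDrawings_subset : T.genericDrawings ⊆ T.drawingSpace := fun _ hx => hx.1

theorem isAffineVariety_drawingSpace : IsAffineVariety T.drawingSpace := by
  refine ⟨Ideal.span ({p | ∃ C ∈ T.constraints, ∃ a ∈ C, ∃ b ∈ C, ∃ c ∈ C, p = det a b c} ∪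
    Set.range fun j => X (T.corner 0, j) + X (T.corner 2, j) -
      (X (T.corner 1, j) + X (T.corner 3, j))), ?_⟩
  rw [zeroLocus_span]
  ext x
  simp only [drawingSpace, IsDrawing, collinear_image_ofCoords_iff]
  constructor
  · rintro ⟨h, h'⟩ _ (⟨C, hC, a, ha, b, hb, c, hc, rfl⟩ | ⟨j, rfl⟩)
    · exact h C hC a ha b hb c hc
    · have := congrFun h' j
      simpa [ofCoords, sub_eq_zero] using this
  · intro h
    refine ⟨fun C hC a ha b hb c hc => h _ (Or.inl ⟨C, hC, a, ha, b, hb, c, hc, rfl⟩),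
      funext fun j => ?_⟩
    have := h _ (Or.inr ⟨j, rfl⟩)
    simpa [ofCoords, sub_eq_zero] using this

/-- The generic drawings are an open subset of the space of drawings. -/
theorem exists_polynomial_of_mem_genericDrawings {x₀ : V × Fin 2 → ℂ}
    (h₀ : x₀ ∈ T.genericDrawings) : ∃ f : MvPolynomial (V × Fin 2) ℂ, eval x₀ f ≠ 0 ∧
      ∀ x ∈ T.drawingSpace, eval x f ≠ 0 → x ∈ T.genericDrawings := by
  classical
  let P : Finset (MvPolynomial (V × Fin 2) ℂ) :=
    (Finset.univ.image fun i : V × V × V => det i.1 i.2.1 i.2.2) ∪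
      Finset.univ.image fun i : V × V × Fin 2 => X (i.1, i.2.2) - X (i.2.1, i.2.2)
  have hdetP : ∀ a b c, det a b c ∈ P := fun a b c =>
    Finset.mem_union_left _ (Finset.mem_image.mpr ⟨(a, b, c), Finset.mem_univ _, rfl⟩)
  have hXP : ∀ a b j, X (a, j) - X (b, j) ∈ P := fun a b j =>
    Finset.mem_union_right _ (Finset.mem_image.mpr ⟨(a, b, j), Finset.mem_univ _, rfl⟩)
  -- Multiply those determinants and coordinate differences that do not vanish at `x₀`. Where the
  -- product is nonzero, each of these polynomials that vanishes at `x` also vanishes at `x₀`, so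
  -- `x` is no more degenerate than `x₀`.
  refine ⟨∏ p ∈ P, if eval x₀ p = 0 then 1 else p, ?_, ?_⟩
  · rw [map_prod, Finset.prod_ne_zero_iff]
    intro p _
    split_ifs with h
    · simp
    · exact h
  · intro x hx hf
    rw [map_prod, Finset.prod_ne_zero_iff] at hf
    have key : ∀ p ∈ P, eval x p = 0 → eval x₀ p = 0 := by
      intro p hp h
      by_contra h'
      have := hf p hp
      rw [if_neg h'] at this
      exact this h
    have hcol : ∀ s : Set V, Collinear ℂ (ofCoords x '' s) → Collinear ℂ (ofCoords x₀ '' s) := by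
      intro s hs
      rw [collinear_image_ofCoords_iff] at hs ⊢
      exact fun a ha b hb c hc => key _ (hdetP a b c) (hs a ha b hb c hc)
    have hinj : Function.Injective (ofCoords x) := by
      intro a b hab
      refine h₀.2.2.2.1 (funext fun j => ?_)
      have hj : x (a, j) = x (b, j) := congrFun hab j
      have h₀ := key _ (hXP a b j) (by simp [hj])
      rw [map_sub, eval_X, eval_X, sub_eq_zero] at h₀
      exact h₀
    refine ⟨hx, fun i h => h₀.2.1 i ?_, fun t ht h => h₀.2.2.1 t ht (hcol _ h), hinj, ?_⟩
    · simpa [Set.image_insert_eq] using hcol {T.corner i, T.corner (i + 1), T.corner (i + 2)}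
        (by simpa [Set.image_insert_eq] using h)
    · intro C hC C' hC' hne hint h
      refine h₀.2.2.2.2 C hC C' hC' hne hint ?_
      refine Collinear.affineSpan_eq_affineSpan ?_
        ((T.constraint_nontrivial hC).image h₀.2.2.2.1)
        ((T.constraint_nontrivial hC').image h₀.2.2.2.1)
      rw [← Set.image_union]
      apply hcol
      rw [Set.image_union]
      exact (hx.1 C hC).union_of_affineSpan_eq h

variable {T} in
/-- The image of a generic drawing under an affine automorphism is generic. -/
theorem IsGenericDrawing.comp_linearEquiv {ρ : V → Fin 2 → ℂ} (hρ : T.IsGenericDrawing ρ)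
    (g : (Fin 2 → ℂ) ≃ₗ[ℂ] (Fin 2 → ℂ)) : T.IsGenericDrawing (g ∘ ρ) := by
  let G : (Fin 2 → ℂ) →ᵃ[ℂ] (Fin 2 → ℂ) := (g : (Fin 2 → ℂ) →ₗ[ℂ] (Fin 2 → ℂ)).toAffineMap
  have hG : Function.Injective G := g.injective
  have hmap : ∀ (f : (Fin 2 → ℂ) ≃ₗ[ℂ] (Fin 2 → ℂ)) s, Collinear ℂ s → Collinear ℂ (f '' s) := by
    intro f s
    simp only [collinear_iff_exists_forall_eq_smul_vadd]
    rintro ⟨o, v, h⟩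
    refine ⟨f o, f v, ?_⟩
    rintro _ ⟨p, hp, rfl⟩
    obtain ⟨a, rfl⟩ := h p hp
    exact ⟨a, by simp⟩
  have hcol : ∀ s, Collinear ℂ (g '' s) ↔ Collinear ℂ s := fun s =>
    ⟨fun h => by simpa [← Set.image_comp] using hmap g.symm _ h, hmap g s⟩
  obtain ⟨⟨h1, h2⟩, h3, h4, h5, h6⟩ := hρ
  refine ⟨⟨fun C hC => ?_, ?_⟩, fun i => ?_, fun t ht => ?_, g.injective.comp h5, ?_⟩
  · rw [Set.image_comp, hcol]
    exact h1 C hC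
  · simp only [Function.comp_apply, ← map_add, h2]
  · have := h3 i
    rw [← hcol] at this
    simpa [Set.image_insert_eq] using this
  · rw [Set.image_comp, hcol]
    exact h4 t ht
  · intro C hC C' hC' hne hint
    rw [Set.image_comp, Set.image_comp]
    have hspan : ∀ s, affineSpan ℂ (g '' s) = (affineSpan ℂ s).map G := fun s =>
      (AffineSubspace.map_span G s).symm
    rw [hspan, hspan]
    intro h
    refine h6 C hC C' hC' hne hint (SetLike.coe_injective (hG.image_injective ?_))
    simpa only [AffineSubspace.coe_map] using congrArg SetLike.coe h

/-- The image of a map to the plane under a shear. -/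
def shear (s : ℂ) (x : V × Fin 2 → ℂ) : V × Fin 2 → ℂ :=
  fun i => if i.2 = 0 then x i + s * x (i.1, 1) else x i

theorem shear_mem_genericDrawings {x : V × Fin 2 → ℂ} (hx : x ∈ T.genericDrawings) (s : ℂ) :
    shear s x ∈ T.genericDrawings := by
  let f : ℂ → (Fin 2 → ℂ) →ₗ[ℂ] (Fin 2 → ℂ) := fun s =>
    { toFun := fun p => ![p 0 + s * p 1, p 1]
      map_add' := fun p q => by
        ext j
        fin_cases j
        · simp; ring
        · simp
      map_smul' := fun a p => by
        ext j
        fin_cases j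
        · simp; ring
        · simp }
  have hf : ∀ s, f (-s) ∘ₗ f s = LinearMap.id := by
    intro s
    ext p j
    fin_cases j <;> simp [f]
  let g : (Fin 2 → ℂ) ≃ₗ[ℂ] (Fin 2 → ℂ) :=
    LinearEquiv.ofLinearMap (f s) (f (-s)) (by simpa using hf (-s)) (hf s)
  have h : ofCoords (shear s x) = g ∘ ofCoords x := by
    ext v j
    fin_cases j <;> simp [ofCoords, shear, g, f]
  change T.IsGenericDrawing _
  rw [h]
  exact hx.comp_linearEquiv g

/-- A generic drawing can be sheared slightly so that the vertices have distinct abscissas. -/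
theorem mem_closure_shear {x : V × Fin 2 → ℂ} (hx : x ∈ T.genericDrawings) :
    x ∈ closure {y | y ∈ T.genericDrawings ∧ Function.Injective fun v => y (v, 0)} := by
  -- Two distinct points get the same abscissa for at most one shear parameter.
  have hfin : (⋃ v : V, ⋃ w : V,
      {s : ℂ | v ≠ w ∧ x (v, 0) + s * x (v, 1) = x (w, 0) + s * x (w, 1)}).Finite := by
    refine Set.finite_iUnion fun v => Set.finite_iUnion fun w => Set.Subsingleton.finite ?_
    rintro s ⟨hvw, hs⟩ s' ⟨-, hs'⟩
    by_contra hne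
    have h1 : x (v, 1) = x (w, 1) := by
      have : (s - s') * (x (v, 1) - x (w, 1)) = 0 := by linear_combination hs - hs'
      exact sub_eq_zero.mp ((mul_eq_zero.mp this).resolve_left (sub_ne_zero.mpr hne))
    refine hvw (hx.2.2.2.1 (funext fun j => ?_))
    fin_cases j
    · change x (v, 0) = x (w, 0)
      rw [h1] at hs
      exact add_right_cancel hs
    · exact h1
  have hdense := Dense.sdiff_finite dense_univ hfin
  have hcont : Continuous fun s : ℂ => shear s x := by
    refine continuous_pi fun i => ?_
    simp only [shear]
    split_ifs
    · fun_prop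
    · fun_prop
  have h0 : shear 0 x = x := by
    ext i
    simp [shear]
  have := mem_closure_image hcont.continuousAt (hdense 0)
  rw [h0] at this
  refine closure_mono ?_ this
  rintro _ ⟨s, ⟨-, hs⟩, rfl⟩
  refine ⟨T.shear_mem_genericDrawings hx s, fun v w hvw => ?_⟩
  by_contra hne
  refine hs (Set.mem_iUnion.mpr ⟨v, Set.mem_iUnion.mpr ⟨w, hne, ?_⟩⟩)
  simpa [shear] using hvw

theorem node_adj_irrefl (e : T.Node) : ¬ T.Adj e e := by
  rcases e with v | C <;> exact id

/-- A generic drawing with distinct abscissas is the set of points of a configuration. -/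
theorem exists_incidenceConfiguration {x : V × Fin 2 → ℂ} (hx : x ∈ T.genericDrawings)
    (hinj : Function.Injective fun v => x (v, 0)) :
    ∃ y : T.Node × Fin 2 → ℂ,
      IsIncidenceConfiguration T.Adj (fun i => Sum.inl (T.corner i)) y ∧
      ∀ v j, y (Sum.inl v, j) = x (v, j) := by
  have hline : ∀ C : T.constraints, ∃ m b : ℂ, ∀ v ∈ C.1, x (v, 1) + b = x (v, 0) * m := by
    intro C
    obtain ⟨v, hv, w, hw, hvw⟩ := T.constraint_nontrivial C.2
    obtain ⟨m, b, h⟩ := (hx.1.1 C.1 C.2).exists_forall_add_eq_mul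
      (Set.mem_image_of_mem _ hv) (Set.mem_image_of_mem _ hw) (hinj.ne hvw)
    exact ⟨m, b, fun u hu => h _ (Set.mem_image_of_mem _ hu)⟩
  choose m b h using hline
  let y : T.Node × Fin 2 → ℂ := fun i =>
    Sum.elim (fun v => x (v, i.2)) (fun C => if i.2 = 0 then m C else b C) i.1
  have hyv : ∀ v j, y (Sum.inl v, j) = x (v, j) := fun _ _ => rfl
  have hym : ∀ C, y (Sum.inr C, 0) = m C := fun _ => rfl
  have hyb : ∀ C, y (Sum.inr C, 1) = b C := fun _ => rfl
  refine ⟨y, ⟨?_, ?_, ?_⟩, hyv⟩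
  · rintro (v | C) (w | C') hadj
    · exact hadj.elim
    · exact h _ _ hadj
    · rw [add_comm, mul_comm]
      exact h _ _ hadj
    · exact hadj.elim
  · rintro (v | C) (w | C') (w' | C'') h1 h2 hne
    · exact h1.elim
    · exact h1.elim
    · exact h2.elim
    · rw [hym, hym]
      intro hmm
      have hne' : C' ≠ C'' := fun h => hne (h ▸ rfl)
      refine hx.2.2.2.2 C'.1 C'.2 C''.1 C''.2 (Subtype.coe_injective.ne hne')
        ⟨v, Finset.mem_inter.mpr ⟨h1, h2⟩⟩ ?_
      -- Two lines through `v` with equal slopes also have equal intercepts, hence coincide, which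
      -- genericity forbids.
      have hbb : b C' = b C'' := by
        have e1 := h C' v h1
        have e2 := h C'' v h2
        rw [← hmm] at e2
        exact add_left_cancel (e1.trans e2.symm)
      refine Collinear.affineSpan_eq_affineSpan
        (collinear_of_forall_mul_sub_eq (m := m C') (b := b C') ?_)
        ((T.constraint_nontrivial C'.2).image hx.2.2.2.1)
        ((T.constraint_nontrivial C''.2).image hx.2.2.2.1)
      rintro _ (⟨u, hu, rfl⟩ | ⟨u, hu, rfl⟩)
      · exact h C' u hu
      · rw [hmm, hbb]
        exact h C'' u hu
    · exact hinj.ne fun h => hne (h ▸ rfl)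
    · exact h2.elim
    · exact h1.elim
    · exact h1.elim
  · intro j
    exact congrFun hx.1.2 j

/-- The points of a configuration form a drawing. -/
theorem mem_drawingSpace_of_incident {y : T.Node × Fin 2 → ℂ}
    (hy : ∀ e f, T.Adj e f → y (e, 1) + y (f, 1) = y (e, 0) * y (f, 0))
    (hc : ∀ j, y (Sum.inl (T.corner 0), j) + y (Sum.inl (T.corner 2), j) =
      y (Sum.inl (T.corner 1), j) + y (Sum.inl (T.corner 3), j)) :
    (fun i : V × Fin 2 => y (Sum.inl i.1, i.2)) ∈ T.drawingSpace := by
  refine ⟨fun C hC => ?_, funext hc⟩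
  refine collinear_of_forall_mul_sub_eq (m := y (Sum.inr ⟨C, hC⟩, 0))
    (b := y (Sum.inr ⟨C, hC⟩, 1)) ?_
  rintro _ ⟨v, hv, rfl⟩
  exact hy (Sum.inl v) (Sum.inr ⟨C, hC⟩) hv

end ConstrainedTriangulation

end

/-! ### The generic point and the theorem -/

open MvPolynomial

namespace ConstrainedTriangulation

/-- A drawable triangulation has a generic drawing with coordinates in a rational function field:
the ideal of the generic drawings is the kernel of the evaluation there. -/
theorem exists_generic_point.{u} {V : Type u} [Fintype V] [DecidableEq V]
    (T : ConstrainedTriangulation V) (hT : T.Drawable) :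
    ∃ (K : Type u) (_ : Field K) (_ : Algebra ℂ K) (r : V × Fin 2 → K) (d : ℕ) (y : Fin d → K),
      vanishingIdeal ℂ T.genericDrawings = RingHom.ker (aeval (R := ℂ) r) ∧
      AlgebraicIndependent ℂ y ∧
      IntermediateField.adjoin ℂ (Set.range r) = IntermediateField.adjoin ℂ (Set.range y) := by
  classical
  obtain ⟨ρ, hρ⟩ := hT
  have hx₀ : (fun i : V × Fin 2 => ρ i.1 i.2) ∈ T.genericDrawings := hρ
  set x₀ : V × Fin 2 → ℂ := fun i => ρ i.1 i.2
  obtain ⟨x₁, hx₁, hinj₁⟩ := closure_nonempty_iff.mp ⟨x₀, T.mem_closure_shear hx₀⟩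
  obtain ⟨y₁, hy₁, hyx₁⟩ := T.exists_incidenceConfiguration hx₁ hinj₁
  let c : Fin 4 → T.Node := fun i => Sum.inl (T.corner i)
  have himage : Finset.univ.image c = T.corners.map ⟨Sum.inl, Sum.inl_injective⟩ := by
    ext
    simp [corners, c]
  let S : Finset T.Node := Finset.univ.filter fun e => ∀ i, c i ≠ e
  have hmem : ∀ e, e ∈ S ∪ Finset.univ.image c := by
    intro e
    simp only [S, Finset.mem_union, Finset.mem_filter, Finset.mem_image, Finset.mem_univ, true_and]
    by_contra! h
    obtain ⟨⟨i, hi⟩, h⟩ := h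
    exact h i hi
  obtain ⟨τ, r, h1, h2, h3, h4, h5⟩ := exists_generic_incidenceConfiguration (R := T.Adj) (c := c)
    (fun _ _ => T.adj_symm) T.node_adj_irrefl (Sum.inl_injective.comp T.corner_injective)
    (fun _ _ => id) (fun S hS hc => by
      rw [himage]
      convert T.exists_card_filter_adj_le_two ⟨ρ, hρ⟩ S hS hc) ⟨y₁, hy₁⟩
    S (by simp [S])
  replace h1 := fun e f => h1 e (hmem e) f (hmem f)
  replace h3 := fun e => h3 e (hmem e)
  replace h5 := fun x hx e => h5 x hx e (hmem e)
  let K := FractionRing (MvPolynomial (T.Node × Fin 2) ℂ)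
  let Y : T.Node × Fin 2 → K := fun i => algebraMap (MvPolynomial (T.Node × Fin 2) ℂ) K (X i)
  let pt : V × Fin 2 → K := fun i => r (Sum.inl i.1, i.2)
  obtain ⟨d, ⟨e⟩⟩ := Finite.exists_equiv_fin τ
  -- evaluation at the generic point specializes to evaluation at generic drawings
  have hker₁ : ∀ F, aeval pt F = 0 → ∀ x ∈ T.genericDrawings, eval x F = 0 := by
    intro F hF x hx
    have hcl : IsClosed {y : V × Fin 2 → ℂ | eval y F = 0} :=
      isClosed_eq (continuous_eval F) continuous_const
    -- Vertical lines have no slope, so only drawings with distinct abscissas are specializations;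
    -- by density these suffice.
    refine hcl.closure_subset_iff.mpr ?_ (T.mem_closure_shear hx)
    rintro z ⟨hz, hzinj⟩
    obtain ⟨y, hy, hyz⟩ := T.exists_incidenceConfiguration hz hzinj
    have := SpecializesTo.aeval (t := y) (r := pt) (x := z)
      (fun i => by simpa only [hyz] using h5 y hy (Sum.inl i.1) i.2) F
    rw [hF] at this
    exact this.eq_zero
  obtain ⟨f, hf₀, hfx⟩ := T.exists_polynomial_of_mem_genericDrawings hx₀
  have hker₂ : ∀ F ∈ vanishingIdeal ℂ T.genericDrawings, aeval pt F = 0 := by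
    intro F hF
    by_contra hne
    have hf : aeval pt f ≠ 0 := fun h => hf₀ (hker₁ f h x₀ hx₀)
    have hFf : aeval pt (F * f) ≠ 0 := by
      rw [map_mul]
      exact mul_ne_zero hne hf
    -- Choose a point where all coordinates and also the inverse of `F * f` at the generic point are
    -- defined. The specialization is a drawing at which `F * f` is nonzero; it is generic because
    -- `f` is nonzero there, and `F` does not vanish at it.
    obtain ⟨t, ht⟩ := SpecializesTo.exists_forall
      (fun i : Option (T.Node × Fin 2) => i.elim (aeval pt (F * f))⁻¹ r)
    obtain ⟨w, hw⟩ := ht none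
    choose z hz using fun i => ht (some i)
    let x : V × Fin 2 → ℂ := fun i => z (Sum.inl i.1, i.2)
    have hxD : x ∈ T.drawingSpace := by
      refine T.mem_drawingSpace_of_incident (fun e f hef => ?_) fun j => ?_
      · have := ((hz (e, 1)).add (hz (f, 1))).sub ((hz (e, 0)).mul (hz (f, 0)))
        simp only [Option.elim, h1 e f hef, sub_self] at this
        exact sub_eq_zero.mp this.eq_zero
      · have := ((hz (c 0, j)).add (hz (c 2, j))).sub ((hz (c 1, j)).add (hz (c 3, j)))
        simp only [Option.elim, h2 j, sub_self] at this
        exact sub_eq_zero.mp this.eq_zero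
    have hx : eval x (F * f) ≠ 0 := by
      intro h0
      have := (SpecializesTo.aeval (t := t) (r := pt) (x := x) (fun i => hz _) (F * f)).mul hw
      rw [h0, zero_mul] at this
      simp only [Option.elim, mul_inv_cancel₀ hFf] at this
      have h' := this.sub (by simpa using SpecializesTo.algebraMap t 1)
      rw [sub_self] at h'
      simpa using h'.eq_zero
    rw [map_mul] at hx
    exact left_ne_zero_of_mul hx (hF x (hfx x hxD (right_ne_zero_of_mul hx)))
  refine ⟨K, inferInstance, inferInstance, pt, d, fun k => Y (e.symm k).1, ?_, ?_, ?_⟩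
  · ext F
    exact ⟨hker₂ F, fun h x hx => hker₁ F h x hx⟩
  · have hX := (algebraicIndependent_X (T.Node × Fin 2) ℂ).map'
      (f := IsScalarTower.toAlgHom ℂ (MvPolynomial (T.Node × Fin 2) ℂ) K)
      (FaithfulSMul.algebraMap_injective _ _)
    exact hX.comp _ (Subtype.val_injective.comp e.symm.injective)
  · have hrange : (Set.range fun k => Y (e.symm k).1) = Y '' τ := by
      rw [Set.image_eq_range]
      exact e.symm.surjective.range_comp (fun i : τ => Y i.1)
    rw [hrange]
    apply le_antisymm
    · rw [IntermediateField.adjoin_le_iff]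
      rintro _ ⟨i, rfl⟩
      exact h3 _ _
    · have hv : ∀ v j, r (Sum.inl v, j) ∈ IntermediateField.adjoin ℂ (Set.range pt) :=
        fun v j => IntermediateField.subset_adjoin _ _ ⟨(v, j), rfl⟩
      -- Slope and intercept of a line are rational in the coordinates of two of its points. So the
      -- points alone generate the free parameters, including those that belong to lines.
      have hmem : ∀ i j, r (i, j) ∈ IntermediateField.adjoin ℂ (Set.range pt) := by
        rintro (v | C)
        · exact hv v
        · obtain ⟨v, hvC, w, hwC, hvw⟩ := T.constraint_nontrivial C.2
          have hne : r (Sum.inl v, 0) - r (Sum.inl w, 0) ≠ 0 :=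
            ((h5 y₁ hy₁ (Sum.inl v) 0).sub (h5 y₁ hy₁ (Sum.inl w) 0)).ne_zero
              (sub_ne_zero.mpr (hy₁.separated (Sum.inr C) _ _ hvC hwC
                (Sum.inl_injective.ne hvw)))
          have e1 := h1 (Sum.inl v) (Sum.inr C) hvC
          have e2 := h1 (Sum.inl w) (Sum.inr C) hwC
          have ha : r (Sum.inr C, 0) ∈ IntermediateField.adjoin ℂ (Set.range pt) := by
            rw [show r (Sum.inr C, 0) = (r (Sum.inl v, 1) - r (Sum.inl w, 1)) /
              (r (Sum.inl v, 0) - r (Sum.inl w, 0)) by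
                rw [eq_div_iff hne]; linear_combination e2 - e1]
            exact div_mem (sub_mem (hv _ _) (hv _ _)) (sub_mem (hv _ _) (hv _ _))
          rw [Fin.forall_fin_two]
          refine ⟨ha, ?_⟩
          rw [show r (Sum.inr C, 1) = r (Sum.inl v, 0) * r (Sum.inr C, 0) - r (Sum.inl v, 1) by
            rw [← e1]; ring]
          exact sub_mem (mul_mem (hv _ _) ha) (hv _ _)
      rw [IntermediateField.adjoin_le_iff]
      rintro _ ⟨i, hi, rfl⟩
      change Y i ∈ IntermediateField.adjoin ℂ (Set.range pt)
      rw [show Y i = r i from (h4 i hi).2.symm]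
      exact hmem i.1 i.2

end ConstrainedTriangulation

theorem mainTheorem3 {V : Type*} [Fintype V] [DecidableEq V]
    (T : ConstrainedTriangulation V) (hT : T.Drawable) :
    IsAffineVariety T.drawingSpace ∧
      IsIrreducibleVariety T.genericDrawingSpace ∧
      IsRationalVariety T.genericDrawingSpace ∧
      IsIrreducibleComponent T.genericDrawingSpace T.drawingSpace := by
  have hD := T.isAffineVariety_drawingSpace
  obtain ⟨K, _, _, r, d, y, hI, hy, hry⟩ := T.exists_generic_point hT
  have hprime : (vanishingIdeal ℂ T.genericDrawings).IsPrime := by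
    rw [hI]
    exact RingHom.ker_isPrime _
  obtain ⟨ρ, hρ⟩ := hT
  obtain ⟨f, hf₀, hf⟩ := T.exists_polynomial_of_mem_genericDrawings
    (x₀ := fun i : V × Fin 2 => ρ i.1 i.2) hρ
  have hfI : f ∉ vanishingIdeal ℂ T.genericDrawings := fun h => hf₀ (h _ hρ)
  have hcl : T.genericDrawingSpace = zeroLocus ℂ (vanishingIdeal ℂ T.genericDrawings) :=
    closure_eq_zeroLocus_vanishingIdeal (Z := T.genericDrawings) hD T.genericDrawings_subset hfI hf
  have hirr := isIrreducibleVariety_zeroLocus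
    (vanishingIdeal_zeroLocus_vanishingIdeal T.genericDrawings)
  rw [hcl]
  refine ⟨hD, hirr, ⟨hirr, d, ?_⟩,
    isIrreducibleComponent_zeroLocus_vanishingIdeal hD T.genericDrawings_subset hfI hf⟩
  exact nonempty_fractionRing_quotient_ker_algEquiv r
    ((vanishingIdeal_zeroLocus_vanishingIdeal _).trans hI) hy hry
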